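/- **Theorem 3.3 (Cycle phases).** *Geometry.* $\mathbb{R}^4$ is Minkowski space with metric $g=\mathrm{diag}(1,-1,-1,-1)$; $X\perp Y$ means $(x-y)^2<0$ for all $x\in X$, $y\in Y$; $K$ is the set of open double cones; $\mathscr{P}^\uparrow_+=\{P=(x,L)\}$ is the restricted Poincaré group, $Py=x+Ly$, and ${L_\mu}^\nu:=g_{\mu\alpha}{L^\alpha}_\beta g^{\beta\nu}$. *Field.* Let $F$ be a quantum electromagnetic field on a Hilbert space $\mathcal{H}$, that is: - a strongly continuous unitary representation $U$ of $\mathscr{P}^\uparrow_+$ satisfying the spectrum condition, with an invariant unit vector $\Omega$ that is unique up to a scalar; - operators $F_{\mu\nu}(f)$, real linear in $f\in\mathcal{S}(\mathbb{R}^4)$ (real valued), defined on a common dense domain $\mathcal{D}\ni\Omega$, with $F_{\mu\nu}(f)\mathcal{D}\subseteq\mathcal{D}$ and $U(P)\mathcal{D}\subseteq\mathcal{D}$, whose matrix elements $f\mapsto(\phi,F_{\mu\nu}(f)\psi)$, $\phi,\psi\in\mathcal{D}$, are tempered distributions, and such that $F_{\mu\nu}(f)$ and the contractions $\sum_\nu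 F_{\mu\nu}(f^\nu)$ and $\sum_{\mu,\nu}F_{\mu\nu}(f^{\mu\nu})$ with $\mathcal{S}(\mathbb{R}^4)$-valued 1- and 2-tensors are essentially self-adjoint on $\mathcal{D}$; - covariance on $\mathcal{D}$: $U(P)F_{\mu\nu}(f)U(P)^*={(L^{-1})_\mu}^\alpha{(L^{-1})_\nu}^\beta F_{\alpha\beta}(f\circ P^{-1})$ for $P=(x,L)$; - strong causality: $[\exp(iF_{\mu\nu}(f)),\exp(iF_{\alpha\beta}(h))]=0$ whenever $\mathrm{supp}(f)\perp\mathrm{supp}(h)$; - antisymmetry $F_{\mu\nu}=-F_{\nu\mu}$ and the first Maxwell equation $F_{\mu\nu}(\partial_\rho f)+F_{\nu\rho}(\partial_\mu f)+F_{\rho\mu}(\partial_\nu f)=0$. (The current $\partial^\mu F_{\mu\nu}$ is not restricted.) In exponentials, an essentially self-adjoint operator stands for its closure. *Simplices.* A singular $n$-simplex is a piecewise smooth map $\chi:\Delta_n\to\mathbb{R}^4$ on $\Delta_n=\{t\in\mathbb{R}^n: t_i\ge0,\ \sum_i t_i\le1\}$; here piecewise smooth means Lipschitz on $\Delta_n$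 and $C^\infty$ on each of the (relatively open) pieces, of all dimensions, into which some finite family of affine hyperplanes divides $\Delta_n$. Put $\partial\chi=\sum_i(-1)^i\partial_i\chi$, a formal integer combination of $(n-1)$-simplices. A smearing function is a real $f\in\mathcal{S}(\mathbb{R}^4)$ with $0\in\mathrm{supp}(f)$. For an $n$-simplex $\chi$ let $$\chi[f]^{\alpha_1\cdots\alpha_n}(x)=\int_{\Delta_n}f(x-\chi(t))\,\det\big(\partial\chi^{\alpha_i}/\partial t_j\big)(t)\,d^nt ,$$ extended linearly to chains; these components lie in $\mathcal{S}(\mathbb{R}^4)$. The support $|(\ell,f)|$ of a chain $\ell$ smeared with $f$ is the support of the form $\ell[f]$, and $P(\ell,f)=(P\ell,f\circ L^{-1})$. For a surface (2-simplex) $\sigma$ put $F\langle\sigma,f\rangle=\tfrac12\sum_{\mu,\nu}F_{\mu\nu}(\sigma[f]^{\mu\nu})$, an operator on $\mathcal{D}$. Let $\partial\Sigma_2(\mathbb{R}^4,\mathcal{S})$ be the set of pairs $(\ell,f)$ where $f$ is a smearing function and $\ell=\partial\sigma$ for some surface $\sigma$. *Claim.* Every closed piecewise smooth curve $\gamma$,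 $\gamma(0)=\gamma(1)$, is of the form $\gamma=\partial\sigma$, so that closed smearing curves belong to $\partial\Sigma_2(\mathbb{R}^4,\mathcal{S})$. There is exactly one map $w$ from $\partial\Sigma_2(\mathbb{R}^4,\mathcal{S})$ to the unitary operators of $\mathcal{H}$ such that $$w(\ell,f)=\exp(iF\langle\sigma,f\rangle)\qquad\text{for every surface }\sigma\text{ with }\partial\sigma=\ell ,$$ i.e. the right-hand side is independent of the spanning surface. It is Poincaré covariant, $$U(P)\,w(\ell,f)\,U(P)^*=w(P(\ell,f)),\qquad P\in\mathscr{P}^\uparrow_+ ,$$ and causal: if $o_1,o_2\in K$, $o_1\perp o_2$, $|(\ell_1,f_1)|\subseteq o_1$ and $|(\ell_2,f_2)|\subseteq o_2$, then $[w(\ell_1,f_1),w(\ell_2,f_2)]=0$. -/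

import Mathlib

open scoped SchwartzMap Matrix ContDiff LineDeriv InnerProductSpace
open MeasureTheory Set

noncomputable section

namespace QEM

/-! ### Minkowski space, causal disjointness, double cones -/

/-- Minkowski space-time `ℝ⁴`, with coordinates `x⁰, x¹, x², x³`. -/
abbrev Mink : Type := Fin 4 → ℝ

/-- The metric tensor `g = diag(1,-1,-1,-1)`. -/
def metric : Matrix (Fin 4) (Fin 4) ℝ := Matrix.diagonal ![1, -1, -1, -1]

/-- The Minkowski inner product `x · y = (x, g y)`. -/
def minkInner (x y : Mink) : ℝ := x ⬝ᵥ (metric *ᵥ y)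

/-- `X ⊥ Y`: all points of `X` are spacelike separated from all points of `Y`. -/
def CausallyDisjoint (X Y : Set Mink) : Prop :=
  ∀ x ∈ X, ∀ y ∈ Y, minkInner (x - y) (x - y) < 0

/-- The open forward light cone. -/
def forwardCone : Set Mink := {v | 0 < minkInner v v ∧ 0 < v 0}

/-- The (open) double cone with past tip `p` and future tip `q`. -/
def doubleCone (p q : Mink) : Set Mink := {x | x - p ∈ forwardCone ∧ q - x ∈ forwardCone}

/-- The set `K` of double cones of Minkowski space-time. -/
def doubleCones : Set (Set Mink) := {o | ∃ p q : Mink, q - p ∈ forwardCone ∧ o = doubleCone p q}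

/-! ### The restricted Lorentz group and the Poincaré group -/

theorem metric_mul_metric : metric * metric = 1 := by
  ext i j
  fin_cases i <;> fin_cases j <;> simp [metric]

theorem lorentz_transpose {A : Matrix (Fin 4) (Fin 4) ℝ} (h : Aᵀ * metric * A = metric) :
    A * metric * Aᵀ = metric := by
  have h1 : (metric * Aᵀ * metric) * A = 1 := by
    rw [Matrix.mul_assoc, Matrix.mul_assoc, ← Matrix.mul_assoc Aᵀ, h, metric_mul_metric]
  have h2 : A * (metric * Aᵀ * metric) = 1 := mul_eq_one_comm.mp h1
  calc A * metric * Aᵀ = A * (metric * Aᵀ * metric) * metric := by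
        simp only [Matrix.mul_assoc, metric_mul_metric, Matrix.mul_one]
    _ = metric := by rw [h2, Matrix.one_mul]

theorem lorentz_time_mul {A B : Matrix (Fin 4) (Fin 4) ℝ} (hA : Aᵀ * metric * A = metric)
    (hB : Bᵀ * metric * B = metric) (hA0 : 1 ≤ A 0 0) (hB0 : 1 ≤ B 0 0) : 1 ≤ (A * B) 0 0 := by
  have key : ∀ {C : Matrix (Fin 4) (Fin 4) ℝ}, Cᵀ * metric * C = metric →
      C 0 0 ^ 2 = 1 + (C 1 0 ^ 2 + C 2 0 ^ 2 + C 3 0 ^ 2) := by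
    intro C hC
    have := congrFun (congrFun hC 0) 0
    simp [metric, Matrix.mul_apply, Fin.sum_univ_four, Matrix.diagonal] at this
    linarith
  have hAB : (A * B)ᵀ * metric * (A * B) = metric := by
    rw [Matrix.transpose_mul]
    calc Bᵀ * Aᵀ * metric * (A * B) = Bᵀ * (Aᵀ * metric * A) * B := by
          simp only [Matrix.mul_assoc]
      _ = metric := by rw [hA, hB]
  have h1 := key hB
  have h2 := key (C := Aᵀ) (by simpa using lorentz_transpose hA)
  have h3 := key hAB
  simp only [Matrix.transpose_apply] at h2
  have e : (A * B) 0 0 =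
      A 0 0 * B 0 0 + (A 0 1 * B 1 0 + A 0 2 * B 2 0 + A 0 3 * B 3 0) := by
    simp [Matrix.mul_apply, Fin.sum_univ_four]; ring
  set r := A 0 1 * B 1 0 + A 0 2 * B 2 0 + A 0 3 * B 3 0 with hr
  have cs : r ^ 2 ≤ (A 0 1 ^ 2 + A 0 2 ^ 2 + A 0 3 ^ 2) * (B 1 0 ^ 2 + B 2 0 ^ 2 + B 3 0 ^ 2) := by
    rw [hr]
    nlinarith [sq_nonneg (A 0 1 * B 2 0 - A 0 2 * B 1 0), sq_nonneg (A 0 1 * B 3 0 - A 0 3 * B 1 0),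
      sq_nonneg (A 0 2 * B 3 0 - A 0 3 * B 2 0)]
  have cs2 : r ^ 2 < (A 0 0 * B 0 0) ^ 2 := by
    rw [mul_pow, h1, h2]
    nlinarith [sq_nonneg (A 0 1), sq_nonneg (A 0 2), sq_nonneg (A 0 3), sq_nonneg (B 1 0),
      sq_nonneg (B 2 0), sq_nonneg (B 3 0)]
  have hpos : 0 < (A * B) 0 0 := by
    have h4 : |r| < A 0 0 * B 0 0 := abs_lt_of_sq_lt_sq cs2 (by positivity)
    rw [e]
    linarith [neg_abs_le r]
  nlinarith [sq_nonneg ((A * B) 1 0), sq_nonneg ((A * B) 2 0), sq_nonneg ((A * B) 3 0)]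

theorem lorentz_inv {A B : Matrix (Fin 4) (Fin 4) ℝ} (hA : Aᵀ * metric * A = metric)
    (hAB : A * B = 1) : B = metric * Aᵀ * metric := by
  have h1 : (metric * Aᵀ * metric) * A = 1 := by
    rw [Matrix.mul_assoc, Matrix.mul_assoc, ← Matrix.mul_assoc Aᵀ, hA, metric_mul_metric]
  calc B = (metric * Aᵀ * metric) * A * B := by rw [h1, Matrix.one_mul]
    _ = metric * Aᵀ * metric := by rw [Matrix.mul_assoc _ A B, hAB, Matrix.mul_one]

/-- The restricted Lorentz group: `Lᵀ g L = g`, `det L > 0`, `L⁰₀ ≥ 1`. -/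
def restrictedLorentz : Subgroup (Matrix.GeneralLinearGroup (Fin 4) ℝ) where
  carrier := {L | (L.val)ᵀ * metric * L.val = metric ∧ 0 < L.val.det ∧ 1 ≤ L.val 0 0}
  one_mem' := by simp
  mul_mem' := by
    rintro A B ⟨hA, hA', hA0⟩ ⟨hB, hB', hB0⟩
    refine ⟨?_, ?_, ?_⟩
    · rw [Units.val_mul, Matrix.transpose_mul]
      calc (B.val)ᵀ * (A.val)ᵀ * metric * (A.val * B.val)
          = (B.val)ᵀ * ((A.val)ᵀ * metric * A.val) * B.val := by simp only [Matrix.mul_assoc]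
        _ = metric := by rw [hA, hB]
    · rw [Units.val_mul, Matrix.det_mul]; positivity
    · rw [Units.val_mul]; exact lorentz_time_mul hA hB hA0 hB0
  inv_mem' := by
    rintro A ⟨hA, hA', hA0⟩
    have hi : A.val * (A⁻¹).val = 1 := A.mul_inv
    have e := lorentz_inv hA hi
    refine ⟨?_, ?_, ?_⟩
    · have ht : (A⁻¹).valᵀ * A.valᵀ = 1 := by rw [← Matrix.transpose_mul, hi, Matrix.transpose_one]
      calc (A⁻¹).valᵀ * metric * (A⁻¹).val
          = (A⁻¹).valᵀ * (A.valᵀ * metric * A.val) * (A⁻¹).val := by rw [hA]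
        _ = ((A⁻¹).valᵀ * A.valᵀ) * metric * (A.val * (A⁻¹).val) := by
            simp only [Matrix.mul_assoc]
        _ = metric := by rw [ht, hi, Matrix.one_mul, Matrix.mul_one]
    · have hd : A.val.det * (A⁻¹).val.det = 1 := by rw [← Matrix.det_mul, hi, Matrix.det_one]
      by_contra hneg
      nlinarith [not_lt.mp hneg]
    · rw [e]
      simpa [metric, Matrix.diagonal_mul, Matrix.mul_diagonal] using hA0

/-- The matrix of a restricted Lorentz transformation. -/
abbrev lmat (L : restrictedLorentz) : Matrix (Fin 4) (Fin 4) ℝ :=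
  (L : Matrix.GeneralLinearGroup (Fin 4) ℝ).val

/-- The Poincaré group (semidirect product of translations and restricted Lorentz
transformations); its elements are pairs `(x, L)`. -/
@[ext] structure Poincare where
  /-- the translation part -/
  trans : Mink
  /-- the Lorentz part -/
  lor : restrictedLorentz

namespace Poincare

instance : Mul Poincare := ⟨fun P Q => ⟨P.trans + lmat P.lor *ᵥ Q.trans, P.lor * Q.lor⟩⟩
instance : One Poincare := ⟨⟨0, 1⟩⟩
instance : Inv Poincare := ⟨fun P => ⟨-(lmat P.lor⁻¹ *ᵥ P.trans), P.lor⁻¹⟩⟩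

theorem lmat_inv_mul (L : restrictedLorentz) : lmat L⁻¹ * lmat L = 1 := by
  simp [lmat]

theorem lmat_mul_inv (L : restrictedLorentz) : lmat L * lmat L⁻¹ = 1 := by
  simp [lmat]

instance : Group Poincare :=
  Group.ofLeftAxioms
    (by
      intro P Q R
      refine Poincare.ext ?_ (mul_assoc _ _ _)
      change (P.trans + lmat P.lor *ᵥ Q.trans) + lmat (P.lor * Q.lor) *ᵥ R.trans
        = P.trans + lmat P.lor *ᵥ (Q.trans + lmat Q.lor *ᵥ R.trans)
      have : lmat (P.lor * Q.lor) = lmat P.lor * lmat Q.lor := rfl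
      rw [this, Matrix.mulVec_add, Matrix.mulVec_mulVec, add_assoc])
    (by
      intro P
      refine Poincare.ext ?_ (one_mul _)
      change (0 : Mink) + lmat 1 *ᵥ P.trans = P.trans
      have : lmat 1 = 1 := rfl
      rw [this, Matrix.one_mulVec, zero_add])
    (by
      intro P
      refine Poincare.ext ?_ (inv_mul_cancel _)
      change -(lmat P.lor⁻¹ *ᵥ P.trans) + lmat P.lor⁻¹ *ᵥ P.trans = 0
      rw [neg_add_cancel])

/-- The topology of the Poincaré group as a subset of `ℝ⁴ × ℝ^{4×4}`. -/
instance : TopologicalSpace Poincare :=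
  TopologicalSpace.induced (fun P => (P.trans, lmat P.lor)) inferInstance

/-- The translation by `x`. -/
def translation (x : Mink) : Poincare := ⟨x, 1⟩

/-- The action `y ↦ x + L y` of `P = (x, L)` on space-time. -/
def act (P : Poincare) (y : Mink) : Mink := P.trans + lmat P.lor *ᵥ y

end Poincare

/-- Real test functions on space-time. -/
abbrev Test : Type := 𝓢(Mink, ℝ)

/-- A restricted Lorentz transformation as a linear homeomorphism of space-time. -/
def lorentzEquiv (L : restrictedLorentz) : Mink ≃L[ℝ] Mink :=
  (LinearEquiv.ofLinearMap (Matrix.toLin' (lmat L)) (Matrix.toLin' (lmat L⁻¹))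
    (by rw [← Matrix.toLin'_mul, Poincare.lmat_mul_inv, Matrix.toLin'_one])
    (by rw [← Matrix.toLin'_mul, Poincare.lmat_inv_mul, Matrix.toLin'_one])).toContinuousLinearEquiv

/-- The transformed test function `f_L = f ∘ L⁻¹`. -/
def testLor (L : restrictedLorentz) (f : Test) : Test :=
  SchwartzMap.compCLMOfContinuousLinearEquiv ℝ (lorentzEquiv L⁻¹) f

/-- The transformed test function `f_P = f ∘ P⁻¹`, i.e. `y ↦ f (L⁻¹ (y - x))` for `P = (x, L)`. -/
def testAct (P : Poincare) (f : Test) : Test :=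
  SchwartzMap.compSubConstCLM ℝ P.trans (testLor P.lor f)

theorem testLor_apply (L : restrictedLorentz) (f : Test) (y : Mink) :
    testLor L f y = f (lmat L⁻¹ *ᵥ y) := rfl

theorem testAct_apply (P : Poincare) (f : Test) (y : Mink) :
    testAct P f y = f (P⁻¹.act y) := by
  change f (lmat P.lor⁻¹ *ᵥ (y - P.trans)) = f (-(lmat P.lor⁻¹ *ᵥ P.trans) + lmat P.lor⁻¹ *ᵥ y)
  rw [Matrix.mulVec_sub]
  congr 1
  abel

/-! ### Singular piecewise smooth simplices -/

/-- The standard simplex `{t ∈ ℝⁿ | tᵢ ≥ 0, ∑ tᵢ ≤ 1}`. -/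
def Delta (n : ℕ) : Set (Fin n → ℝ) := {t | (∀ i, 0 ≤ t i) ∧ ∑ i, t i ≤ 1}

/-- A map is piecewise smooth on the standard simplex if it is Lipschitz there (continuous, with
bounded first derivatives) and if, for some finite arrangement of affine hyperplanes, it is smooth
on each of the finitely many (relatively open, convex) pieces, of any dimension, into which the
arrangement cuts the simplex: a piece is the set of points at which each of the affine functions
`a ∈ A` has a prescribed sign. The derivatives may jump across, or fail to exist on, lower
dimensional pieces; in particular, cones over piecewise smooth simplices are included. -/
def PiecewiseSmoothOn {n : ℕ} (φ : (Fin n → ℝ) → Mink) : Prop :=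
  (∃ K, LipschitzOnWith K φ (Delta n)) ∧
  ∃ A : Finset ((Fin n → ℝ) →ᵃ[ℝ] ℝ), ∀ s : ((Fin n → ℝ) →ᵃ[ℝ] ℝ) → SignType,
    ContDiffOn ℝ ∞ φ {t ∈ Delta n | ∀ a ∈ A, SignType.sign (a t) = s a}

/-- A map on the standard simplex, extended by `0` to all of `ℝⁿ`. -/
def extendZero {n : ℕ} (φ : Delta n → Mink) : (Fin n → ℝ) → Mink :=
  Function.extend Subtype.val φ 0

/-- Singular piecewise smooth `n`-simplices `χ : Δₙ → ℝ⁴`. -/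
@[ext] structure SingSimplex (n : ℕ) where
  /-- the underlying map -/
  toFun : Delta n → Mink
  piecewiseSmooth : PiecewiseSmoothOn (extendZero toFun)

theorem extendZero_apply {n : ℕ} (φ : Delta n → Mink) {t : Fin n → ℝ} (ht : t ∈ Delta n) :
    extendZero φ t = φ ⟨t, ht⟩ :=
  Subtype.val_injective.extend_apply φ 0 ⟨t, ht⟩

/-- The linear part of the `i`-th face inclusion. -/
def faceLin {n : ℕ} (i : Fin (n + 2)) : (Fin n → ℝ) →ₗ[ℝ] (Fin (n + 1) → ℝ) where
  toFun t := Fin.cases (Fin.cons (-∑ k, t k) t) (fun j : Fin (n + 1) => j.insertNth 0 t) i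
  map_add' t u := by
    refine Fin.cases ?_ (fun j => ?_) i
    · ext k
      refine Fin.cases ?_ (fun k => ?_) k
      · simp [Finset.sum_add_distrib]; ring
      · simp
    · ext k
      refine Fin.succAboveCases j ?_ (fun k => ?_) k <;> simp
  map_smul' c t := by
    refine Fin.cases ?_ (fun j => ?_) i
    · ext k
      refine Fin.cases ?_ (fun k => ?_) k
      · simp [Finset.mul_sum]
      · simp
    · ext k
      refine Fin.succAboveCases j ?_ (fun k => ?_) k <;> simp

/-- The `i`-th face inclusion: `(t₁,…,tₙ) ↦ (1 - ∑ tₖ, t₁, …, tₙ)` for `i = 0`, and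
`(t₁,…,tₙ) ↦ (t₁, …, tᵢ₋₁, 0, tᵢ, …, tₙ)` for `i > 0`. -/
def faceIncl {n : ℕ} (i : Fin (n + 2)) : (Fin n → ℝ) →ᵃ[ℝ] (Fin (n + 1) → ℝ) where
  toFun t := Fin.cases (Fin.cons (1 - ∑ k, t k) t) (fun j : Fin (n + 1) => j.insertNth 0 t) i
  linear := faceLin i
  map_vadd' t u := by
    refine Fin.cases ?_ (fun j => ?_) i
    · ext k
      refine Fin.cases ?_ (fun k => ?_) k
      · simp [faceLin, Finset.sum_add_distrib]; ring
      · simp [faceLin]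
    · ext k
      refine Fin.succAboveCases j ?_ (fun k => ?_) k <;> simp [faceLin]

theorem faceIncl_mem {n : ℕ} (i : Fin (n + 2)) {t : Fin n → ℝ} (ht : t ∈ Delta n) :
    faceIncl i t ∈ Delta (n + 1) := by
  obtain ⟨h0, h1⟩ := ht
  refine Fin.cases ?_ (fun j => ?_) i
  · constructor
    · intro k
      refine Fin.cases ?_ (fun k => ?_) k
      · simpa [faceIncl] using h1
      · simpa [faceIncl] using h0 k
    · simp [faceIncl, Fin.sum_univ_succ]
  · constructor
    · intro k
      refine Fin.succAboveCases j ?_ (fun k => ?_) k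
      · simp [faceIncl]
      · simpa [faceIncl] using h0 k
    · simpa [faceIncl, Fin.sum_univ_succAbove _ j] using h1

/-- The face map `∂ᵢ`. -/
def SingSimplex.face {n : ℕ} (i : Fin (n + 2)) (χ : SingSimplex (n + 1)) : SingSimplex n where
  toFun t := χ.toFun ⟨faceIncl i t, faceIncl_mem i t.2⟩
  piecewiseSmooth := by
    obtain ⟨⟨K, hK⟩, A, hA⟩ := χ.piecewiseSmooth
    set g : Delta n → Mink := fun t => χ.toFun ⟨faceIncl i t, faceIncl_mem i t.2⟩ with hg
    have e : EqOn (extendZero g) (extendZero χ.toFun ∘ faceIncl i) (Delta n) := by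
      intro t ht
      rw [extendZero_apply g ht, Function.comp_apply, extendZero_apply _ (faceIncl_mem i ht)]
    have hmaps : MapsTo (faceIncl i) (Delta n) (Delta (n + 1)) := fun t ht => faceIncl_mem i ht
    have hcont : ContDiff ℝ ∞ (faceIncl i : (Fin n → ℝ) → (Fin (n + 1) → ℝ)) :=
      (⟨faceIncl i, AffineMap.continuous_of_finiteDimensional _⟩ :
        (Fin n → ℝ) →ᴬ[ℝ] (Fin (n + 1) → ℝ)).contDiff
    constructor
    · have hl : LipschitzWith ‖LinearMap.toContinuousLinearMap (faceLin i)‖₊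
          (faceIncl i : (Fin n → ℝ) → (Fin (n + 1) → ℝ)) := by
        refine LipschitzWith.of_dist_le_mul fun t u => ?_
        rw [dist_eq_norm, dist_eq_norm]
        have : faceIncl i t - faceIncl i u = LinearMap.toContinuousLinearMap (faceLin i) (t - u) := by
          have := (faceIncl i).linearMap_vsub t u
          simp only [vsub_eq_sub] at this
          exact this.symm
        rw [this]
        exact ContinuousLinearMap.le_opNorm _ _
      refine ⟨K * ‖LinearMap.toContinuousLinearMap (faceLin i)‖₊, ?_⟩
      intro t ht u hu
      rw [e ht, e hu]
      exact (hK.comp hl.lipschitzOnWith hmaps) ht hu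
    · classical
      refine ⟨A.image fun a => a.comp (faceIncl i), fun s => ?_⟩
      have h1 := hA fun a => s (a.comp (faceIncl i))
      have h2 := h1.comp (hcont.contDiffOn
        (s := {t ∈ Delta n | ∀ a ∈ A.image fun a => a.comp (faceIncl i),
          SignType.sign (a t) = s a})) (by
          rintro t ⟨ht, hs⟩
          refine ⟨faceIncl_mem i ht, fun a ha => ?_⟩
          simpa using hs _ (Finset.mem_image_of_mem _ ha))
      exact h2.congr fun t ht => e ht.1

/-- The action of the Poincaré group on singular simplices, `(Pχ)(t) = x + L χ(t)`. -/
def SingSimplex.poincare {n : ℕ} (P : Poincare) (χ : SingSimplex n) : SingSimplex n where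
  toFun t := P.act (χ.toFun t)
  piecewiseSmooth := by
    obtain ⟨⟨K, hK⟩, A, hA⟩ := χ.piecewiseSmooth
    have e : EqOn (extendZero fun t => P.act (χ.toFun t)) (P.act ∘ extendZero χ.toFun)
        (Delta n) := by
      intro t ht
      rw [extendZero_apply _ ht, Function.comp_apply, extendZero_apply _ ht]
    have hP : P.act = fun y => P.trans + (lorentzEquiv P.lor : Mink →L[ℝ] Mink) y := rfl
    constructor
    · have hl : LipschitzWith ‖(lorentzEquiv P.lor : Mink →L[ℝ] Mink)‖₊ P.act := by
        refine LipschitzWith.of_dist_le_mul fun t u => ?_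
        rw [hP, dist_add_left]
        exact (lorentzEquiv P.lor : Mink →L[ℝ] Mink).lipschitz.dist_le_mul t u
      refine ⟨‖(lorentzEquiv P.lor : Mink →L[ℝ] Mink)‖₊ * K, fun t ht u hu => ?_⟩
      rw [e ht, e hu]
      exact (hl.comp_lipschitzOnWith hK) ht hu
    · refine ⟨A, fun s => ?_⟩
      have hc : ContDiff ℝ ∞ P.act := by
        rw [hP]
        exact contDiff_const.add (ContinuousLinearMap.contDiff _)
      exact (hc.comp_contDiffOn (hA s)).congr fun t ht => e ht.1

/-- The vertices of the standard simplex: `0` and the vectors of the canonical basis. -/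
def vertex {n : ℕ} (i : Fin (n + 1)) : Delta n :=
  ⟨Fin.cases 0 (fun j : Fin n => Pi.single j 1) i, by
    refine Fin.cases ?_ (fun j => ?_) i
    · constructor <;> simp
    · constructor
      · intro k
        by_cases h : k = j
        · subst h; simp
        · simp [h]
      · simp⟩

/-- Singular chains: finite formal linear combinations of singular simplices. -/
abbrev Chain (n : ℕ) : Type := SingSimplex n →₀ ℤ

/-- The boundary `∂χ = ∑ᵢ (-1)ⁱ ∂ᵢχ` of a simplex. -/
def SingSimplex.boundary {n : ℕ} (χ : SingSimplex (n + 1)) : Chain n :=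
  ∑ i : Fin (n + 2), Finsupp.single (χ.face i) ((-1) ^ (i : ℕ))

/-- The action of the Poincaré group on chains. -/
def chainAct {n : ℕ} (P : Poincare) (c : Chain n) : Chain n :=
  c.mapDomain (SingSimplex.poincare P)

theorem boundary_poincare {n : ℕ} (P : Poincare) (χ : SingSimplex (n + 1)) :
    (χ.poincare P).boundary = chainAct P χ.boundary := by
  unfold SingSimplex.boundary chainAct
  rw [Finsupp.mapDomain_finsetSum]
  refine Finset.sum_congr rfl fun i _ => ?_
  rw [Finsupp.mapDomain_single]
  congr 1

/-! ### Smearing -/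

/-- The Jacobian `χ^{α₁⋯αₙ}(t) = det (∂χ^{αᵢ}/∂tⱼ)(t)`, defined at almost every `t ∈ Δₙ`. For
`n = 1` it is `χ̇^α`, for `n = 2` it is `∂₁χ^μ ∂₂χ^ν - ∂₂χ^μ ∂₁χ^ν`. -/
def SingSimplex.jacobian {n : ℕ} (χ : SingSimplex n) (α : Fin n → Fin 4) (t : Fin n → ℝ) : ℝ :=
  Matrix.det (Matrix.of fun i j : Fin n =>
    fderiv ℝ (extendZero χ.toFun) t (Pi.single j 1) (α i))

/-- `χ[f]^α(x) = ∫_{Δₙ} f(x - χ(t)) χ^α(t) dⁿt`. -/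
def smearFun {n : ℕ} (χ : SingSimplex n) (f : Test) (α : Fin n → Fin 4) (x : Mink) : ℝ :=
  ∫ t in Delta n, f (x - extendZero χ.toFun t) * χ.jacobian α t

/-- Superpositions `∫ J(t) f(x - c(t)) dν(t)` of boundedly many translates of a Schwartz function,
with bounded weights, are Schwartz functions. -/
theorem schwartz_superposition {T : Type*} [MeasurableSpace T] (ν : Measure T) [IsFiniteMeasure ν]
    (c : T → Mink) (J : T → ℝ) (hc : AEStronglyMeasurable c ν) (hJ : AEStronglyMeasurable J ν)
    (R C : ℝ) (hcR : ∀ᵐ t ∂ν, ‖c t‖ ≤ R) (hJC : ∀ᵐ t ∂ν, ‖J t‖ ≤ C) (f : Test) :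
    ContDiff ℝ ∞ (fun x => ∫ t, f (x - c t) * J t ∂ν) ∧
    ∀ k n : ℕ, ∃ B : ℝ, ∀ x : Mink,
      ‖x‖ ^ k * ‖iteratedFDeriv ℝ n (fun x => ∫ t, f (x - c t) * J t ∂ν) x‖ ≤ B := by
  have hmeas : ∀ (n : ℕ) (x : Mink),
      AEStronglyMeasurable (fun t => J t • iteratedFDeriv ℝ n f (x - c t)) ν := by
    intro n x
    refine hJ.smul ?_
    have h1 : Continuous (iteratedFDeriv ℝ n f) :=
      f.smooth'.continuous_iteratedFDeriv (by exact_mod_cast le_top)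
    exact h1.comp_aestronglyMeasurable (aestronglyMeasurable_const.sub hc)
  have hbd : ∀ n : ℕ, ∃ B : ℝ, 0 ≤ B ∧ ∀ x : Mink, ∀ᵐ t ∂ν,
      ‖J t • iteratedFDeriv ℝ n f (x - c t)‖ ≤ B := by
    intro n
    obtain ⟨B, hB⟩ := f.decay' 0 n
    refine ⟨|C| * |B|, by positivity, fun x => ?_⟩
    filter_upwards [hJC] with t ht
    rw [norm_smul]
    have h2 := hB (x - c t)
    simp only [pow_zero, one_mul] at h2
    exact mul_le_mul (ht.trans (le_abs_self _)) (h2.trans (le_abs_self _)) (norm_nonneg _)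
      (abs_nonneg _)
  have hint : ∀ (n : ℕ) (x : Mink),
      Integrable (fun t => J t • iteratedFDeriv ℝ n f (x - c t)) ν := by
    intro n x
    obtain ⟨B, -, hB⟩ := hbd n
    exact Integrable.of_bound (hmeas n x) B (hB x)
  have hderiv : ∀ (n : ℕ) (x : Mink),
      HasFDerivAt (fun x => ∫ t, J t • iteratedFDeriv ℝ n f (x - c t) ∂ν)
        (∫ t, J t • iteratedFDeriv ℝ (n + 1) f (x - c t) ∂ν).curryLeft x := by
    intro n x
    obtain ⟨B, -, hB⟩ := hbd (n + 1)
    have hcurry : (∫ t, J t • iteratedFDeriv ℝ (n + 1) f (x - c t) ∂ν).curryLeft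
        = ∫ t, (J t • iteratedFDeriv ℝ (n + 1) f (x - c t)).curryLeft ∂ν := by
      let e : (Mink [×(n + 1)]→L[ℝ] ℝ) →L[ℝ] (Mink →L[ℝ] (Mink [×n]→L[ℝ] ℝ)) :=
        (continuousMultilinearCurryLeftEquiv ℝ (fun _ : Fin (n + 1) => Mink)
          ℝ).toContinuousLinearEquiv.toContinuousLinearMap
      exact (ContinuousLinearMap.integral_comp_comm (𝕜 := ℝ)
        (Fₗ := Mink →L[ℝ] (Mink [×n]→L[ℝ] ℝ)) e (hint (n + 1) x)).symm
    rw [hcurry]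
    have hnorm : ∀ (y : Mink) (t : T),
        ‖(J t • iteratedFDeriv ℝ (n + 1) f (y - c t)).curryLeft‖
          = ‖J t • iteratedFDeriv ℝ (n + 1) f (y - c t)‖ := fun y t =>
      ContinuousMultilinearMap.curryLeft_norm _
    obtain ⟨B', hB'⟩ := f.decay' 0 (n + 1)
    refine hasFDerivAt_integral_of_dominated_of_fderiv_le (s := univ)
      (F' := fun y t => (J t • iteratedFDeriv ℝ (n + 1) f (y - c t)).curryLeft)
      (bound := fun _ => |C| * |B'|) Filter.univ_mem
      (Filter.Eventually.of_forall fun y => hmeas n y) (hint n x) ?_ ?_ (integrable_const _) ?_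
    · exact (continuousMultilinearCurryLeftEquiv ℝ (fun _ : Fin (n + 1) => Mink)
        ℝ).continuous.comp_aestronglyMeasurable (hmeas (n + 1) x)
    · filter_upwards [hJC] with t ht y _
      rw [hnorm, norm_smul]
      have h2 := hB' (y - c t)
      simp only [pow_zero, one_mul] at h2
      exact mul_le_mul (ht.trans (le_abs_self _)) (h2.trans (le_abs_self _)) (norm_nonneg _)
        (abs_nonneg _)
    · refine Filter.Eventually.of_forall fun t y _ => ?_
      have h3 : HasFDerivAt (iteratedFDeriv ℝ n f)
          (iteratedFDeriv ℝ (n + 1) f (y - c t)).curryLeft (y - c t) := by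
        have h4 : DifferentiableAt ℝ (iteratedFDeriv ℝ n f) (y - c t) :=
          (f.smooth'.differentiable_iteratedFDeriv
            (by exact_mod_cast ENat.natCast_lt_top n)).differentiableAt
        have h5 := h4.hasFDerivAt
        rw [fderiv_iteratedFDeriv] at h5
        exact h5
      have h6 : HasFDerivAt (fun y : Mink => y - c t) (ContinuousLinearMap.id ℝ Mink) y :=
        (hasFDerivAt_id y).sub_const (c t)
      have h7 := (h3.comp y h6).const_smul (J t)
      exact h7
  have hzero : ∀ x, ∫ t, f (x - c t) * J t ∂ν
      = (∫ t, J t • iteratedFDeriv ℝ 0 f (x - c t) ∂ν).curry0 := by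
    intro x
    have := (continuousMultilinearCurryFin0 ℝ Mink
      ℝ).toContinuousLinearEquiv.toContinuousLinearMap.integral_comp_comm (hint 0 x)
    refine Eq.trans ?_ this
    refine integral_congr_ae (Filter.Eventually.of_forall fun t => ?_)
    simp [mul_comm]
  have htaylor : HasFTaylorSeriesUpTo ∞ (fun x => ∫ t, f (x - c t) * J t ∂ν)
      (fun x n => ∫ t, J t • iteratedFDeriv ℝ n f (x - c t) ∂ν) :=
    { zero_eq := fun x => (hzero x).symm
      fderiv := fun m _ x => hderiv m x
      cont := fun m _ => continuous_iff_continuousAt.mpr fun x => (hderiv m x).continuousAt }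
  refine ⟨htaylor.contDiff, fun k n => ?_⟩
  set S : ℝ := 2 ^ k * (Finset.Iic (k, n)).sup (fun m => SchwartzMap.seminorm ℝ m.1 m.2) f with hS
  refine ⟨(1 + |R|) ^ k * (|C| * |S|) * ν.real univ, fun x => ?_⟩
  rw [← htaylor.eq_iteratedFDeriv (by exact_mod_cast le_top)]
  have hpt : ∀ᵐ t ∂ν, ‖(‖x‖ ^ k) • (J t • iteratedFDeriv ℝ n f (x - c t))‖
      ≤ (1 + |R|) ^ k * (|C| * |S|) := by
    filter_upwards [hcR, hJC] with t h1 h2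
    have h3 := SchwartzMap.one_add_le_sup_seminorm_apply (𝕜 := ℝ) (m := (k, n)) (k := k) (n := n)
      le_rfl le_rfl f (x - c t)
    have h4 : ‖x‖ ≤ (1 + |R|) * (1 + ‖x - c t‖) := by
      have h5 : ‖x‖ ≤ ‖x - c t‖ + ‖c t‖ := by simpa using norm_add_le (x - c t) (c t)
      have h6 := h1.trans (le_abs_self R)
      nlinarith [norm_nonneg (x - c t), abs_nonneg R]
    rw [norm_smul, norm_smul, norm_pow, norm_norm]
    calc ‖x‖ ^ k * (‖J t‖ * ‖iteratedFDeriv ℝ n f (x - c t)‖)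
        ≤ ((1 + |R|) * (1 + ‖x - c t‖)) ^ k * (|C| * ‖iteratedFDeriv ℝ n f (x - c t)‖) := by
          have := h2.trans (le_abs_self C)
          gcongr
      _ = (1 + |R|) ^ k * (|C| * ((1 + ‖x - c t‖) ^ k * ‖iteratedFDeriv ℝ n f (x - c t)‖)) := by
          rw [mul_pow]; ring
      _ ≤ (1 + |R|) ^ k * (|C| * |S|) := by
          have := h3.trans (le_abs_self S)
          gcongr
  calc ‖x‖ ^ k * ‖∫ t, J t • iteratedFDeriv ℝ n f (x - c t) ∂ν‖
      = ‖∫ t, (‖x‖ ^ k) • (J t • iteratedFDeriv ℝ n f (x - c t)) ∂ν‖ := by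
        rw [integral_smul, norm_smul, norm_pow, norm_norm]
    _ ≤ (1 + |R|) ^ k * (|C| * |S|) * ν.real univ :=
        norm_integral_le_of_norm_le_const hpt

theorem convex_Delta (n : ℕ) : Convex ℝ (Delta n) := by
  rintro t ⟨ht0, ht1⟩ u ⟨hu0, hu1⟩ a b ha hb hab
  refine ⟨fun i => ?_, ?_⟩
  · have := ht0 i; have := hu0 i
    simp only [Pi.add_apply, Pi.smul_apply, smul_eq_mul]; positivity
  · simp only [Pi.add_apply, Pi.smul_apply, smul_eq_mul, Finset.sum_add_distrib, ← Finset.mul_sum]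
    nlinarith

theorem isCompact_Delta (n : ℕ) : IsCompact (Delta n) := by
  have hcl : IsClosed (Delta n) := by
    have : Delta n = (⋂ i, {t : Fin n → ℝ | 0 ≤ t i}) ∩ {t | ∑ i, t i ≤ 1} := by
      ext t; simp [Delta]
    rw [this]
    exact (isClosed_iInter fun i => isClosed_le continuous_const (continuous_apply i)).inter
      (isClosed_le (by fun_prop) continuous_const)
  refine (isCompact_Icc (a := (0 : Fin n → ℝ)) (b := 1)).of_isClosed_subset hcl ?_
  rintro t ⟨h0, h1⟩
  exact ⟨h0, fun i => (Finset.single_le_sum (fun j _ => h0 j) (Finset.mem_univ i)).trans h1⟩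

theorem aestronglyMeasurable_jacobian {n : ℕ} (χ : SingSimplex n) (α : Fin n → Fin 4)
    (ν : Measure (Fin n → ℝ)) : AEStronglyMeasurable (χ.jacobian α) ν := by
  have h : Measurable (χ.jacobian α) := by
    unfold SingSimplex.jacobian
    simp only [Matrix.det_apply, Matrix.of_apply]
    refine Finset.measurable_sum _ fun p _ => Measurable.const_smul ?_ _
    refine Finset.measurable_prod _ fun i _ => ?_
    exact (measurable_pi_apply _).comp (measurable_fderiv_apply_const ℝ _ _)
  exact h.aestronglyMeasurable

theorem jacobian_bounded {n : ℕ} (χ : SingSimplex n) (α : Fin n → Fin 4) :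
    ∃ C : ℝ, ∀ᵐ t ∂(volume.restrict (Delta n)), ‖χ.jacobian α t‖ ≤ C := by
  obtain ⟨⟨K, hK⟩, -⟩ := χ.piecewiseSmooth
  refine ⟨(Fintype.card (Equiv.Perm (Fin n))) • ∏ _i : Fin n, (K : ℝ), ?_⟩
  have hint : ∀ᵐ t ∂(volume.restrict (Delta n)), t ∈ interior (Delta n) := by
    have h0 := (convex_Delta n).addHaar_frontier (volume : Measure (Fin n → ℝ))
    rw [ae_restrict_iff' (isCompact_Delta n).measurableSet]
    have h1 : ∀ᵐ t ∂(volume : Measure (Fin n → ℝ)), t ∉ frontier (Delta n) :=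
      measure_eq_zero_iff_ae_notMem.mp h0
    filter_upwards [h1] with t ht htD
    by_contra hni
    exact ht ⟨subset_closure htD, hni⟩
  filter_upwards [hint] with t ht
  have hn : ∀ i j : Fin n, ‖fderiv ℝ (extendZero χ.toFun) t (Pi.single j 1) (α i)‖ ≤ K := by
    intro i j
    have h1 : ‖fderiv ℝ (extendZero χ.toFun) t‖ ≤ K :=
      norm_fderiv_le_of_lipschitzOn ℝ (mem_interior_iff_mem_nhds.mp ht) hK
    calc _ ≤ ‖fderiv ℝ (extendZero χ.toFun) t (Pi.single j 1)‖ := norm_le_pi_norm _ _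
      _ ≤ ‖fderiv ℝ (extendZero χ.toFun) t‖ * ‖(Pi.single j 1 : Fin n → ℝ)‖ :=
          ContinuousLinearMap.le_opNorm _ _
      _ ≤ K * 1 := by
          gcongr
          rw [Pi.norm_single]; simp
      _ = K := mul_one _
  unfold SingSimplex.jacobian
  rw [Matrix.det_apply]
  refine (norm_sum_le _ _).trans ?_
  rw [← Finset.card_univ, ← Finset.sum_const]
  refine Finset.sum_le_sum fun p _ => ?_
  have hs : ‖Equiv.Perm.sign p • ∏ i, Matrix.of (fun i j : Fin n =>
      fderiv ℝ (extendZero χ.toFun) t (Pi.single j 1) (α i)) (p i) i‖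
      = ‖∏ i, Matrix.of (fun i j : Fin n =>
      fderiv ℝ (extendZero χ.toFun) t (Pi.single j 1) (α i)) (p i) i‖ := by
    rcases Int.units_eq_one_or (Equiv.Perm.sign p) with h | h <;> simp [h]
  rw [hs, norm_prod]
  exact Finset.prod_le_prod (fun i _ => norm_nonneg _) fun i _ => hn _ _

theorem smearFun_schwartz {n : ℕ} (χ : SingSimplex n) (f : Test) (α : Fin n → Fin 4) :
    ContDiff ℝ ∞ (smearFun χ f α) ∧
    ∀ k m : ℕ, ∃ B : ℝ, ∀ x : Mink, ‖x‖ ^ k * ‖iteratedFDeriv ℝ m (smearFun χ f α) x‖ ≤ B := by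
  have hcont : ContinuousOn (extendZero χ.toFun) (Delta n) := by
    obtain ⟨⟨K, hK⟩, -⟩ := χ.piecewiseSmooth
    exact hK.continuousOn
  have hD := isCompact_Delta n
  have : IsFiniteMeasure (volume.restrict (Delta n)) :=
    ⟨by rw [Measure.restrict_apply_univ]; exact hD.measure_lt_top⟩
  obtain ⟨C, hC⟩ := jacobian_bounded χ α
  obtain ⟨R, hR⟩ := hD.exists_bound_of_continuousOn hcont
  exact schwartz_superposition (volume.restrict (Delta n)) (extendZero χ.toFun) (χ.jacobian α)
    (hcont.aestronglyMeasurable hD.measurableSet) (aestronglyMeasurable_jacobian χ α _) R C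
    ((ae_restrict_iff' hD.measurableSet).mpr (Filter.Eventually.of_forall hR)) hC f

/-- The form `χ[f]`, with components `χ[f]^α` in the Schwartz space. -/
def smear {n : ℕ} (χ : SingSimplex n) (f : Test) (α : Fin n → Fin 4) : Test where
  toFun := smearFun χ f α
  smooth' := (smearFun_schwartz χ f α).1
  decay' := (smearFun_schwartz χ f α).2

/-- The form `[c]^α = ∑ᵢ mᵢ χᵢ[f]^α` of a smearing chain `∑ᵢ mᵢ (χᵢ, f)`. -/
def chainForm {n : ℕ} (c : Chain n) (f : Test) (α : Fin n → Fin 4) : Test :=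
  c.sum fun χ m => m • smear χ f α

/-- The support `|(c, f)|` of a smearing chain: the support of its form. -/
def chainSupport {n : ℕ} (c : Chain n) (f : Test) : Set Mink :=
  closure {x | ∃ α : Fin n → Fin 4, chainForm c f α x ≠ 0}

/-- Smearing functions: real test functions whose support contains `0`. -/
def SmearingFn : Type := {f : Test // (0 : Mink) ∈ tsupport f}

/-- The Lorentz action `f ↦ f_L` on smearing functions. -/
def SmearingFn.lor (L : restrictedLorentz) (f : SmearingFn) : SmearingFn :=
  ⟨testLor L f.1, by
    have h : (testLor L f.1 : Mink → ℝ) = f.1 ∘ (lorentzEquiv L⁻¹).toHomeomorph := rfl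
    rw [h, tsupport_comp_eq_preimage]
    simpa using f.2⟩

/-- The smearing boundaries `(ℓ, f)`: `f` is a smearing function and `ℓ = ∂σ` for some
singular piecewise smooth 2-simplex `σ`. -/
def SmearingBoundary : Type :=
  {c : Chain 1 × SmearingFn // ∃ σ : SingSimplex 2, σ.boundary = c.1}

/-- The boundary `∂(σ, f) = (∂σ, f)`. -/
def SmearingBoundary.of (σ : SingSimplex 2) (f : SmearingFn) : SmearingBoundary :=
  ⟨(σ.boundary, f), σ, rfl⟩

/-- The action `P(ℓ, f) = (Pℓ, f_L)` of `P = (x, L)`. -/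
def SmearingBoundary.poincare (P : Poincare) (c : SmearingBoundary) : SmearingBoundary :=
  ⟨(chainAct P c.1.1, c.1.2.lor P.lor), by
    obtain ⟨σ, hσ⟩ := c.2
    exact ⟨σ.poincare P, by rw [boundary_poincare, hσ]⟩⟩

/-- The support `|(ℓ, f)|`. -/
def SmearingBoundary.support (c : SmearingBoundary) : Set Mink :=
  chainSupport c.1.1 c.1.2.1

/-! ### Unbounded operators and their exponentials -/

section Operators

variable {H : Type*} [NormedAddCommGroup H] [InnerProductSpace ℂ H] [CompleteSpace H]

/-- An operator `A : D → D` on a subspace `D` of `H`, as an unbounded operator of `H` with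
domain `D`. -/
def toPMap {D : Submodule ℂ H} (A : D →ₗ[ℂ] D) : H →ₗ.[ℂ] H := ⟨D, D.subtype ∘ₗ A⟩

/-- `A` is essentially self-adjoint on `D`: it is symmetric and its closure is self-adjoint. -/
def IsEssSelfAdjoint {D : Submodule ℂ H} (A : D →ₗ[ℂ] D) : Prop :=
  (toPMap A).IsFormalAdjoint (toPMap A) ∧ IsSelfAdjoint (toPMap A).closure

/-- `V` is the strongly continuous one-parameter unitary group `V(t) = exp(itT)`: its infinitesimal
generator is `iT`, with equality of domains. -/
structure IsUnitaryGroupOf (V : ℝ → unitary (H →L[ℂ] H)) (T : H →ₗ.[ℂ] H) : Prop where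
  map_add : ∀ s t, V (s + t) = V s * V t
  continuous : ∀ ψ : H, Continuous fun t => (V t : H →L[ℂ] H) ψ
  generator : ∀ ψ η : H, (ψ, η) ∈ T.graph ↔
    HasDerivAt (fun t => (V t : H →L[ℂ] H) ψ) (Complex.I • η) 0

/-- `u = exp(iA)`, where `A` on the right denotes the closure of the operator `A : D → D`. -/
def IsExpI {D : Submodule ℂ H} (A : D →ₗ[ℂ] D) (u : unitary (H →L[ℂ] H)) : Prop :=
  ∃ V : ℝ → unitary (H →L[ℂ] H), IsUnitaryGroupOf V (toPMap A).closure ∧ V 1 = u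

end Operators

/-! ### The quantum electromagnetic field -/

/-- The matrix `L_μ^ν = g_{μα} L^α_β g^{βν}`. -/
def lowerUpper (A : Matrix (Fin 4) (Fin 4) ℝ) : Matrix (Fin 4) (Fin 4) ℝ := metric * A * metric

/-- A quantum electromagnetic field on the Hilbert space `H`, not necessarily free: the
current `J_ν = ∂^μ F_{μν}` is not restricted. -/
structure EMField (H : Type*) [NormedAddCommGroup H] [InnerProductSpace ℂ H]
    [CompleteSpace H] where
  /-- the (strongly continuous) unitary representation of the Poincaré group -/
  U : Poincare →* unitary (H →L[ℂ] H)
  continuous_U : ∀ ψ : H, Continuous fun P => (U P : H →L[ℂ] H) ψ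
  /-- the vacuum vector -/
  Ω : H
  norm_Ω : ‖Ω‖ = 1
  U_Ω : ∀ P, (U P : H →L[ℂ] H) Ω = Ω
  vacuum_unique : ∀ ψ : H, (∀ P, (U P : H →L[ℂ] H) ψ = ψ) → ∃ c : ℂ, ψ = c • Ω
  /-- the spectrum condition: the joint spectrum of the generators of the translations lies in the
  closed forward cone, i.e. the generator of the translations in any future timelike direction `a`
  is a positive operator -/
  spectrum : ∀ a ∈ forwardCone, ∀ ψ η : H,
    HasDerivAt (fun t : ℝ => (U (Poincare.translation (t • a)) : H →L[ℂ] H) ψ)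
      (Complex.I • η) 0 → 0 ≤ (⟪ψ, η⟫_ℂ).re
  /-- the common domain -/
  D : Submodule ℂ H
  dense_D : Dense (D : Set H)
  Ω_mem : Ω ∈ D
  U_mem : ∀ P, ∀ ψ ∈ D, (U P : H →L[ℂ] H) ψ ∈ D
  /-- the field `F_{μν}(f)`, an operator on `D` -/
  F : Fin 4 → Fin 4 → Test →ₗ[ℝ] (D →ₗ[ℂ] D)
  /-- matrix elements are tempered distributions -/
  continuous_F : ∀ μ ν (φ ψ : D), Continuous fun f : Test => ⟪(φ : H), (F μ ν f ψ : H)⟫_ℂ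
  /-- essential self-adjointness of the field -/
  essSelfAdjoint : ∀ μ ν f, IsEssSelfAdjoint (F μ ν f)
  /-- essential self-adjointness of contractions with Schwartz 1-tensors -/
  essSelfAdjoint₁ : ∀ (μ : Fin 4) (f : Fin 4 → Test), IsEssSelfAdjoint (∑ ν, F μ ν (f ν))
  /-- essential self-adjointness of contractions with Schwartz 2-tensors -/
  essSelfAdjoint₂ : ∀ f : Fin 4 → Fin 4 → Test, IsEssSelfAdjoint (∑ μ, ∑ ν, F μ ν (f μ ν))
  /-- covariance: `U(P) F_{μν}(f) U(P)* = (L⁻¹)_μ^α (L⁻¹)_ν^β F_{αβ}(f ∘ P⁻¹)` on `D`, `P = (x, L)`;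
  both sides are evaluated at `U(P)ψ` with `ψ ∈ D` -/
  covariance : ∀ (P : Poincare) (μ ν : Fin 4) (f : Test) (ψ : D),
    (U P : H →L[ℂ] H) (F μ ν f ψ) =
      ∑ α, ∑ β, ((lowerUpper (lmat P.lor⁻¹) μ α * lowerUpper (lmat P.lor⁻¹) ν β : ℝ) : ℂ) •
        (F α β (testAct P f) ⟨(U P : H →L[ℂ] H) ψ, U_mem P ψ ψ.2⟩ : H)
  /-- strong causality: `[exp(iF_{μν}(f)), exp(iF_{αβ}(g))] = 0` if `supp f ⊥ supp g` -/
  causality : ∀ (μ ν α β : Fin 4) (f g : Test), CausallyDisjoint (tsupport f) (tsupport g) →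
    ∀ u v, IsExpI (F μ ν f) u → IsExpI (F α β g) v → u * v = v * u
  antisymm : ∀ μ ν f, F μ ν f = -F ν μ f
  /-- first Maxwell equation `∂_ρ F_{μν} + ∂_μ F_{νρ} + ∂_ν F_{ρμ} = 0`, in the weak sense -/
  maxwell : ∀ (ρ μ ν : Fin 4) (f : Test),
    F μ ν (∂_{(Pi.single ρ 1 : Mink)} f) + F ν ρ (∂_{(Pi.single μ 1 : Mink)} f)
      + F ρ μ (∂_{(Pi.single ν 1 : Mink)} f) = 0

/-- The surface integral `F⟨σ, f⟩ = ½ F_{μν}(σ[f]^{μν})`, an operator on the common domain. -/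
def EMField.surface {H : Type*} [NormedAddCommGroup H] [InnerProductSpace ℂ H] [CompleteSpace H]
    (Q : EMField H) (σ : SingSimplex 2) (f : SmearingFn) : Q.D →ₗ[ℂ] Q.D :=
  (1 / 2 : ℂ) • ∑ μ, ∑ ν, Q.F μ ν (smear σ f.1 ![μ, ν])

end QEM

end

/-! The phase depends only on the boundary because, by the first Maxwell equation, the field smeared
with an antisymmetric tensor K depends only on the divergence of K. By Stokes, the divergence of
σ[f] is minus the boundary form (∂σ)[f].

Stokes (`divergence_smear`) comes from Green's theorem on the triangle, applied to A(t) = f(x -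
σ(t)) and B(t) = σ^ν(t). These are merely Lipschitz, so `green_lipschitz` mollifies A, starting from
the smooth case `green_smooth`.

The dependence on the divergence alone is a Poincaré lemma for currents (`sum_pd_potential`): K =
∂_ρ T^{ρμν} + (an operator applied to div K), with T cyclic in its indices. The field annihilates
the first term by the Maxwell equation. The usual contraction K(x/s) becomes singular as s → 0 and
leaves the Schwartz space. It is therefore replaced by two homotopies: K is deformed into φ * K by
translations, for a bump function φ of integral 1, and φ * K is then contracted by scaling only the
centres of the bumps. Both are integrals `rayConv` of translates of test functions. If div K = 0
nothing remains, and surfaces with equal boundary give equal operators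
(`EMField.surface_eq_of_boundary_eq`).

The same formula controls supports. The remaining term lives near the union of the segments from the
centre p to the support of div K. When (∂σ)[f] is supported in a double cone, which is open, bounded
and convex, that union stays inside it, so F⟨σ, f⟩ equals the field smeared with a tensor supported
there (`EMField.exists_surface_eq`), wherever σ itself runs. Strong causality holds for single
components. It passes to finite sums because a unitary commuting with all exp(itAᵢ) preserves the
graph of the closure of ∑ Aᵢ (`commute_isExpI_sum`).

Exponentials are unitary groups with prescribed generator, so existence and uniqueness in Stone's
theorem are needed. Covariance holds because U(P) maps the domain to itself and intertwines the two
surface integrals there (`EMField.U_surface`). A closed curve is spanned by the cone over it, whose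
two radial faces coincide and cancel (`boundary_cone`). -/

noncomputable section

namespace QEM

/-! ### Resolvents and bounded approximations of self-adjoint operators -/

section Stone

open Filter Topology

variable {H : Type*} [NormedAddCommGroup H] [InnerProductSpace ℂ H] [CompleteSpace H]

/-- The graph of a self-adjoint operator is its own adjoint. -/
theorem mem_graph_iff_of_isSelfAdjoint {T : H →ₗ.[ℂ] H} (hT : IsSelfAdjoint T) (ψ η : H) :
    (ψ, η) ∈ T.graph ↔ ∀ a b, (a, b) ∈ T.graph → ⟪b, ψ⟫_ℂ = ⟪a, η⟫_ℂ := by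
  have h := LinearPMap.adjoint_graph_eq_graph_adjoint hT.dense_domain
  rw [LinearPMap.isSelfAdjoint_def.mp hT] at h
  conv_lhs => rw [h]
  simp [sub_eq_zero]

theorem inner_graph_of_isSelfAdjoint {T : H →ₗ.[ℂ] H} (hT : IsSelfAdjoint T) {a b c d : H}
    (h : (a, b) ∈ T.graph) (h' : (c, d) ∈ T.graph) : ⟪b, c⟫_ℂ = ⟪a, d⟫_ℂ :=
  (mem_graph_iff_of_isSelfAdjoint hT c d).mp h' a b h

theorem dense_graph_fst {T : H →ₗ.[ℂ] H} (hT : IsSelfAdjoint T) :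
    Dense {a : H | ∃ b, (a, b) ∈ T.graph} := by
  refine hT.dense_domain.mono fun a ha => ?_
  exact ⟨T ⟨a, ha⟩, T.mem_graph ⟨a, ha⟩⟩

/-- The cross term vanishes since ⟨Ta, a⟩ is real. The identity bounds T - il from below, which
makes it injective with closed range and gives the resolvent bound 1/|l|. -/
theorem norm_le_norm_sub_of_isSelfAdjoint {T : H →ₗ.[ℂ] H} (hT : IsSelfAdjoint T) {a b : H}
    (h : (a, b) ∈ T.graph) (l : ℝ) :
    ‖b - (Complex.I * l) • a‖ ^ 2 = ‖b‖ ^ 2 + l ^ 2 * ‖a‖ ^ 2 := by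
  have hs := inner_graph_of_isSelfAdjoint hT h h
  have him : (⟪b, a⟫_ℂ).im = 0 := by
    have h2 := congrArg Complex.im hs
    rw [← inner_conj_symm a b, Complex.conj_im] at h2
    linarith
  rw [norm_sub_sq (𝕜 := ℂ), inner_smul_right]
  have : RCLike.re (Complex.I * (l : ℂ) * ⟪b, a⟫_ℂ) = 0 := by
    simp [him]
  rw [this, norm_smul]
  simp [mul_pow]

/-- The resolvent of a self-adjoint operator off the real axis. -/
theorem exists_resolvent {T : H →ₗ.[ℂ] H} (hT : IsSelfAdjoint T) {l : ℝ} (hl : l ≠ 0) :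
    ∃ R : H →L[ℂ] H, (∀ x, (R x, x + (Complex.I * l) • R x) ∈ T.graph) ∧
      (∀ a b, (a, b) ∈ T.graph → R (b - (Complex.I * l) • a) = a) ∧
      ∀ x, |l| * ‖R x‖ ≤ ‖x‖ := by
  let g : T.graph →L[ℂ] H :=
    ((ContinuousLinearMap.snd ℂ H H) - (Complex.I * (l : ℂ)) • ContinuousLinearMap.fst ℂ H H).comp
      T.graph.subtypeL
  have hg : ∀ x : T.graph, g x = x.1.2 - (Complex.I * l) • x.1.1 := fun x => rfl
  have hn : ∀ x : T.graph, ‖g x‖ ^ 2 = ‖x.1.2‖ ^ 2 + l ^ 2 * ‖x.1.1‖ ^ 2 := fun x => by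
    rw [hg]; exact norm_le_norm_sub_of_isSelfAdjoint hT x.2 l
  have hb1 : ∀ x : T.graph, ‖x.1.2‖ ≤ ‖g x‖ := fun x => by
    refine le_of_sq_le_sq ?_ (norm_nonneg _)
    rw [hn]
    nlinarith [mul_nonneg (sq_nonneg l) (sq_nonneg ‖x.1.1‖)]
  have hb2 : ∀ x : T.graph, |l| * ‖x.1.1‖ ≤ ‖g x‖ := fun x => by
    refine le_of_sq_le_sq ?_ (norm_nonneg _)
    rw [hn, mul_pow, sq_abs]
    nlinarith [sq_nonneg ‖x.1.2‖]
  have hlpos : 0 < |l| := abs_pos.mpr hl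
  have hanti : AntilipschitzWith (1 + ⟨|l|⁻¹, by positivity⟩) g := by
    refine AddMonoidHomClass.antilipschitz_of_bound g fun x => ?_
    change max ‖x.1.1‖ ‖x.1.2‖ ≤ _
    have h1 := hb1 x
    have h2 : ‖x.1.1‖ ≤ |l|⁻¹ * ‖g x‖ := by
      rw [inv_mul_eq_div, le_div_iff₀ hlpos, mul_comm]; exact hb2 x
    have h3 : 0 ≤ |l|⁻¹ * ‖g x‖ := by positivity
    have h4 := norm_nonneg (g x)
    change _ ≤ (1 + |l|⁻¹) * ‖g x‖
    refine max_le ?_ ?_ <;> nlinarith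
  have hcomp : CompleteSpace T.graph := hT.isClosed.completeSpace_coe
  have hclosed : IsClosed (Set.range g) := hanti.isClosed_range g.uniformContinuous
  -- The range is closed, so only its orthogonal complement has to vanish. A vector w in it
  -- satisfies Tw = -ilw by self-adjointness, which contradicts the reality of ⟨w, Tw⟩ unless w = 0.
  have hrange : LinearMap.range g.toLinearMap = ⊤ := by
    have hc : IsClosed (LinearMap.range g.toLinearMap : Set H) := hclosed
    have : CompleteSpace (LinearMap.range g.toLinearMap) := hc.completeSpace_coe
    rw [← Submodule.orthogonal_eq_bot_iff, Submodule.eq_bot_iff]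
    intro w hw
    rw [Submodule.mem_orthogonal] at hw
    have hmem : (w, (-(Complex.I * l)) • w) ∈ T.graph := by
      rw [mem_graph_iff_of_isSelfAdjoint hT]
      intro a b hab
      have := hw (g ⟨(a, b), hab⟩) ⟨⟨(a, b), hab⟩, rfl⟩
      rw [hg, inner_sub_left, inner_smul_left, sub_eq_zero] at this
      rw [this, inner_smul_right]
      simp
    have := inner_graph_of_isSelfAdjoint hT hmem hmem
    rw [inner_smul_left, inner_smul_right] at this
    have h2 : (2 * Complex.I * (l : ℂ)) * ⟪w, w⟫_ℂ = 0 := by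
      simp only [map_neg, map_mul, Complex.conj_I, Complex.conj_ofReal] at this
      linear_combination this
    have h3 : (2 * Complex.I * (l : ℂ)) ≠ 0 := by simp [hl]
    exact inner_self_eq_zero.mp ((mul_eq_zero.mp h2).resolve_left h3)
  have hker : LinearMap.ker g.toLinearMap = ⊥ := LinearMap.ker_eq_bot.mpr hanti.injective
  let e : T.graph ≃ₗ[ℂ] H := LinearEquiv.ofBijective g.toLinearMap
    ⟨hanti.injective, LinearMap.range_eq_top.mp hrange⟩
  have he : ∀ x, g (e.symm x) = x := fun x => e.apply_symm_apply x
  have hbound : ∀ x, |l| * ‖(e.symm x).1.1‖ ≤ ‖x‖ := fun x => by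
    have := hb2 (e.symm x)
    rwa [he] at this
  let R : H →L[ℂ] H := LinearMap.mkContinuous
    ((LinearMap.fst ℂ H H).comp (T.graph.subtype.comp e.symm.toLinearMap)) |l|⁻¹ (fun x => by
      rw [inv_mul_eq_div, le_div_iff₀ hlpos, mul_comm]; exact hbound x)
  have hR : ∀ x, R x = (e.symm x).1.1 := fun x => rfl
  refine ⟨R, fun x => ?_, fun a b hab => ?_, hbound⟩
  · have h1 := he x
    rw [hg, sub_eq_iff_eq_add] at h1
    rw [hR, ← h1]
    exact (e.symm x).2
  · have : e ⟨(a, b), hab⟩ = b - (Complex.I * l) • a := rfl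
    rw [hR, ← this, e.symm_apply_apply]

/-- A self-adjoint operator is a strong limit, on its domain, of commuting bounded self-adjoint
operators. -/
theorem exists_bounded_approx {T : H →ₗ.[ℂ] H} (hT : IsSelfAdjoint T) :
    ∃ B : ℕ → H →L[ℂ] H, (∀ n, IsSelfAdjoint (B n)) ∧ (∀ m n, Commute (B m) (B n)) ∧
      ∀ a b, (a, b) ∈ T.graph → Tendsto (fun n => B n a) atTop (𝓝 b) := by
  have hex : ∀ l : ℝ, ∃ R : H →L[ℂ] H, l ≠ 0 → (∀ x, (R x, x + (Complex.I * l) • R x) ∈ T.graph) ∧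
      (∀ a b, (a, b) ∈ T.graph → R (b - (Complex.I * l) • a) = a) ∧
      ∀ x, |l| * ‖R x‖ ≤ ‖x‖ := fun l => by
    by_cases hl : l = 0
    · exact ⟨0, fun h => absurd hl h⟩
    · obtain ⟨R, hR⟩ := exists_resolvent hT hl
      exact ⟨R, fun _ => hR⟩
  choose R hR using hex
  have hcomm : ∀ l m : ℝ, l ≠ 0 → m ≠ 0 → Commute (R l) (R m) := by
    intro l m hl hm
    obtain ⟨hl1, hl2, -⟩ := hR l hl
    obtain ⟨hm1, hm2, -⟩ := hR m hm
    ext x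
    simp only [mul_apply_eq_comp]
    set u := R m x with hu
    set p := R l u with hp
    set q := R l x with hq
    -- This leads to the resolvent identity R_l x - R_m x = i(l - m) R_l R_m x. With p = R_l R_m x
    -- it reads (T - im)p = R_l x, so applying R_m gives R_m R_l x = p.
    have h1 : (q - u, (Complex.I * l) • q - (Complex.I * m) • u) ∈ T.graph := by
      have := T.graph.sub_mem (hl1 x) (hm1 x)
      simp only [Prod.mk_sub_mk] at this
      convert this using 2
      rw [← hq, ← hu]; abel
    have h2 := hl2 _ _ h1
    have h3 : (Complex.I * l) • q - (Complex.I * m) • u - (Complex.I * l) • (q - u)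
        = (Complex.I * (l - m)) • u := by
      rw [mul_sub, sub_smul, smul_sub]; abel
    rw [h3, map_smul, ← hp] at h2
    have h4 : u + (Complex.I * l) • p - (Complex.I * m) • p = q := by
      rw [mul_sub, sub_smul] at h2
      rw [add_sub_assoc, h2]; abel
    have h5 := hm2 _ _ (hl1 u)
    rw [← hp, h4] at h5
    exact h5.symm
  have hadj : ∀ l : ℝ, l ≠ 0 → star (R l) = R (-l) := by
    intro l hl
    obtain ⟨hl1, -, -⟩ := hR l hl
    obtain ⟨hm1, -, -⟩ := hR (-l) (neg_ne_zero.mpr hl)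
    rw [ContinuousLinearMap.star_eq_adjoint]
    symm
    rw [ContinuousLinearMap.eq_adjoint_iff]
    intro x y
    have := inner_graph_of_isSelfAdjoint hT (hm1 x) (hl1 y)
    rw [inner_add_left, inner_add_right, inner_smul_left, inner_smul_right] at this
    simp only [map_mul, map_neg, Complex.conj_I, Complex.conj_ofReal, Complex.ofReal_neg] at this
    linear_combination -this
  -- In functional calculus this is N²T/(T² + N²) with N = n + 1. It is self-adjoint because the
  -- adjoint of R_l is R_{-l}, and the shift by one keeps l nonzero.
  let B : ℕ → (H →L[ℂ] H) := fun n =>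
    (((n + 1 : ℝ) ^ 2 / 2 : ℝ) : ℂ) • (R (n + 1) + R (-(n + 1)))
  have hpos : ∀ n : ℕ, ((n : ℝ) + 1) ≠ 0 := fun n => by positivity
  have hposn : ∀ n : ℕ, -((n : ℝ) + 1) ≠ 0 := fun n => neg_ne_zero.mpr (hpos n)
  have hBsa : ∀ n, IsSelfAdjoint (B n) := fun n => by
    rw [IsSelfAdjoint, star_smul, star_add, hadj _ (hpos n), hadj _ (hposn n), neg_neg,
      add_comm (R _), Complex.star_def, Complex.conj_ofReal]
  refine ⟨B, hBsa, fun m n => ?_, fun a b hab => ?_⟩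
  · refine Commute.smul_left (Commute.smul_right ?_ _) _
    refine Commute.add_left (Commute.add_right ?_ ?_) (Commute.add_right ?_ ?_) <;>
    exact hcomm _ _ (by first | exact hpos _ | exact hposn _) (by first | exact hpos _ | exact hposn _)
  · -- `∓ i n R_{±n} → 1` strongly
    have hlim : ∀ ε : ℝ, (ε = 1 ∨ ε = -1) → ∀ y : H,
        Tendsto (fun n : ℕ => (-(Complex.I * ((ε * (n + 1) : ℝ) : ℂ))) • R (ε * (n + 1)) y)
          atTop (𝓝 y) := by
      intro ε hε y
      have hne : ∀ n : ℕ, ε * ((n : ℝ) + 1) ≠ 0 := fun n => by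
        rcases hε with rfl | rfl
        · rw [one_mul]; exact hpos n
        · rw [neg_one_mul]; exact hposn n
      have habs : ∀ n : ℕ, |ε * ((n : ℝ) + 1)| = n + 1 := fun n => by
        rw [abs_mul, abs_of_nonneg (by positivity : (0 : ℝ) ≤ n + 1)]
        rcases hε with rfl | rfl <;> simp
      have hle : ∀ (n : ℕ) (z : H),
          ‖(-(Complex.I * ((ε * (n + 1) : ℝ) : ℂ))) • R (ε * (n + 1)) z‖ ≤ ‖z‖ := by
        intro n z
        have := (hR _ (hne n)).2.2 z
        rw [norm_smul, norm_neg, norm_mul, Complex.norm_I, one_mul, Complex.norm_real,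
          Real.norm_eq_abs]
        exact this
      rw [Metric.tendsto_atTop]
      intro δ hδ
      obtain ⟨c, ⟨d, hcd⟩, hc⟩ := (dense_graph_fst hT).exists_dist_lt y (by positivity : 0 < δ / 3)
      obtain ⟨N, hN⟩ := exists_nat_gt (3 * ‖d‖ / δ)
      refine ⟨N, fun n hn => ?_⟩
      set z := (-(Complex.I * ((ε * (n + 1) : ℝ) : ℂ)))
      set S := R (ε * (n + 1))
      have h1 : z • S c = c - S d := by
        have := (hR _ (hne n)).2.1 c d hcd
        rw [map_sub, map_smul] at this
        change z • S c = _
        change S d - (Complex.I * ((ε * (n + 1) : ℝ) : ℂ)) • S c = c at this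
        rw [eq_sub_iff_add_eq, neg_smul, neg_add_eq_sub]
        exact this
      have h2 : ‖S d‖ < δ / 3 := by
        have h3 := (hR _ (hne n)).2.2 d
        rw [habs] at h3
        have h4 : (N : ℝ) ≤ n := by exact_mod_cast hn
        rw [div_lt_iff₀ hδ] at hN
        have h5 : ‖d‖ < (n + 1 : ℝ) * (δ / 3) := by nlinarith
        have h6 : 0 < (n : ℝ) + 1 := by positivity
        exact lt_of_mul_lt_mul_left (h3.trans_lt h5) h6.le
      have h3 : z • S y - y = z • S (y - c) - S d - (y - c) := by
        rw [map_sub, smul_sub, h1]; abel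
      rw [dist_eq_norm, h3]
      rw [dist_eq_norm] at hc
      have h4 := hle n (y - c)
      calc ‖z • S (y - c) - S d - (y - c)‖ ≤ ‖z • S (y - c)‖ + ‖S d‖ + ‖y - c‖ :=
            (norm_sub_le _ _).trans (add_le_add_left (norm_sub_le _ _) _)
        _ < δ := by linarith
    have h1 := hlim 1 (Or.inl rfl) b
    have h2 := hlim (-1) (Or.inr rfl) b
    -- With l = ±(n + 1), the relation R_l b = a + il R_l a turns -il R_l b into -il a + l² R_l a.
    -- In the average over both signs the terms in a cancel and `B n a` remains.
    have h3 := (h1.add h2).const_smul (1 / 2 : ℂ)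
    have h4 : (1 / 2 : ℂ) • (b + b) = b := by
      rw [← two_smul ℂ b, smul_smul]; norm_num
    rw [h4] at h3
    refine h3.congr fun n => ?_
    simp only [one_mul, neg_mul, B, _root_.smul_apply,
      _root_.add_apply]
    have e1 := (hR _ (hpos n)).2.1 a b hab
    have e2 := (hR _ (hposn n)).2.1 a b hab
    rw [map_sub, map_smul, sub_eq_iff_eq_add] at e1 e2
    rw [e1, e2]
    push_cast
    match_scalars <;> ring_nf <;> simp [Complex.I_sq] <;> ring

/-- The unitary group `exp(itC)` of a bounded self-adjoint operator. -/
def expI (C : H →L[ℂ] H) (t : ℝ) : H →L[ℂ] H := NormedSpace.exp (t • (Complex.I • C))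

theorem expI_mem_unitary {C : H →L[ℂ] H} (hC : IsSelfAdjoint C) (t : ℝ) :
    expI C t ∈ unitary (H →L[ℂ] H) := by
  let +nondep : NormedAlgebra ℚ (H →L[ℂ] H) := .restrictScalars ℚ ℂ _
  refine NormedSpace.exp_mem_unitary_of_mem_skewAdjoint ?_
  rw [skewAdjoint.mem_iff, star_smul, star_smul, hC.star_eq]
  simp

theorem norm_expI {C : H →L[ℂ] H} (hC : IsSelfAdjoint C) (t : ℝ) (x : H) :
    ‖expI C t x‖ = ‖x‖ :=
  ContinuousLinearMap.norm_map_of_mem_unitary (expI_mem_unitary hC t) x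

theorem expI_zero (C : H →L[ℂ] H) : expI C 0 = 1 := by
  rw [expI, zero_smul, NormedSpace.exp_zero]

theorem expI_add (C : H →L[ℂ] H) (s t : ℝ) : expI C (s + t) = expI C s * expI C t := by
  let +nondep : NormedAlgebra ℚ (H →L[ℂ] H) := .restrictScalars ℚ ℂ _
  rw [expI, add_smul, NormedSpace.exp_add_of_commute]
  · rfl
  · exact ((Commute.refl _).smul_left _).smul_right _

theorem expI_add_of_commute {B C : H →L[ℂ] H} (h : Commute B C) (t : ℝ) :
    expI (B + C) t = expI B t * expI C t := by
  let +nondep : NormedAlgebra ℚ (H →L[ℂ] H) := .restrictScalars ℚ ℂ _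
  rw [expI, smul_add, smul_add, NormedSpace.exp_add_of_commute]
  · rfl
  · exact (((h.smul_left _).smul_right _).smul_left _).smul_right _

theorem hasDerivAt_expI_apply (C : H →L[ℂ] H) (x : H) (t : ℝ) :
    HasDerivAt (fun t : ℝ => expI C t x) (expI C t (Complex.I • C x)) t := by
  have h := hasDerivAt_exp_smul_const (𝕂 := ℝ) (Complex.I • C) t
  exact ((ContinuousLinearMap.apply ℂ H x).restrictScalars ℝ).hasFDerivAt.comp_hasDerivAt t h

theorem norm_expI_apply_sub_le {C : H →L[ℂ] H} (hC : IsSelfAdjoint C) (x : H) (t : ℝ) :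
    ‖expI C t x - x‖ ≤ |t| * ‖C x‖ := by
  have h := Convex.norm_image_sub_le_of_norm_hasDerivWithin_le (𝕜 := ℝ) (s := univ) (x := 0) (y := t)
    (f := fun s : ℝ => expI C s x) (f' := fun s => expI C s (Complex.I • C x)) (C := ‖C x‖)
    (fun s _ => (hasDerivAt_expI_apply C x s).hasDerivWithinAt)
    (fun s _ => by rw [norm_expI hC, norm_smul]; simp) convex_univ (mem_univ _) (mem_univ _)
  rw [expI_zero, sub_zero, Real.norm_eq_abs, mul_comm] at h
  exact h

/-- Since the operators commute, exp(itB) = exp(itC) exp(it(B - C)), and the isometry exp(itC) drops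
out. The bound involves only (B - C)x, so strong convergence of generators on a vector controls the
groups there. -/
theorem norm_expI_sub_expI_le {B C : H →L[ℂ] H} (hB : IsSelfAdjoint B) (hC : IsSelfAdjoint C)
    (h : Commute B C) (x : H) (t : ℝ) :
    ‖expI B t x - expI C t x‖ ≤ |t| * ‖B x - C x‖ := by
  have h2 : expI B t = expI C t * expI (B - C) t := by
    rw [← expI_add_of_commute (h.symm.sub_right (Commute.refl _)), add_sub_cancel]
  have h3 := norm_expI_apply_sub_le (hB.sub hC) x t
  rw [h2, mul_apply_eq_comp, ← map_sub, norm_expI hC]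
  exact h3

end Stone

/-! ### Stone's theorem, cores, and commuting exponentials -/

section UnitaryGroups

open Filter Topology

variable {H : Type*} [NormedAddCommGroup H] [InnerProductSpace ℂ H] [CompleteSpace H]

theorem norm_unitary_apply (u : unitary (H →L[ℂ] H)) (x : H) : ‖(u : H →L[ℂ] H) x‖ = ‖x‖ :=
  ContinuousLinearMap.norm_map_of_mem_unitary u.2 x

theorem inner_unitary_apply (u : unitary (H →L[ℂ] H)) (x y : H) :
    ⟪(u : H →L[ℂ] H) x, (u : H →L[ℂ] H) y⟫_ℂ = ⟪x, y⟫_ℂ :=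
  ContinuousLinearMap.inner_map_map_of_mem_unitary u.2 x y

theorem unitary_apply_star_apply (u : unitary (H →L[ℂ] H)) (x : H) :
    (u : H →L[ℂ] H) (((star u : unitary (H →L[ℂ] H)) : H →L[ℂ] H) x) = x := by
  have h : u * star u = 1 := Unitary.mul_star_self u
  exact DFunLike.congr_fun (congrArg Subtype.val h) x

theorem hasDerivAt_clm_apply (u : H →L[ℂ] H) {f : ℝ → H} {f' : H} {t : ℝ}
    (h : HasDerivAt f f' t) : HasDerivAt (fun s => u (f s)) (u f') t :=
  (u.restrictScalars ℝ).hasFDerivAt.comp_hasDerivAt t h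

/-- A one-parameter unitary group whose generator extends the self-adjoint operator `iT` is generated
by `iT`. -/
theorem isUnitaryGroupOf_of_hasDerivAt {T : H →ₗ.[ℂ] H} (hT : IsSelfAdjoint T)
    {V : ℝ → unitary (H →L[ℂ] H)} (hadd : ∀ s t, V (s + t) = V s * V t)
    (hV : ∀ ψ η, (ψ, η) ∈ T.graph → HasDerivAt (fun t => (V t : H →L[ℂ] H) ψ) (Complex.I • η) 0) :
    IsUnitaryGroupOf V T := by
  have h0 : V 0 = 1 := by
    have := hadd 0 0
    rw [add_zero] at this
    exact mul_eq_left.mp this.symm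
  have h00 : ∀ x, (V 0 : H →L[ℂ] H) x = x := fun x => by rw [h0]; rfl
  refine ⟨hadd, fun ψ => ?_, fun ψ η => ⟨hV ψ η, fun h => ?_⟩⟩
  · have hc0 : Tendsto (fun t => (V t : H →L[ℂ] H) ψ) (𝓝 0) (𝓝 ψ) := by
      rw [Metric.tendsto_nhds]
      intro ε hε
      obtain ⟨c, ⟨d, hcd⟩, hc⟩ := (dense_graph_fst hT).exists_dist_lt ψ (by positivity : 0 < ε / 3)
      have h1 := (hV c d hcd).continuousAt.tendsto
      rw [h00] at h1
      filter_upwards [Metric.tendsto_nhds.mp h1 (ε / 3) (by positivity)] with t ht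
      have h2 : dist ((V t : H →L[ℂ] H) ψ) ((V t : H →L[ℂ] H) c) = dist ψ c := by
        rw [dist_eq_norm, ← map_sub, norm_unitary_apply, dist_eq_norm]
      have h3 := dist_triangle4 ((V t : H →L[ℂ] H) ψ) ((V t : H →L[ℂ] H) c) c ψ
      rw [h2, dist_comm c ψ] at h3
      linarith
    rw [continuous_iff_continuousAt]
    intro t₀
    have h1 : (fun t => (V t : H →L[ℂ] H) ψ)
        = fun t => (V t₀ : H →L[ℂ] H) ((V (t - t₀) : H →L[ℂ] H) ψ) := by
      funext t
      have := hadd t₀ (t - t₀)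
      rw [add_sub_cancel] at this
      rw [this]; rfl
    rw [ContinuousAt, h1]
    refine ((V t₀ : H →L[ℂ] H).continuous.tendsto ψ).comp (hc0.comp ?_)
    have : Tendsto (fun t => t - t₀) (𝓝 t₀) (𝓝 (t₀ - t₀)) := (continuous_sub_right t₀).tendsto t₀
    rwa [sub_self] at this
  -- A self-adjoint operator has no proper symmetric extension. Differentiating the constant ⟨V(t)a,
  -- V(t)ψ⟩ at 0 shows that η satisfies the defining relation of the adjoint.
  · rw [mem_graph_iff_of_isSelfAdjoint hT]
    intro a b hab
    have h1 := (hV a b hab).inner ℂ h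
    simp only [h00, inner_unitary_apply] at h1
    have h2 := h1.unique (hasDerivAt_const (0 : ℝ) _)
    rw [inner_smul_left, inner_smul_right, Complex.conj_I] at h2
    have h3 : Complex.I * (⟪a, η⟫_ℂ - ⟪b, ψ⟫_ℂ) = 0 := by linear_combination h2
    have h4 := (mul_eq_zero.mp h3).resolve_left Complex.I_ne_zero
    exact (sub_eq_zero.mp h4).symm

/-- **Stone's theorem**, existence part: every self-adjoint operator generates a one-parameter
unitary group. -/
theorem exists_isUnitaryGroupOf {T : H →ₗ.[ℂ] H} (hT : IsSelfAdjoint T) :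
    ∃ V : ℝ → unitary (H →L[ℂ] H), IsUnitaryGroupOf V T := by
  obtain ⟨B, hB, hcomm, hlim⟩ := exists_bounded_approx hT
  -- On the domain of T the differences are bounded by |t| times those of the convergent sequence `B
  -- n c`. Since all the groups are isometric, density extends this to every vector.
  have hcau : ∀ (t : ℝ) (x : H), CauchySeq fun n => expI (B n) t x := by
    intro t x
    rw [Metric.cauchySeq_iff]
    intro ε hε
    obtain ⟨c, ⟨d, hcd⟩, hc⟩ := (dense_graph_fst hT).exists_dist_lt x (by positivity : 0 < ε / 3)
    obtain ⟨N, hN⟩ := Metric.cauchySeq_iff.mp (hlim c d hcd).cauchySeq (ε / (3 * (|t| + 1)))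
      (by positivity)
    refine ⟨N, fun m hm n hn => ?_⟩
    have h2 : ∀ n, dist (expI (B n) t x) (expI (B n) t c) < ε / 3 := fun n => by
      rw [dist_eq_norm, ← map_sub, norm_expI (hB n), ← dist_eq_norm]; exact hc
    have h3 : dist (expI (B m) t c) (expI (B n) t c) < ε / 3 := by
      have h4 := norm_expI_sub_expI_le (hB m) (hB n) (hcomm m n) c t
      have h5 := hN m hm n hn
      rw [dist_eq_norm, lt_div_iff₀ (by positivity)] at h5
      rw [dist_eq_norm]
      have h6 := norm_nonneg (B m c - B n c)
      nlinarith [abs_nonneg t]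
    have h4 := dist_triangle4 (expI (B m) t x) (expI (B m) t c) (expI (B n) t c) (expI (B n) t x)
    have h5 := h2 m
    have h6 := h2 n
    rw [dist_comm] at h6
    linarith
  have hex : ∀ (t : ℝ) (x : H), ∃ y, Tendsto (fun n => expI (B n) t x) atTop (𝓝 y) :=
    fun t x => cauchySeq_tendsto_of_complete (hcau t x)
  choose v hv using hex
  have hnorm : ∀ t x, ‖v t x‖ = ‖x‖ := fun t x => by
    have h1 := (hv t x).norm
    simp only [norm_expI (hB _)] at h1
    exact tendsto_nhds_unique h1 tendsto_const_nhds
  have hmul : ∀ s t x, v s (v t x) = v (s + t) x := fun s t x => by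
    refine tendsto_nhds_unique ?_ (hv (s + t) x)
    have h1 : Tendsto (fun n => expI (B n) s (expI (B n) t x) - expI (B n) s (v t x)) atTop (𝓝 0) := by
      rw [tendsto_zero_iff_norm_tendsto_zero]
      have h2 := tendsto_iff_norm_sub_tendsto_zero.mp (hv t x)
      refine h2.congr fun n => ?_
      rw [← map_sub, norm_expI (hB n)]
    have h2 := h1.add (hv s (v t x))
    rw [zero_add] at h2
    refine h2.congr fun n => ?_
    rw [sub_add_cancel, expI_add, mul_apply_eq_comp]
  have hzero : ∀ x, v 0 x = x := fun x => by
    refine tendsto_nhds_unique (hv 0 x) (tendsto_const_nhds.congr fun n => ?_)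
    rw [expI_zero]; rfl
  let L : ℝ → H →L[ℂ] H := fun t => LinearMap.mkContinuous
    { toFun := v t
      map_add' := fun x y => tendsto_nhds_unique (hv t (x + y))
        (by simpa only [map_add] using (hv t x).add (hv t y))
      map_smul' := fun c x => tendsto_nhds_unique (hv t (c • x))
        (by simpa only [map_smul] using! (hv t x).const_smul c) } 1
    (fun x => by rw [one_mul]; exact (hnorm t x).le)
  have hL : ∀ t x, L t x = v t x := fun _ _ => rfl
  have hLL : ∀ s t, L s * L t = L (s + t) := fun s t => by
    ext x; exact hmul s t x
  have hL0 : L 0 = 1 := by ext x; exact hzero x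
  have hstar : ∀ t, star (L t) * L t = 1 := fun t => by
    rw [ContinuousLinearMap.star_eq_adjoint]
    exact (ContinuousLinearMap.norm_map_iff_adjoint_comp_self (L t)).mp (hnorm t)
  -- The limits are so far only isometries. The group law supplies the inverse L(-t), which must
  -- then be the adjoint.
  have hstar' : ∀ t, star (L t) = L (-t) := fun t => by
    calc star (L t) = star (L t) * (L t * L (-t)) := by
          rw [hLL, add_neg_cancel, hL0, mul_one]
      _ = L (-t) := by rw [← mul_assoc, hstar, one_mul]
  let V : ℝ → unitary (H →L[ℂ] H) := fun t => ⟨L t, by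
    rw [Unitary.mem_iff]
    refine ⟨hstar t, ?_⟩
    rw [hstar', hLL, add_neg_cancel, hL0]⟩
  refine ⟨V, isUnitaryGroupOf_of_hasDerivAt hT (fun s t => Subtype.ext (hLL s t).symm) ?_⟩
  intro x y hxy
  change HasDerivAt (fun t => v t x) _ _
  -- The error is linear in |t| with a coefficient that is small for large n. One fixed n therefore
  -- transfers differentiability at 0 from the bounded group to the limit.
  have hle : ∀ n t, ‖v t x - expI (B n) t x‖ ≤ |t| * ‖y - B n x‖ := by
    intro n t
    have h1 : Tendsto (fun m => ‖expI (B m) t x - expI (B n) t x‖) atTop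
        (𝓝 ‖v t x - expI (B n) t x‖) := ((hv t x).sub_const _).norm
    have h2 : Tendsto (fun m => |t| * ‖B m x - B n x‖) atTop (𝓝 (|t| * ‖y - B n x‖)) :=
      (((hlim x y hxy).sub_const _).norm).const_mul _
    exact le_of_tendsto_of_tendsto' h1 h2
      fun m => norm_expI_sub_expI_le (hB m) (hB n) (hcomm m n) x t
  rw [hasDerivAt_iff_isLittleO, Asymptotics.isLittleO_iff]
  intro ε hε
  obtain ⟨n, hn⟩ := ((Metric.tendsto_nhds.mp (hlim x y hxy)) (ε / 3) (by positivity)).exists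
  have h1 := hasDerivAt_expI_apply (B n) x 0
  rw [hasDerivAt_iff_isLittleO, Asymptotics.isLittleO_iff] at h1
  filter_upwards [h1 (by positivity : 0 < ε / 3)] with t ht
  simp only [expI_zero, sub_zero, hzero, Real.norm_eq_abs, one_apply_eq_self] at ht ⊢
  have h2 := hle n t
  rw [dist_eq_norm] at hn
  have h4 : v t x - x - t • Complex.I • y = (v t x - expI (B n) t x)
      + (expI (B n) t x - x - t • Complex.I • (B n) x) + t • Complex.I • (B n x - y) := by
    simp only [smul_sub]; abel
  have h5 : ‖t • Complex.I • (B n x - y)‖ = |t| * ‖B n x - y‖ := by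
    rw [norm_smul, norm_smul]; simp
  rw [h4]
  refine (norm_add₃_le).trans ?_
  rw [h5]
  rw [norm_sub_rev] at h2
  rw [norm_sub_rev y] at h2
  rw [norm_sub_rev (v t x)]
  nlinarith [abs_nonneg t]

theorem IsUnitaryGroupOf.map_zero {T : H →ₗ.[ℂ] H} {V : ℝ → unitary (H →L[ℂ] H)}
    (h : IsUnitaryGroupOf V T) : V 0 = 1 := by
  have := h.map_add 0 0
  rw [add_zero] at this
  exact mul_eq_left.mp this.symm

theorem IsUnitaryGroupOf.hasDerivAt {T : H →ₗ.[ℂ] H} {V : ℝ → unitary (H →L[ℂ] H)}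
    (h : IsUnitaryGroupOf V T) {ψ η : H} (hψ : (ψ, η) ∈ T.graph) (t : ℝ) :
    HasDerivAt (fun s => (V s : H →L[ℂ] H) ψ) ((V t : H →L[ℂ] H) (Complex.I • η)) t := by
  have h1 := hasDerivAt_clm_apply (V t : H →L[ℂ] H) ((h.generator ψ η).mp hψ)
  have h2 : HasDerivAt (fun s : ℝ => s - t) 1 t := (hasDerivAt_id t).sub_const t
  have h3 := HasDerivAt.scomp (g₁ := fun s => (V t : H →L[ℂ] H) ((V s : H →L[ℂ] H) ψ))
    (h := fun s : ℝ => s - t) t (by simpa only [sub_self] using h1) h2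
  rw [one_smul] at h3
  refine h3.congr_of_eventuallyEq (Eventually.of_forall fun s => ?_)
  have := h.map_add t (s - t)
  rw [add_sub_cancel] at this
  exact DFunLike.congr_fun (congrArg Subtype.val this) ψ

/-- V(t) commutes with the group it belongs to, so it carries the derivative at 0 of the orbit of ψ
to that of the orbit of V(t)ψ. -/
theorem IsUnitaryGroupOf.apply_mem_graph {T : H →ₗ.[ℂ] H} {V : ℝ → unitary (H →L[ℂ] H)}
    (h : IsUnitaryGroupOf V T) {ψ η : H} (hψ : (ψ, η) ∈ T.graph) (t : ℝ) :
    ((V t : H →L[ℂ] H) ψ, (V t : H →L[ℂ] H) η) ∈ T.graph := by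
  rw [h.generator, ← map_smul]
  refine (hasDerivAt_clm_apply (V t : H →L[ℂ] H) ((h.generator ψ η).mp hψ)).congr_of_eventuallyEq
    (Eventually.of_forall fun s => ?_)
  change (V s * V t : unitary (H →L[ℂ] H)).1 ψ = (V t * V s : unitary (H →L[ℂ] H)).1 ψ
  rw [← h.map_add, ← h.map_add, add_comm]

/-- A self-adjoint operator generates only one unitary group. -/
theorem IsUnitaryGroupOf.unique {T : H →ₗ.[ℂ] H} (hT : IsSelfAdjoint T)
    {V W : ℝ → unitary (H →L[ℂ] H)} (hV : IsUnitaryGroupOf V T) (hW : IsUnitaryGroupOf W T) :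
    V = W := by
  funext t
  have key : ∀ a b, (a, b) ∈ T.graph → ∀ c d, (c, d) ∈ T.graph →
      ⟪(V t : H →L[ℂ] H) a, (W t : H →L[ℂ] H) c⟫_ℂ = ⟪a, c⟫_ℂ := by
    intro a b hab c d hcd
    -- Symmetry of T makes the two contributions to the derivative of ⟨V(s)a, W(s)c⟩ cancel. The
    -- value at t then equals the value at 0, which says W(t)*V(t) = 1 weakly.
    have hd : ∀ s : ℝ, HasDerivAt
        (fun s => ⟪(V s : H →L[ℂ] H) a, (W s : H →L[ℂ] H) c⟫_ℂ) 0 s := by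
      intro s
      have h1 := (hV.hasDerivAt hab s).inner ℂ (hW.hasDerivAt hcd s)
      have h2 := inner_graph_of_isSelfAdjoint hT (hV.apply_mem_graph hab s)
        (hW.apply_mem_graph hcd s)
      rw [map_smul, map_smul, inner_smul_left, inner_smul_right, Complex.conj_I, h2, neg_mul,
        add_neg_cancel] at h1
      exact h1
    have h1 := is_const_of_deriv_eq_zero (𝕜 := ℝ)
      (f := fun s => ⟪(V s : H →L[ℂ] H) a, (W s : H →L[ℂ] H) c⟫_ℂ)
      (fun s => (hd s).differentiableAt) (fun s => (hd s).deriv) t 0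
    simp only [hV.map_zero, hW.map_zero] at h1
    exact h1
  have hd := dense_graph_fst hT
  refine Subtype.ext (ContinuousLinearMap.coeFn_injective ?_)
  refine Continuous.ext_on hd (V t : H →L[ℂ] H).continuous (W t : H →L[ℂ] H).continuous ?_
  rintro a ⟨b, hab⟩
  have h1 : ∀ c, ⟪(V t : H →L[ℂ] H) a - (W t : H →L[ℂ] H) a, (W t : H →L[ℂ] H) c⟫_ℂ = 0 := by
    intro c
    have : (fun c => ⟪(V t : H →L[ℂ] H) a - (W t : H →L[ℂ] H) a, (W t : H →L[ℂ] H) c⟫_ℂ)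
        = fun _ => 0 := by
      refine Continuous.ext_on hd (by fun_prop) continuous_const ?_
      rintro c ⟨d, hcd⟩
      change ⟪_, _⟫_ℂ = 0
      rw [inner_sub_left, key a b hab c d hcd, inner_unitary_apply, sub_self]
    exact congrFun this c
  have h2 := h1 (((star (W t) : unitary (H →L[ℂ] H)) : H →L[ℂ] H)
    ((V t : H →L[ℂ] H) a - (W t : H →L[ℂ] H) a))
  rw [unitary_apply_star_apply] at h2
  exact sub_eq_zero.mp (inner_self_eq_zero.mp h2)

/-- If the unitary `u` maps a core of `T` into the domain of `S` and intertwines there, it intertwines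
the unitary groups. -/
theorem IsUnitaryGroupOf.conj {T S : H →ₗ.[ℂ] H} (hT : IsSelfAdjoint T) (hS : IsSelfAdjoint S)
    {V : ℝ → unitary (H →L[ℂ] H)} (hV : IsUnitaryGroupOf V T) (u : unitary (H →L[ℂ] H))
    (hu : ∀ a b, (a, b) ∈ T.graph → ((u : H →L[ℂ] H) a, (u : H →L[ℂ] H) b) ∈ S.graph) :
    IsUnitaryGroupOf (fun t => u * V t * star u) S := by
  refine isUnitaryGroupOf_of_hasDerivAt hS (fun s t => ?_) fun ψ η h => ?_
  · simp only [hV.map_add, mul_assoc]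
    rw [← mul_assoc (star u) u, Unitary.star_mul_self, one_mul]
  -- One inclusion of graphs suffices: uTu* ⊆ S gives S = S* ⊆ (uTu*)* = uTu*.
  · have h1 : ((star u : unitary (H →L[ℂ] H)).1 ψ, (star u : unitary (H →L[ℂ] H)).1 η)
        ∈ T.graph := by
      rw [mem_graph_iff_of_isSelfAdjoint hT]
      intro a b hab
      have h2 := inner_graph_of_isSelfAdjoint hS (hu a b hab) h
      rw [← inner_unitary_apply u b, ← inner_unitary_apply u a, unitary_apply_star_apply,
        unitary_apply_star_apply]
      exact h2
    have h2 := hasDerivAt_clm_apply (u : H →L[ℂ] H) ((hV.generator _ _).mp h1)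
    rw [map_smul, unitary_apply_star_apply] at h2
    exact h2

variable {D : Submodule ℂ H}

theorem mem_graph_toPMap (A : D →ₗ[ℂ] D) (ψ : D) : ((ψ : H), (A ψ : H)) ∈ (toPMap A).graph :=
  (toPMap A).mem_graph ψ

theorem mem_graph_closure (A : D →ₗ[ℂ] D) (ψ : D) :
    ((ψ : H), (A ψ : H)) ∈ (toPMap A).closure.graph :=
  LinearPMap.le_graph_of_le (toPMap A).le_closure (mem_graph_toPMap A ψ)

theorem exists_of_mem_graph_toPMap {A : D →ₗ[ℂ] D} {x y : H} (h : (x, y) ∈ (toPMap A).graph) :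
    ∃ ψ : D, (ψ : H) = x ∧ (A ψ : H) = y := by
  obtain ⟨ψ, h1, h2⟩ := (LinearPMap.mem_graph_iff _).mp h
  exact ⟨ψ, h1, h2⟩

/-- The graph of the closure of an essentially self-adjoint operator is contained in every closed set
containing the graph of the operator. -/
theorem IsEssSelfAdjoint.graph_closure_subset {A : D →ₗ[ℂ] D} (hA : IsEssSelfAdjoint A)
    {s : Set (H × H)} (hs : IsClosed s) (h : ∀ ψ : D, ((ψ : H), (A ψ : H)) ∈ s) :
    ((toPMap A).closure.graph : Set (H × H)) ⊆ s := by
  have hc : (toPMap A).IsClosable := by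
    rw [LinearPMap.isClosable_iff_exists_closed_extension]
    exact ⟨_, hA.2.isClosed, (toPMap A).le_closure⟩
  rw [← hc.graph_closure_eq_closure_graph, Submodule.topologicalClosure_coe]
  refine closure_minimal ?_ hs
  rintro ⟨x, y⟩ hxy
  obtain ⟨ψ, rfl, rfl⟩ := exists_of_mem_graph_toPMap hxy
  exact h ψ

/-- For an essentially self-adjoint operator, membership in the graph of the closure can be tested
on the original domain. -/
theorem IsEssSelfAdjoint.mem_graph_closure_of_forall {A : D →ₗ[ℂ] D} (hA : IsEssSelfAdjoint A)
    {x y : H} (h : ∀ φ : D, ⟪(A φ : H), x⟫_ℂ = ⟪(φ : H), y⟫_ℂ) :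
    (x, y) ∈ (toPMap A).closure.graph := by
  rw [mem_graph_iff_of_isSelfAdjoint hA.2]
  intro a b hab
  exact hA.graph_closure_subset (s := {p | ⟪p.2, x⟫_ℂ = ⟪p.1, y⟫_ℂ})
    (isClosed_eq (by fun_prop) (by fun_prop)) h hab

/-- The intertwining relation is needed only on the core D, because the set of pairs satisfying it
is closed and so contains the graph of the closure of A. -/
theorem IsEssSelfAdjoint.conj_group {A B : D →ₗ[ℂ] D} (hA : IsEssSelfAdjoint A)
    (hB : IsEssSelfAdjoint B) {V : ℝ → unitary (H →L[ℂ] H)}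
    (hV : IsUnitaryGroupOf V (toPMap A).closure) (u : unitary (H →L[ℂ] H))
    (hu : ∀ ψ : D, ((u : H →L[ℂ] H) ψ, (u : H →L[ℂ] H) (A ψ)) ∈ (toPMap B).closure.graph) :
    IsUnitaryGroupOf (fun t => u * V t * star u) (toPMap B).closure := by
  refine hV.conj hA.2 hB.2 u fun a b hab => ?_
  refine hA.graph_closure_subset
    (s := (fun p : H × H => ((u : H →L[ℂ] H) p.1, (u : H →L[ℂ] H) p.2)) ⁻¹'
      ((toPMap B).closure.graph : Set (H × H))) (IsClosed.preimage (by fun_prop) hB.2.isClosed) hu hab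

theorem IsEssSelfAdjoint.exists_isExpI {A : D →ₗ[ℂ] D} (hA : IsEssSelfAdjoint A) :
    ∃ u, IsExpI A u := by
  obtain ⟨V, hV⟩ := exists_isUnitaryGroupOf hA.2
  exact ⟨V 1, V, hV, rfl⟩

theorem IsExpI.unique {A : D →ₗ[ℂ] D} (hA : IsEssSelfAdjoint A) {u v : unitary (H →L[ℂ] H)}
    (hu : IsExpI A u) (hv : IsExpI A v) : u = v := by
  obtain ⟨V, hV, rfl⟩ := hu
  obtain ⟨W, hW, rfl⟩ := hv
  rw [hV.unique hA.2 hW]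

theorem IsExpI.conj {A B : D →ₗ[ℂ] D} (hA : IsEssSelfAdjoint A)
    (hB : IsEssSelfAdjoint B) {w u : unitary (H →L[ℂ] H)} (hw : IsExpI A w)
    (hu : ∀ ψ : D, ((u : H →L[ℂ] H) ψ, (u : H →L[ℂ] H) (A ψ)) ∈ (toPMap B).closure.graph) :
    IsExpI B (u * w * star u) := by
  obtain ⟨V, hV, rfl⟩ := hw
  exact ⟨_, hA.conj_group hB hV u hu, rfl⟩

/-- The unitary group of `A`, reparametrized, consists of the exponentials of the multiples of
`A`. -/
theorem IsUnitaryGroupOf.isExpI_smul {A : D →ₗ[ℂ] D} {V : ℝ → unitary (H →L[ℂ] H)}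
    (hA : IsEssSelfAdjoint A) (hV : IsUnitaryGroupOf V (toPMap A).closure) (t : ℝ)
    (ht : IsEssSelfAdjoint (t • A)) : IsExpI (t • A) (V t) := by
  refine ⟨fun s => V (t * s), isUnitaryGroupOf_of_hasDerivAt ht.2
    (fun s r => by rw [mul_add, hV.map_add]) fun ψ η h => ?_, congrArg V (mul_one t)⟩
  have hc : ∀ a b : H, (a, b) ∈ (toPMap A).closure.graph →
      HasDerivAt (fun s => (V (t * s) : H →L[ℂ] H) a) (Complex.I • ((t : ℂ) • b)) 0 := by
    intro a b hab
    have h1 := hV.hasDerivAt hab (t * 0)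
    have h2 : HasDerivAt (fun s : ℝ => t * s) t 0 := by
      simpa using (hasDerivAt_id (0 : ℝ)).const_mul t
    have h3 := HasDerivAt.scomp (0 : ℝ) h1 h2
    rw [mul_zero, hV.map_zero] at h3
    have h4 : t • ((1 : unitary (H →L[ℂ] H)) : H →L[ℂ] H) (Complex.I • b)
        = Complex.I • ((t : ℂ) • b) := by
      change t • (Complex.I • b) = _
      rw [smul_comm]; rfl
    rw [h4] at h3
    exact h3
  -- For t = 0 the closure of `t • A` is a zero operator whose domain need not lie in that of the
  -- closure of A. Both sides are then constant in s.
  by_cases h0 : t = 0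
  · have h1 : (fun s => (V (t * s) : H →L[ℂ] H) ψ) = fun _ => ψ := by
      funext s; rw [h0, zero_mul, hV.map_zero]; rfl
    have h2 : η = 0 := by
      refine ht.graph_closure_subset (s := {p | p.2 = 0})
        (isClosed_eq continuous_snd continuous_const) (fun φ => ?_) h
      simp [h0]
    rw [h1, h2, smul_zero]
    exact hasDerivAt_const _ _
  · have h1 : (ψ, ((t : ℂ)⁻¹) • η) ∈ (toPMap A).closure.graph := by
      refine ht.graph_closure_subset
        (s := (fun p : H × H => (p.1, ((t : ℂ)⁻¹) • p.2)) ⁻¹' ((toPMap A).closure.graph : Set (H × H)))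
        (IsClosed.preimage (by fun_prop) hA.2.isClosed) (fun φ => ?_) h
      have h2 : ((t : ℂ)⁻¹) • (((t • A) φ : D) : H) = (A φ : H) := by
        change ((t : ℂ)⁻¹) • ((t : ℂ) • (A φ : H)) = _
        rw [smul_smul, inv_mul_cancel₀ (by exact_mod_cast h0), one_smul]
      simp only [mem_preimage, h2]
      exact mem_graph_closure A φ
    have h2 := hc _ _ h1
    rw [smul_smul (t : ℂ), mul_inv_cancel₀ (by exact_mod_cast h0), one_smul] at h2
    exact h2

/-- A unitary commuting with the unitary group of `A` leaves the closure of `A` invariant. -/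
theorem IsUnitaryGroupOf.map_graph_of_commute {T : H →ₗ.[ℂ] H} {V : ℝ → unitary (H →L[ℂ] H)}
    (hV : IsUnitaryGroupOf V T) {u : unitary (H →L[ℂ] H)} (hu : ∀ t, u * V t = V t * u) {a b : H}
    (hab : (a, b) ∈ T.graph) : ((u : H →L[ℂ] H) a, (u : H →L[ℂ] H) b) ∈ T.graph := by
  rw [hV.generator, ← map_smul]
  refine (hasDerivAt_clm_apply (u : H →L[ℂ] H) ((hV.generator _ _).mp hab)).congr_of_eventuallyEq
    (Eventually.of_forall fun s => ?_)
  exact (DFunLike.congr_fun (congrArg Subtype.val (hu s)) a).symm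

/-- A unitary which commutes with the exponentials of the multiples of the essentially self-adjoint
operators `Aᵢ` commutes with the exponential of their sum. -/
theorem commute_isExpI_sum {ι : Type*} (s : Finset ι) {A : ι → D →ₗ[ℂ] D}
    (hA : ∀ i ∈ s, ∀ t : ℝ, IsEssSelfAdjoint (t • A i)) (hS : IsEssSelfAdjoint (∑ i ∈ s, A i))
    {u : unitary (H →L[ℂ] H)}
    (hu : ∀ i ∈ s, ∀ (t : ℝ) (v : unitary (H →L[ℂ] H)), IsExpI (t • A i) v → u * v = v * u)
    {w : unitary (H →L[ℂ] H)} (hw : IsExpI (∑ i ∈ s, A i) w) : u * w = w * u := by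
  have hA1 : ∀ i ∈ s, IsEssSelfAdjoint (A i) := fun i hi => by simpa using hA i hi 1
  -- The vector uψ lies in the domain of the closure of each Aᵢ, but this alone does not place it in
  -- the domain of the closure of the sum. Essential self-adjointness of the sum does: it is enough
  -- to test against vectors of D, where the sum splits into its terms.
  have key : ∀ ψ : D, ((u : H →L[ℂ] H) ψ, (u : H →L[ℂ] H) ((∑ i ∈ s, A i) ψ : D))
      ∈ (toPMap (∑ i ∈ s, A i)).closure.graph := by
    intro ψ
    refine hS.mem_graph_closure_of_forall fun φ => ?_
    simp only [LinearMap.sum_apply, Submodule.coe_sum, map_sum, sum_inner, inner_sum]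
    refine Finset.sum_congr rfl fun i hi => ?_
    obtain ⟨V, hV⟩ := exists_isUnitaryGroupOf (hA1 i hi).2
    have h1 : ∀ t, u * V t = V t * u := fun t =>
      hu i hi t (V t) (hV.isExpI_smul (hA1 i hi) t (hA i hi t))
    exact inner_graph_of_isSelfAdjoint (hA1 i hi).2 (mem_graph_closure (A i) φ)
      (hV.map_graph_of_commute h1 (mem_graph_closure (A i) ψ))
  have h1 := (hw.conj hS hS key).unique hS hw
  calc u * w = u * w * (star u * u) := by rw [Unitary.star_mul_self, mul_one]
    _ = w * u := by rw [← mul_assoc, h1]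

end UnitaryGroups

/-! ### Green's theorem on the triangle: a smooth and a Lipschitz function -/

section Green

open Filter Topology
open scoped NNReal Convolution

/-- The coordinate vectors of the parameter plane. -/
abbrev planeBasis (i : Fin 2) : Fin 2 → ℝ := Pi.single i 1

theorem vec_eq_add_smul_snd (x y : ℝ) : (![x, y] : Fin 2 → ℝ) = ![x, 0] + y • planeBasis 1 := by
  ext i; fin_cases i <;> simp

theorem vec_eq_add_smul_fst (x y : ℝ) : (![x, y] : Fin 2 → ℝ) = ![0, y] + x • planeBasis 0 := by
  ext i; fin_cases i <;> simp

theorem mem_Delta_two {x y : ℝ} : (![x, y] : Fin 2 → ℝ) ∈ Delta 2 ↔ 0 ≤ x ∧ 0 ≤ y ∧ x + y ≤ 1 := by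
  simp [Delta, Fin.forall_fin_two, and_assoc]

theorem continuous_vec_pair : Continuous fun p : ℝ × ℝ => (![p.1, p.2] : Fin 2 → ℝ) :=
  continuous_pi fun i => by fin_cases i <;> simp <;> fun_prop

theorem measurableSet_Delta (n : ℕ) : MeasurableSet (Delta n) := (isCompact_Delta n).measurableSet

/-- The slice at x = 0 is a full unit segment, although 0 is outside `Ioc 0 1`. The last term
corrects this, so that the identity holds for every x; `integral_slices_eq` then discards it as
supported on a null set. -/
theorem integral_indicator_slice (G : ℝ → ℝ) (P : ℝ → Prop) (x : ℝ)
    (hP : ∀ y, P y ↔ 0 ≤ x ∧ 0 ≤ y ∧ x + y ≤ 1) :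
    ∫ y, ({y | P y} : Set ℝ).indicator G y
      = (Ioc (0 : ℝ) 1).indicator (fun x => ∫ y in (0 : ℝ)..(1 - x), G y) x
        + (if x = 0 then ∫ y in (0 : ℝ)..1, G y else 0) := by
  by_cases hx : 0 ≤ x ∧ x ≤ 1
  · have h1 : {y | P y} = Icc 0 (1 - x) := by
      ext y
      simp only [mem_ofPred_eq, hP, mem_Icc]
      exact ⟨fun h => ⟨h.2.1, by linarith⟩, fun h => ⟨hx.1, h.1, by linarith⟩⟩
    rw [h1, integral_indicator measurableSet_Icc, integral_Icc_eq_integral_Ioc,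
      ← intervalIntegral.integral_of_le (by linarith)]
    by_cases h0 : x = 0
    · subst h0; simp
    · have : x ∈ Ioc (0 : ℝ) 1 := ⟨lt_of_le_of_ne hx.1 (Ne.symm h0), hx.2⟩
      simp [this, h0]
  · have h1 : {y | P y} = ∅ := by
      ext y
      simp only [mem_ofPred_eq, hP, mem_empty_iff_false, iff_false]
      rintro ⟨h1, h2, h3⟩
      exact hx ⟨h1, by linarith⟩
    have h2 : x ∉ Ioc (0 : ℝ) 1 := fun h => hx ⟨h.1.le, h.2⟩
    have h3 : x ≠ 0 := by rintro rfl; simp at hx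
    simp [h1, h2, h3]

theorem integral_slices_eq (Φ : ℝ → ℝ) (c : ℝ) :
    ∫ x, ((Ioc (0 : ℝ) 1).indicator Φ x + (if x = 0 then c else 0)) = ∫ x in (0 : ℝ)..1, Φ x := by
  rw [intervalIntegral.integral_of_le zero_le_one, ← integral_indicator measurableSet_Ioc]
  refine integral_congr_ae ?_
  have : ∀ᵐ x : ℝ, x ≠ 0 := by simp [ae_iff]
  filter_upwards [this] with x hx
  simp [hx]

theorem integrable_indicator_pair {F : (Fin 2 → ℝ) → ℝ} (hF : IntegrableOn F (Delta 2)) :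
    Integrable (fun p : ℝ × ℝ => (Delta 2).indicator F ![p.1, p.2]) (volume.prod volume) := by
  have h := (volume_preserving_finTwoArrow ℝ).symm
  have h1 := (hF.integrable_indicator (measurableSet_Delta 2))
  exact (h.integrable_comp_emb (MeasurableEquiv.measurableEmbedding _)).mpr h1

theorem integral_Delta_two_eq_prod (F : (Fin 2 → ℝ) → ℝ) :
    ∫ t in Delta 2, F t = ∫ p : ℝ × ℝ, (Delta 2).indicator F ![p.1, p.2] := by
  rw [← integral_indicator (measurableSet_Delta 2)]
  exact ((volume_preserving_finTwoArrow ℝ).symm.integral_comp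
    (MeasurableEquiv.measurableEmbedding _) _).symm

theorem integral_Delta_two {F : (Fin 2 → ℝ) → ℝ} (hF : IntegrableOn F (Delta 2)) :
    ∫ t in Delta 2, F t = ∫ x in (0 : ℝ)..1, ∫ y in (0 : ℝ)..(1 - x), F ![x, y] := by
  rw [integral_Delta_two_eq_prod]
  refine (integral_prod _ (integrable_indicator_pair hF)).trans ?_
  rw [← integral_slices_eq _ (∫ y in (0 : ℝ)..1, F ![0, y])]
  refine integral_congr_ae (Eventually.of_forall fun x => ?_)
  have h := integral_indicator_slice (fun y => F ![x, y]) (fun y => ![x, y] ∈ Delta 2) x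
    (fun y => mem_Delta_two)
  refine Eq.trans ?_ (h.trans ?_)
  · rfl
  · by_cases h0 : x = 0
    · subst h0; simp
    · simp [h0, indicator]

theorem integral_Delta_two_swap {F : (Fin 2 → ℝ) → ℝ} (hF : IntegrableOn F (Delta 2)) :
    ∫ t in Delta 2, F t = ∫ y in (0 : ℝ)..1, ∫ x in (0 : ℝ)..(1 - y), F ![x, y] := by
  rw [integral_Delta_two_eq_prod]
  refine (integral_prod_symm _ (integrable_indicator_pair hF)).trans ?_
  rw [← integral_slices_eq _ (∫ y in (0 : ℝ)..1, F ![y, 0])]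
  refine integral_congr_ae (Eventually.of_forall fun x => ?_)
  have h := integral_indicator_slice (fun y => F ![y, x]) (fun y => ![y, x] ∈ Delta 2) x
    (fun y => by rw [mem_Delta_two]; constructor <;> rintro ⟨h1, h2, h3⟩ <;>
                  exact ⟨h2, h1, by linarith⟩)
  refine Eq.trans ?_ (h.trans ?_)
  · rfl
  · by_cases h0 : x = 0
    · subst h0; simp
    · simp [h0, indicator]

theorem lineDeriv_along {E : Type*} [NormedAddCommGroup E] [NormedSpace ℝ E] (B : E → ℝ) (p v : E)
    (s : ℝ) : lineDeriv ℝ B (p + s • v) v = deriv (fun r : ℝ => B (p + r • v)) s := by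
  have h := deriv_comp_const_add (fun r : ℝ => B (p + r • v)) s 0
  rw [add_zero] at h
  rw [lineDeriv, ← h]
  congr 1
  funext r
  rw [add_smul, add_assoc]

/-- Integration by parts along a segment. -/
theorem integral_segment_mul_lineDeriv {E : Type*} [NormedAddCommGroup E] [NormedSpace ℝ E]
    {f B : E → ℝ} (hf : ContDiff ℝ 1 f) {K : ℝ≥0} (hB : LipschitzWith K B) (p v : E) (a b : ℝ) :
    ∫ s in a..b, f (p + s • v) * lineDeriv ℝ B (p + s • v) v
      = f (p + b • v) * B (p + b • v) - f (p + a • v) * B (p + a • v)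
        - ∫ s in a..b, fderiv ℝ f (p + s • v) v * B (p + s • v) := by
  have hl : ContDiff ℝ 1 fun s : ℝ => p + s • v := by fun_prop
  have h1 : AbsolutelyContinuousOnInterval (fun s : ℝ => f (p + s • v)) a b :=
    (hf.comp hl).contDiffOn.absolutelyContinuousOnInterval
  have h2 : AbsolutelyContinuousOnInterval (fun s : ℝ => B (p + s • v)) a b := by
    have : LipschitzWith ‖v‖₊ fun s : ℝ => p + s • v := by
      refine LipschitzWith.of_dist_le_mul fun s t => ?_
      rw [dist_add_left, dist_eq_norm, ← sub_smul, norm_smul, mul_comm, dist_eq_norm]; rfl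
    exact (hB.comp this).lipschitzOnWith.absolutelyContinuousOnInterval
  have h3 := h1.integral_mul_deriv_eq_deriv_mul h2
  simp only [lineDeriv_along]
  rw [h3]
  congr 1
  refine intervalIntegral.integral_congr fun s _ => ?_
  have h4 : HasDerivAt (fun s : ℝ => f (p + s • v)) (fderiv ℝ f (p + s • v) v) s := by
    have h5 := (hf.differentiable one_ne_zero (p + s • v)).hasFDerivAt
    have h6 : HasDerivAt (fun s : ℝ => p + s • v) v s := by
      simpa using ((hasDerivAt_id s).smul_const v).const_add p
    exact h5.comp_hasDerivAt s h6
  simp only [h4.deriv]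

theorem integrableOn_mul_lineDeriv {f B : (Fin 2 → ℝ) → ℝ} (hf : Continuous f) {K : ℝ≥0}
    (hB : LipschitzWith K B) (v : Fin 2 → ℝ) :
    IntegrableOn (fun t => f t * lineDeriv ℝ B t v) (Delta 2) :=
  ((hB.locallyIntegrable_lineDeriv v).integrableOn_isCompact (isCompact_Delta 2)).continuousOn_mul
    hf.continuousOn (isCompact_Delta 2)

theorem integrableOn_Delta {f : (Fin 2 → ℝ) → ℝ} (hf : Continuous f) : IntegrableOn f (Delta 2) :=
  hf.continuousOn.integrableOn_compact (isCompact_Delta 2)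

theorem continuous_fderiv_apply_of_contDiff {f : (Fin 2 → ℝ) → ℝ} (hf : ContDiff ℝ 1 f)
    (v : Fin 2 → ℝ) : Continuous fun t => fderiv ℝ f t v :=
  (hf.continuous_fderiv one_ne_zero).clm_apply continuous_const

/-- On each vertical segment B is absolutely continuous, so integration by parts is legitimate
there. The upper endpoints trace the hypotenuse and the lower ones the first axis. -/
theorem integral_Delta_mul_lineDeriv_snd {f B : (Fin 2 → ℝ) → ℝ} (hf : ContDiff ℝ 1 f) {K : ℝ≥0}
    (hB : LipschitzWith K B) :
    ∫ t in Delta 2, f t * lineDeriv ℝ B t (planeBasis 1)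
      = (∫ x in (0 : ℝ)..1, f ![x, 1 - x] * B ![x, 1 - x]) - (∫ x in (0 : ℝ)..1, f ![x, 0] * B ![x, 0])
        - ∫ t in Delta 2, fderiv ℝ f t (planeBasis 1) * B t := by
  have hi : IntegrableOn (fun t => fderiv ℝ f t (planeBasis 1) * B t) (Delta 2) := integrableOn_Delta
    ((continuous_fderiv_apply_of_contDiff hf (planeBasis 1)).mul hB.continuous)
  have hfc := hf.continuous
  have hBc := hB.continuous
  have hv : ∀ g : ℝ → ℝ, Continuous g → Continuous fun x : ℝ => (![x, g x] : Fin 2 → ℝ) := fun g hg =>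
    continuous_vec_pair.comp (continuous_id.prodMk hg)
  have e : ∀ x, ∫ y in (0 : ℝ)..(1 - x), f ![x, y] * lineDeriv ℝ B ![x, y] (planeBasis 1)
      = f ![x, 1 - x] * B ![x, 1 - x] - f ![x, 0] * B ![x, 0]
        - ∫ y in (0 : ℝ)..(1 - x), fderiv ℝ f ![x, y] (planeBasis 1) * B ![x, y] := fun x => by
    have h := integral_segment_mul_lineDeriv hf hB ![x, 0] (planeBasis 1) 0 (1 - x)
    simpa only [← vec_eq_add_smul_snd] using h
  rw [integral_Delta_two (integrableOn_mul_lineDeriv hfc hB _), integral_Delta_two hi]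
  simp only [e]
  have hc : Continuous fun x : ℝ =>
      ∫ y in (0 : ℝ)..(1 - x), fderiv ℝ f ![x, y] (planeBasis 1) * B ![x, y] := by
    refine intervalIntegral.continuous_parametric_intervalIntegral_of_continuous
      (f := fun x y => fderiv ℝ f ![x, y] (planeBasis 1) * B ![x, y]) ?_
      (continuous_const.sub continuous_id)
    exact ((continuous_fderiv_apply_of_contDiff hf (planeBasis 1)).mul hBc).comp continuous_vec_pair
  have h1 : Continuous fun x : ℝ => f ![x, 1 - x] * B ![x, 1 - x] :=
    (hfc.mul hBc).comp (hv _ (continuous_const.sub continuous_id))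
  have h2 : Continuous fun x : ℝ => f ![x, 0] * B ![x, 0] :=
    (hfc.mul hBc).comp (hv _ continuous_const)
  rw [intervalIntegral.integral_sub ((h1.fun_sub h2).intervalIntegrable _ _) (hc.intervalIntegrable _ _),
    intervalIntegral.integral_sub (h1.intervalIntegrable _ _) (h2.intervalIntegrable _ _)]

theorem integral_Delta_mul_lineDeriv_fst {f B : (Fin 2 → ℝ) → ℝ} (hf : ContDiff ℝ 1 f) {K : ℝ≥0}
    (hB : LipschitzWith K B) :
    ∫ t in Delta 2, f t * lineDeriv ℝ B t (planeBasis 0)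
      = (∫ y in (0 : ℝ)..1, f ![1 - y, y] * B ![1 - y, y]) - (∫ y in (0 : ℝ)..1, f ![0, y] * B ![0, y])
        - ∫ t in Delta 2, fderiv ℝ f t (planeBasis 0) * B t := by
  have hi : IntegrableOn (fun t => fderiv ℝ f t (planeBasis 0) * B t) (Delta 2) := integrableOn_Delta
    ((continuous_fderiv_apply_of_contDiff hf (planeBasis 0)).mul hB.continuous)
  have hfc := hf.continuous
  have hBc := hB.continuous
  have hv : ∀ g : ℝ → ℝ, Continuous g → Continuous fun x : ℝ => (![g x, x] : Fin 2 → ℝ) := fun g hg =>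
    continuous_vec_pair.comp (hg.prodMk continuous_id)
  have e : ∀ y, ∫ x in (0 : ℝ)..(1 - y), f ![x, y] * lineDeriv ℝ B ![x, y] (planeBasis 0)
      = f ![1 - y, y] * B ![1 - y, y] - f ![0, y] * B ![0, y]
        - ∫ x in (0 : ℝ)..(1 - y), fderiv ℝ f ![x, y] (planeBasis 0) * B ![x, y] := fun y => by
    have h := integral_segment_mul_lineDeriv hf hB ![0, y] (planeBasis 0) 0 (1 - y)
    simpa only [← vec_eq_add_smul_fst] using h
  rw [integral_Delta_two_swap (integrableOn_mul_lineDeriv hfc hB _), integral_Delta_two_swap hi]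
  simp only [e]
  have hc : Continuous fun y : ℝ =>
      ∫ x in (0 : ℝ)..(1 - y), fderiv ℝ f ![x, y] (planeBasis 0) * B ![x, y] := by
    refine intervalIntegral.continuous_parametric_intervalIntegral_of_continuous
      (f := fun y x => fderiv ℝ f ![x, y] (planeBasis 0) * B ![x, y]) ?_
      (continuous_const.sub continuous_id)
    exact ((continuous_fderiv_apply_of_contDiff hf (planeBasis 0)).mul hBc).comp
      (continuous_vec_pair.comp continuous_swap)
  have h1 : Continuous fun y : ℝ => f ![1 - y, y] * B ![1 - y, y] :=
    (hfc.mul hBc).comp (hv _ (continuous_const.sub continuous_id))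
  have h2 : Continuous fun y : ℝ => f ![0, y] * B ![0, y] :=
    (hfc.mul hBc).comp (hv _ continuous_const)
  rw [intervalIntegral.integral_sub ((h1.fun_sub h2).intervalIntegrable _ _) (hc.intervalIntegrable _ _),
    intervalIntegral.integral_sub (h1.intervalIntegrable _ _) (h2.intervalIntegrable _ _)]

/-- The edges of the triangle `Δ₂`, parametrized by the unit interval. -/
def edge (i : Fin 3) (s : ℝ) : Fin 2 → ℝ :=
  match i with
  | 0 => ![1 - s, s]
  | 1 => ![0, s]
  | 2 => ![s, 0]

theorem edge_eq_add_smul (i : Fin 3) (s : ℝ) : edge i s = edge i 0 + s • (edge i 1 - edge i 0) := by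
  fin_cases i <;> ext j <;> fin_cases j <;> simp [edge] <;> ring

theorem integral_edge_mul_deriv {f B : (Fin 2 → ℝ) → ℝ} (hf : ContDiff ℝ 1 f) {K : ℝ≥0}
    (hB : LipschitzWith K B) (i : Fin 3) :
    ∫ s in (0 : ℝ)..1, f (edge i s) * deriv (fun s => B (edge i s)) s
      = f (edge i 1) * B (edge i 1) - f (edge i 0) * B (edge i 0)
        - ∫ s in (0 : ℝ)..1, fderiv ℝ f (edge i s) (edge i 1 - edge i 0) * B (edge i s) := by
  have h := integral_segment_mul_lineDeriv hf hB (edge i 0) (edge i 1 - edge i 0) 0 1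
  have e : ∀ s, lineDeriv ℝ B (edge i s) (edge i 1 - edge i 0)
      = deriv (fun s => B (edge i s)) s := fun s => by
    conv_lhs => rw [edge_eq_add_smul i s]
    rw [lineDeriv_along]
    simp only [← edge_eq_add_smul]
  simp only [← edge_eq_add_smul, e] at h
  exact h

/-- **Green's theorem** on the triangle, for a smooth and a Lipschitz function. -/
theorem green_smooth {A B : (Fin 2 → ℝ) → ℝ} (hA : ContDiff ℝ 2 A) {K : ℝ≥0}
    (hB : LipschitzWith K B) :
    ∫ t in Delta 2, (fderiv ℝ A t (planeBasis 0) * lineDeriv ℝ B t (planeBasis 1)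
        - fderiv ℝ A t (planeBasis 1) * lineDeriv ℝ B t (planeBasis 0))
      = ∑ i : Fin 3, (-1) ^ (i : ℕ) *
          ∫ s in (0 : ℝ)..1, A (edge i s) * deriv (fun s => B (edge i s)) s := by
  have hA1 : ContDiff ℝ 1 A := hA.of_le (by norm_num)
  have hd : ∀ v, ContDiff ℝ 1 fun t => fderiv ℝ A t v := fun v =>
    (hA.fderiv_right (m := 1) (by norm_num)).clm_apply contDiff_const
  have hdc : ∀ v, Continuous fun t => fderiv ℝ A t v := fun v => (hd v).continuous
  have hBc := hB.continuous
  rw [integral_sub (integrableOn_mul_lineDeriv (hdc _) hB _)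
    (integrableOn_mul_lineDeriv (hdc _) hB _), integral_Delta_mul_lineDeriv_snd (hd _) hB,
    integral_Delta_mul_lineDeriv_fst (hd _) hB]
  -- After both integrations by parts the remaining area terms contain the two mixed second
  -- derivatives of A, and so they cancel.
  have hsymm : ∀ t, fderiv ℝ (fun t => fderiv ℝ A t (planeBasis 0)) t (planeBasis 1)
      = fderiv ℝ (fun t => fderiv ℝ A t (planeBasis 1)) t (planeBasis 0) := by
    intro t
    have h1 : ∀ v w, fderiv ℝ (fun t => fderiv ℝ A t v) t w = fderiv ℝ (fderiv ℝ A) t w v := by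
      intro v w
      have h2 : DifferentiableAt ℝ (fderiv ℝ A) t :=
        (hA.fderiv_right (m := 1) (by norm_num)).differentiable one_ne_zero t
      rw [fderiv_clm_apply h2 (differentiableAt_const v)]
      simp
    rw [h1, h1]
    exact (hA.contDiffAt.isSymmSndFDerivAt (by simp)) _ _
  simp only [hsymm]
  -- The two orders of integration parametrize the hypotenuse in opposite directions. The direction
  -- of `edge 0` is chosen.
  have hswap : ∫ x in (0 : ℝ)..1, fderiv ℝ A ![x, 1 - x] (planeBasis 0) * B ![x, 1 - x]
      = ∫ y in (0 : ℝ)..1, fderiv ℝ A ![1 - y, y] (planeBasis 0) * B ![1 - y, y] := by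
    have h := intervalIntegral.integral_comp_sub_left (a := 0) (b := 1)
      (fun x => fderiv ℝ A ![x, 1 - x] (planeBasis 0) * B ![x, 1 - x]) 1
    simp only [sub_sub_cancel, sub_self, sub_zero] at h
    exact h.symm
  rw [hswap, Fin.sum_univ_three]
  -- On the right-hand side the derivative moves from B to A along each edge. The endpoint terms
  -- cancel in the alternating sum, each vertex occurring once with each sign.
  simp only [integral_edge_mul_deriv hA1 hB]
  have e0 : edge 0 1 - edge 0 0 = planeBasis 1 - planeBasis 0 := by
    ext j; fin_cases j <;> simp [edge]
  have e1 : edge 1 1 - edge 1 0 = planeBasis 1 := by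
    ext j; fin_cases j <;> simp [edge]
  have e2 : edge 2 1 - edge 2 0 = planeBasis 0 := by
    ext j; fin_cases j <;> simp [edge]
  rw [e0, e1, e2]
  have hv : Continuous fun y : ℝ => (![1 - y, y] : Fin 2 → ℝ) :=
    continuous_vec_pair.comp ((continuous_const.sub continuous_id).prodMk continuous_id)
  have h1 : ∀ v, IntervalIntegrable (fun s => fderiv ℝ A (edge 0 s) v * B (edge 0 s)) volume 0 1 :=
    fun v => (((hdc v).mul hBc).comp hv).intervalIntegrable _ _
  have h2 : ∫ s in (0 : ℝ)..1, fderiv ℝ A (edge 0 s) (planeBasis 1 - planeBasis 0) * B (edge 0 s)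
      = (∫ s in (0 : ℝ)..1, fderiv ℝ A (edge 0 s) (planeBasis 1) * B (edge 0 s))
        - ∫ s in (0 : ℝ)..1, fderiv ℝ A (edge 0 s) (planeBasis 0) * B (edge 0 s) := by
    rw [← intervalIntegral.integral_sub (h1 _) (h1 _)]
    simp only [map_sub, sub_mul]
  rw [h2]
  simp only [edge, sub_self, sub_zero]
  norm_num
  ring

end Green

/-! ### Mollification and Green's theorem for two Lipschitz functions -/

section GreenLipschitz

open Filter Topology
open scoped NNReal Convolution

/-- Lipschitz functions are limits of smooth functions with uniformly bounded gradients which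
converge almost everywhere. -/
theorem exists_smooth_approx {E : Type*} [NormedAddCommGroup E] [NormedSpace ℝ E]
    [FiniteDimensional ℝ E] [MeasureSpace E] [BorelSpace E] [(volume : Measure E).IsAddHaarMeasure]
    {A : E → ℝ} {C : ℝ≥0} (hA : LipschitzWith C A) :
    ∃ a : ℕ → E → ℝ, (∀ n, ContDiff ℝ 2 (a n)) ∧ (∀ n t, ‖a n t - A t‖ ≤ C) ∧
      (∀ t, Tendsto (fun n => a n t) atTop (𝓝 (A t))) ∧
      (∀ n t v, ‖fderiv ℝ (a n) t v‖ ≤ C * ‖v‖) ∧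
      ∀ v, ∀ᵐ t : E, Tendsto (fun n => fderiv ℝ (a n) t v) atTop (𝓝 (lineDeriv ℝ A t v)) := by
  let φ : ℕ → ContDiffBump (0 : E) := fun n =>
    ⟨1 / (2 * ((n : ℝ) + 1)), 1 / ((n : ℝ) + 1), by positivity, by
      apply one_div_lt_one_div_of_lt <;> linarith [(by positivity : (0 : ℝ) < n + 1)]⟩
  have hφ0 : Tendsto (fun n => (φ n).rOut) atTop (𝓝 0) := tendsto_one_div_add_atTop_nhds_zero_nat
  have hφ1 : ∀ n, (φ n).rOut ≤ 1 := fun n => by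
    change 1 / ((n : ℝ) + 1) ≤ 1
    rw [div_le_one (by positivity)]
    linarith [(Nat.cast_nonneg n : (0 : ℝ) ≤ n)]
  -- Comparability of inner and outer radii is what almost everywhere convergence of the mollified,
  -- merely locally integrable derivative requires.
  have hφK : ∀ n, (φ n).rOut ≤ 2 * (φ n).rIn := fun n => by
    change 1 / ((n : ℝ) + 1) ≤ 2 * (1 / (2 * ((n : ℝ) + 1)))
    apply le_of_eq; field_simp
  let a : ℕ → E → ℝ := fun n => (φ n).normed volume ⋆[ContinuousLinearMap.lsmul ℝ ℝ, volume] A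
  have hint : ∀ n, Integrable ((φ n).normed (volume : Measure E)) := fun n =>
    (φ n).integrable_normed
  have hsm : ∀ n, ContDiff ℝ 2 (a n) := fun n =>
    HasCompactSupport.contDiff_convolution_left _ (φ n).hasCompactSupport_normed
      ((φ n).contDiff_normed.of_le (by exact_mod_cast le_top)) hA.continuous.locallyIntegrable
  -- The derivative is moved onto A rather than onto the bump, so that gradient bounds and almost
  -- everywhere limits follow from those of the line derivative of A.
  have hder : ∀ n t v, fderiv ℝ (a n) t v
      = ∫ u, lineDeriv ℝ A (t - u) v * (φ n).normed volume u := by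
    intro n t v
    have h1 := ((hsm n).differentiable two_ne_zero t).hasFDerivAt.hasLineDerivAt v
    have h2 := h1.tendsto_slope_zero_right
    have hrefl : LipschitzWith C fun u => A (t - u) := by
      have h4 : LipschitzWith 1 fun u : E => t - u :=
        LipschitzWith.of_dist_le_mul fun u w => by
          rw [dist_sub_left, NNReal.coe_one, one_mul]
      simpa using! hA.comp h4
    have h3 := hrefl.integral_inv_smul_sub_mul_tendsto_integral_lineDeriv_mul (hint n) (-v)
    have h5 : ∀ u, lineDeriv ℝ (fun u => A (t - u)) u (-v) = lineDeriv ℝ A (t - u) v := fun u => by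
      simp only [lineDeriv]
      congr 1
      funext s
      congr 1
      rw [smul_neg]; abel
    simp only [h5] at h3
    refine tendsto_nhds_unique h2 (h3.congr fun s => ?_)
    have hi : ∀ x, Integrable fun u => (φ n).normed volume u • A (x - u) := fun x =>
      HasCompactSupport.convolutionExists_left (ContinuousLinearMap.lsmul ℝ ℝ)
        (φ n).hasCompactSupport_normed (φ n).continuous_normed
        hA.continuous.locallyIntegrable x
    change _ = s⁻¹ • ((∫ u, (φ n).normed volume u • A (t + s • v - u))
      - ∫ u, (φ n).normed volume u • A (t - u))
    rw [← integral_sub (hi _) (hi _), ← integral_smul]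
    refine integral_congr_ae (Eventually.of_forall fun u => ?_)
    have h6 : t - (u + s • -v) = t + s • v - u := by rw [smul_neg]; abel
    simp only [h6, smul_eq_mul]
    ring
  refine ⟨a, hsm, fun n t => ?_, fun t => ?_, fun n t v => ?_, fun v => ?_⟩
  · rw [← dist_eq_norm]
    refine (φ n).dist_normed_convolution_le hA.continuous.aestronglyMeasurable fun u hu => ?_
    refine (hA.dist_le_mul u t).trans ?_
    have h1 : dist u t ≤ 1 := (Metric.mem_ball.mp hu).le.trans (hφ1 n)
    have h2 : (0 : ℝ) ≤ C := C.2
    nlinarith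
  · exact ContDiffBump.convolution_tendsto_right_of_continuous hφ0 hA.continuous t
  · rw [hder]
    refine (norm_integral_le_integral_norm _).trans ?_
    calc ∫ u, ‖lineDeriv ℝ A (t - u) v * (φ n).normed volume u‖
        ≤ ∫ u, C * ‖v‖ * (φ n).normed volume u := by
          refine integral_mono_of_nonneg (Eventually.of_forall fun u => norm_nonneg _)
            ((hint n).const_mul _) (Eventually.of_forall fun u => ?_)
          change ‖_ * _‖ ≤ _
          rw [norm_mul, Real.norm_of_nonneg ((φ n).nonneg_normed u)]
          exact mul_le_mul_of_nonneg_right (norm_lineDeriv_le_of_lipschitz ℝ hA)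
            ((φ n).nonneg_normed u)
      _ = C * ‖v‖ := by
          rw [integral_const_mul, (φ n).integral_normed, mul_one]
  · have h := ContDiffBump.ae_convolution_tendsto_right_of_locallyIntegrable (φ := φ) (K := 2) hφ0
      (Eventually.of_forall hφK) (hA.locallyIntegrable_lineDeriv (μ := volume) v)
    filter_upwards [h] with t ht
    refine ht.congr fun n => ?_
    rw [hder]
    refine integral_congr_ae (Eventually.of_forall fun u => ?_)
    simp [mul_comm]

/-- **Green's theorem** on the triangle, for Lipschitz functions. -/
theorem green_lipschitz {A B : (Fin 2 → ℝ) → ℝ} {C K : ℝ≥0} (hA : LipschitzWith C A)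
    (hB : LipschitzWith K B) :
    ∫ t in Delta 2, (lineDeriv ℝ A t (planeBasis 0) * lineDeriv ℝ B t (planeBasis 1)
        - lineDeriv ℝ A t (planeBasis 1) * lineDeriv ℝ B t (planeBasis 0))
      = ∑ i : Fin 3, (-1) ^ (i : ℕ) *
          ∫ s in (0 : ℝ)..1, A (edge i s) * deriv (fun s => B (edge i s)) s := by
  obtain ⟨a, hsm, hbd, hlim, hder, hae⟩ := exists_smooth_approx hA
  have hfin : IsFiniteMeasure ((volume : Measure (Fin 2 → ℝ)).restrict (Delta 2)) :=
    ⟨by rw [Measure.restrict_apply_univ]; exact (isCompact_Delta 2).measure_lt_top⟩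
  have hBn : ∀ t v, ‖lineDeriv ℝ B t v‖ ≤ K * ‖v‖ := fun t v => norm_lineDeriv_le_of_lipschitz ℝ hB
  have h1 : Tendsto (fun n => ∫ t in Delta 2,
      (fderiv ℝ (a n) t (planeBasis 0) * lineDeriv ℝ B t (planeBasis 1)
        - fderiv ℝ (a n) t (planeBasis 1) * lineDeriv ℝ B t (planeBasis 0))) atTop
      (𝓝 (∫ t in Delta 2, (lineDeriv ℝ A t (planeBasis 0) * lineDeriv ℝ B t (planeBasis 1)
        - lineDeriv ℝ A t (planeBasis 1) * lineDeriv ℝ B t (planeBasis 0)))) := by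
    refine tendsto_integral_of_dominated_convergence
      (fun _ => C * ‖planeBasis 0‖ * (K * ‖planeBasis 1‖) + C * ‖planeBasis 1‖ * (K * ‖planeBasis 0‖))
      (fun n => ?_) (integrable_const _) (fun n => Eventually.of_forall fun t => ?_) ?_
    · have hc : ∀ v, Continuous fun t => fderiv ℝ (a n) t v := fun v =>
        continuous_fderiv_apply_of_contDiff ((hsm n).of_le (by norm_num)) v
      exact ((integrableOn_mul_lineDeriv (hc _) hB _).sub
        (integrableOn_mul_lineDeriv (hc _) hB _)).aestronglyMeasurable
    · refine (norm_sub_le _ _).trans ?_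
      rw [norm_mul, norm_mul]
      gcongr
      all_goals first | exact hder _ _ _ | exact hBn _ _
    · refine ae_restrict_of_ae ?_
      filter_upwards [hae (planeBasis 0), hae (planeBasis 1)] with t h0 h1
      exact (h0.mul_const _).sub (h1.mul_const _)
  -- The edges are null sets, on which almost everywhere convergence of gradients says nothing. Only
  -- the values of the approximants enter here, and these converge at every point.
  have h2 : Tendsto (fun n => ∑ i : Fin 3, (-1 : ℝ) ^ (i : ℕ) *
          ∫ s in (0 : ℝ)..1, a n (edge i s) * deriv (fun s => B (edge i s)) s) atTop
      (𝓝 (∑ i : Fin 3, (-1) ^ (i : ℕ) *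
          ∫ s in (0 : ℝ)..1, A (edge i s) * deriv (fun s => B (edge i s)) s)) := by
    refine tendsto_finsetSum _ fun i _ => Tendsto.const_mul _ ?_
    have he : Continuous (edge i) := by
      have : edge i = fun s => edge i 0 + s • (edge i 1 - edge i 0) :=
        funext fun s => edge_eq_add_smul i s
      rw [this]; fun_prop
    have hd : ∀ s, ‖deriv (fun s => B (edge i s)) s‖ ≤ K * ‖edge i 1 - edge i 0‖ := fun s => by
      have h3 := hBn (edge i s) (edge i 1 - edge i 0)
      rw [edge_eq_add_smul i s, lineDeriv_along] at h3
      simpa only [← edge_eq_add_smul] using h3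
    have hmeas : Measurable (deriv fun s => B (edge i s)) := measurable_deriv _
    have hAe : Continuous fun s => A (edge i s) := hA.continuous.comp he
    refine intervalIntegral.tendsto_integral_filter_of_dominated_convergence
      (fun s => (‖A (edge i s)‖ + C) * (K * ‖edge i 1 - edge i 0‖)) ?_ ?_ ?_ ?_
    · refine Eventually.of_forall fun n => ?_
      exact (((hsm n).continuous.comp he).measurable.mul hmeas).aestronglyMeasurable
    · refine Eventually.of_forall fun n => Eventually.of_forall fun s _ => ?_
      rw [norm_mul]
      gcongr
      · have h3 := hbd n (edge i s)
        have h4 := norm_add_le (A (edge i s)) (a n (edge i s) - A (edge i s))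
        rw [add_sub_cancel] at h4
        linarith
      · exact hd s
    · exact ((hAe.norm.add continuous_const).mul continuous_const).intervalIntegrable _ _
    · exact Eventually.of_forall fun s _ => (hlim _).mul_const _
  refine tendsto_nhds_unique h1 (h2.congr fun n => ?_)
  exact (green_smooth (hsm n) hB).symm

end GreenLipschitz

/-! ### Stokes' theorem for smeared surfaces -/

section Divergence

open Filter Topology
open scoped NNReal

/-- A simplex is differentiable at almost every point of the standard simplex. -/
theorem ae_differentiableAt_extendZero {n : ℕ} (χ : SingSimplex n) :
    ∀ᵐ t ∂(volume.restrict (Delta n)), t ∈ interior (Delta n) ∧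
      DifferentiableAt ℝ (extendZero χ.toFun) t := by
  obtain ⟨⟨K, hK⟩, -⟩ := χ.piecewiseSmooth
  have h0 := (convex_Delta n).addHaar_frontier (volume : Measure (Fin n → ℝ))
  rw [ae_restrict_iff' (isCompact_Delta n).measurableSet]
  filter_upwards [measure_eq_zero_iff_ae_notMem.mp h0,
    hK.ae_differentiableWithinAt_of_mem (μ := volume)] with t ht hd htD
  have hi : t ∈ interior (Delta n) := by
    by_contra hni
    exact ht ⟨subset_closure htD, hni⟩
  exact ⟨hi, (hd htD).differentiableAt (mem_interior_iff_mem_nhds.mp hi)⟩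

theorem continuousOn_extendZero {n : ℕ} (χ : SingSimplex n) :
    ContinuousOn (extendZero χ.toFun) (Delta n) := by
  obtain ⟨⟨K, hK⟩, -⟩ := χ.piecewiseSmooth
  exact hK.continuousOn

instance {n : ℕ} : IsFiniteMeasure ((volume : Measure (Fin n → ℝ)).restrict (Delta n)) :=
  ⟨by rw [Measure.restrict_apply_univ]; exact (isCompact_Delta n).measure_lt_top⟩

theorem integrable_jacobian {n : ℕ} (χ : SingSimplex n) (α : Fin n → Fin 4) :
    Integrable (χ.jacobian α) (volume.restrict (Delta n)) := by
  obtain ⟨C, hC⟩ := jacobian_bounded χ α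
  exact Integrable.of_bound (aestronglyMeasurable_jacobian χ α _) C hC

theorem Test.norm_le (f : Test) : ∃ C : ℝ, ∀ x, ‖f x‖ ≤ C := by
  obtain ⟨C, hC⟩ := f.decay' 0 0
  refine ⟨C, fun x => ?_⟩
  have h := hC x
  rw [pow_zero, one_mul, norm_iteratedFDeriv_zero] at h
  exact h

theorem integrable_superposition {T : Type*} [MeasurableSpace T] {ν : Measure T}
    {c : T → Mink} {J : T → ℝ} (hc : AEStronglyMeasurable c ν) (hJ : Integrable J ν) (f : Test)
    (x : Mink) : Integrable (fun t => f (x - c t) * J t) ν := by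
  obtain ⟨C, hC⟩ := Test.norm_le f
  exact hJ.bdd_mul (c := C) (f.continuous.comp_aestronglyMeasurable
    (aestronglyMeasurable_const.sub hc)) (Eventually.of_forall fun t => hC _)

/-- Superpositions of translates of a test function may be differentiated under the integral. -/
theorem hasLineDerivAt_superposition {T : Type*} [MeasurableSpace T] {ν : Measure T}
    {c : T → Mink} {J : T → ℝ} (hc : AEStronglyMeasurable c ν) (hJ : Integrable J ν) (f : Test)
    (x v : Mink) :
    HasLineDerivAt ℝ (fun x => ∫ t, f (x - c t) * J t ∂ν) (∫ t, (∂_{v} f) (x - c t) * J t ∂ν) x v := by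
  obtain ⟨C, hC⟩ := Test.norm_le (∂_{v} f)
  have h := hasDerivAt_integral_of_dominated_loc_of_deriv_le (μ := ν) (s := univ) (x₀ := (0 : ℝ))
    (F := fun (s : ℝ) t => f (x + s • v - c t) * J t)
    (F' := fun (s : ℝ) t => (∂_{v} f) (x + s • v - c t) * J t)
    (bound := fun t => C * ‖J t‖) univ_mem
    (Eventually.of_forall fun s => (integrable_superposition hc hJ f _).aestronglyMeasurable)
    (integrable_superposition hc hJ f _)
    (integrable_superposition hc hJ _ _).aestronglyMeasurable
    (Eventually.of_forall fun t s _ => by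
      rw [norm_mul]; exact mul_le_mul_of_nonneg_right (hC _) (norm_nonneg _))
    (hJ.norm.const_mul C)
    (Eventually.of_forall fun t s _ => by
      refine HasDerivAt.mul_const ?_ _
      have h1 : HasDerivAt (fun s : ℝ => x + s • v - c t) v s := by
        simpa using (((hasDerivAt_id s).smul_const v).const_add x).sub_const (c t)
      have h2 := (f.hasFDerivAt (x + s • v - c t)).comp_hasDerivAt s h1
      rw [SchwartzMap.lineDerivOp_apply_eq_fderiv]
      exact h2)
  have h2 := h.2
  simp only [zero_smul, add_zero] at h2
  exact h2

theorem lineDerivOp_smear {n : ℕ} (χ : SingSimplex n) (f : Test) (α : Fin n → Fin 4) (v : Mink) :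
    ∂_{v} (smear χ f α) = smear χ (∂_{v} f) α := by
  ext x
  rw [SchwartzMap.lineDerivOp_apply]
  exact (hasLineDerivAt_superposition ((continuousOn_extendZero χ).aestronglyMeasurable
    (isCompact_Delta n).measurableSet) (integrable_jacobian χ α) f x v).lineDeriv

theorem jacobian_one (γ : SingSimplex 1) (ν : Fin 4) (t : Fin 1 → ℝ) :
    γ.jacobian (fun _ => ν) t = fderiv ℝ (extendZero γ.toFun) t (Pi.single 0 1) ν := by
  simp [SingSimplex.jacobian]

theorem jacobian_two (σ : SingSimplex 2) (μ ν : Fin 4) (t : Fin 2 → ℝ) :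
    σ.jacobian ![μ, ν] t
      = fderiv ℝ (extendZero σ.toFun) t (planeBasis 0) μ * fderiv ℝ (extendZero σ.toFun) t (planeBasis 1) ν
        - fderiv ℝ (extendZero σ.toFun) t (planeBasis 1) μ
          * fderiv ℝ (extendZero σ.toFun) t (planeBasis 0) ν := by
  simp [SingSimplex.jacobian, Matrix.det_fin_two]

theorem fderiv_apply_eq_sum (f : Test) (x w : Mink) :
    fderiv ℝ f x w = ∑ μ, (∂_{(Pi.single μ 1 : Mink)} f) x * w μ := by
  have h : w = ∑ μ, w μ • (Pi.single μ 1 : Mink) := by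
    ext ν; simp [Pi.single_apply]
  conv_lhs => rw [h]
  rw [map_sum]
  refine Finset.sum_congr rfl fun μ _ => ?_
  rw [map_smul, SchwartzMap.lineDerivOp_apply_eq_fderiv, smul_eq_mul, mul_comm]

/-- A line derivative at an interior point depends only on the germ, so the arbitrary Lipschitz
extension A beyond the simplex does not matter. -/
theorem lineDeriv_eq_of_eqOn {n : ℕ} {φ : (Fin n → ℝ) → Mink} {g : Mink → ℝ} {A : (Fin n → ℝ) → ℝ}
    (hA : EqOn A (fun t => g (φ t)) (Delta n)) {t : Fin n → ℝ} (ht : t ∈ interior (Delta n))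
    (hφ : DifferentiableAt ℝ φ t) (hg : DifferentiableAt ℝ g (φ t)) (v : Fin n → ℝ) :
    lineDeriv ℝ A t v = fderiv ℝ g (φ t) (fderiv ℝ φ t v) := by
  have h1 : A =ᶠ[𝓝 t] fun t => g (φ t) :=
    Filter.eventuallyEq_of_mem (mem_interior_iff_mem_nhds.mp ht) hA
  rw [h1.lineDeriv_eq]
  exact ((hg.hasFDerivAt.comp t hφ.hasFDerivAt).hasLineDerivAt v).lineDeriv

theorem setIntegral_Delta_one (G : ℝ → ℝ) :
    ∫ t in Delta 1, G (t 0) = ∫ s in (0 : ℝ)..1, G s := by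
  rw [intervalIntegral.integral_of_le zero_le_one, ← integral_Icc_eq_integral_Ioc]
  have h := (volume_preserving_funUnique (Fin 1) ℝ).setIntegral_preimage_emb
    (MeasurableEquiv.measurableEmbedding _) G (Icc 0 1)
  rw [← h]
  have : (MeasurableEquiv.funUnique (Fin 1) ℝ) ⁻¹' Icc 0 1 = Delta 1 := by
    ext t
    simp [Delta, MeasurableEquiv.funUnique]
  rw [this]
  rfl

theorem faceIncl_eq_edge (i : Fin 3) (t : Fin 1 → ℝ) : faceIncl i t = edge i (t 0) := by
  fin_cases i <;> ext j <;> fin_cases j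
  · simp [faceIncl, edge]
  · simp [faceIncl, edge]
  · rfl
  · rfl
  · rfl
  · rfl

theorem edge_mem_Delta (i : Fin 3) {s : ℝ} (hs : s ∈ Icc (0 : ℝ) 1) : edge i s ∈ Delta 2 := by
  fin_cases i
  · exact mem_Delta_two.mpr ⟨by linarith [hs.2], hs.1, by linarith⟩
  · exact mem_Delta_two.mpr ⟨le_rfl, hs.1, by linarith [hs.2]⟩
  · exact mem_Delta_two.mpr ⟨hs.1, le_rfl, by linarith [hs.2]⟩

theorem extendZero_face (σ : SingSimplex 2) (i : Fin 3) {t : Fin 1 → ℝ} (ht : t ∈ Delta 1) :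
    extendZero (σ.face i).toFun t = extendZero σ.toFun (edge i (t 0)) := by
  rw [extendZero_apply _ ht, ← faceIncl_eq_edge, extendZero_apply _ (faceIncl_mem i ht)]
  rfl

/-- Stated for arbitrary A and B agreeing with f(x - σ) and σ^ν on the triangle, so that the global
Lipschitz extensions required by Green's theorem can be inserted. Almost everywhere on the edge, the
Jacobian of the face is the derivative of B along it. -/
theorem smear_face (σ : SingSimplex 2) (f : Test) (i : Fin 3) (ν : Fin 4) {B : (Fin 2 → ℝ) → ℝ}
    (hB : EqOn B (fun t => extendZero σ.toFun t ν) (Delta 2)) {A : (Fin 2 → ℝ) → ℝ} {x : Mink}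
    (hA : EqOn A (fun t => f (x - extendZero σ.toFun t)) (Delta 2)) :
    smear (σ.face i) f (fun _ => ν) x
      = ∫ s in (0 : ℝ)..1, A (edge i s) * deriv (fun s => B (edge i s)) s := by
  rw [← setIntegral_Delta_one]
  change ∫ t in Delta 1, _ = _
  refine integral_congr_ae ?_
  have hmem : ∀ {r : Fin 1 → ℝ}, r ∈ Delta 1 → r 0 ∈ Icc (0 : ℝ) 1 := fun {r} hr =>
    ⟨hr.1 0, by simpa using hr.2⟩
  filter_upwards [ae_differentiableAt_extendZero (σ.face i)] with t ht
  have htD := interior_subset ht.1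
  have hc : (fun r : Fin 1 → ℝ => B (edge i (r 0))) =ᶠ[𝓝 t]
      fun r => extendZero (σ.face i).toFun r ν := by
    filter_upwards [mem_interior_iff_mem_nhds.mp ht.1] with r hr
    rw [hB (edge_mem_Delta i (hmem hr)), extendZero_face σ i hr]
  have hd : HasDerivAt (fun s => B (edge i s))
      (fderiv ℝ (extendZero (σ.face i).toFun) t (Pi.single 0 1) ν) (t 0) := by
    have h1 : HasFDerivAt (fun r : Fin 1 → ℝ => B (edge i (r 0)))
        ((ContinuousLinearMap.proj (R := ℝ) ν).comp (fderiv ℝ (extendZero (σ.face i).toFun) t)) t :=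
      ((ContinuousLinearMap.proj (R := ℝ) (φ := fun _ : Fin 4 => ℝ) ν).hasFDerivAt.comp t
        ht.2.hasFDerivAt).congr_of_eventuallyEq hc
    have h2 : HasDerivAt (fun s : ℝ => (Pi.single 0 s : Fin 1 → ℝ)) (Pi.single 0 1) (t 0) :=
      hasDerivAt_single 0 (t 0)
    have h3 : (Pi.single 0 (t 0) : Fin 1 → ℝ) = t := by
      ext k; fin_cases k; simp
    rw [← h3] at h1
    have h4 := h1.comp_hasDerivAt (t 0) h2
    rw [h3] at h4
    refine h4.congr_of_eventuallyEq (Eventually.of_forall fun s => ?_)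
    simp
  change f (x - extendZero (σ.face i).toFun t) * (σ.face i).jacobian (fun _ => ν) t = _
  rw [jacobian_one, hd.deriv, hA (edge_mem_Delta i (hmem htD)), extendZero_face σ i htD]

theorem chainForm_boundary (σ : SingSimplex 2) (f : Test) (α : Fin 1 → Fin 4) :
    chainForm σ.boundary f α = ∑ i : Fin 3, ((-1 : ℤ) ^ (i : ℕ)) • smear (σ.face i) f α := by
  have h : ∀ c : Chain 1, chainForm c f α
      = Finsupp.linearCombination ℤ (fun χ => smear χ f α) c := fun c => rfl
  rw [h, SingSimplex.boundary, map_sum]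
  simp only [Finsupp.linearCombination_single]

/-- **Stokes' theorem** for smeared surfaces: the divergence of the form `σ[f]` is, up to the sign, the
form of the boundary. -/
theorem divergence_smear (σ : SingSimplex 2) (f : Test) (ν : Fin 4) (x : Mink) :
    ∑ μ, (∂_{(Pi.single μ 1 : Mink)} (smear σ f ![μ, ν])) x
      = -chainForm σ.boundary f (fun _ => ν) x := by
  obtain ⟨⟨K, hK⟩, -⟩ := σ.piecewiseSmooth
  -- Green's theorem is available for functions that are Lipschitz on the whole plane, while σ is
  -- Lipschitz only on the triangle. Real-valued Lipschitz functions extend with the same constant.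
  have hBL : LipschitzOnWith K (fun t => extendZero σ.toFun t ν) (Delta 2) := by
    have h := (LipschitzWith.eval (α := fun _ : Fin 4 => ℝ) ν).comp_lipschitzOnWith hK
    rwa [one_mul] at h
  obtain ⟨B, hB, hBe⟩ := hBL.extend_real
  have hAL : ∃ C, LipschitzOnWith C (fun t => f (x - extendZero σ.toFun t)) (Delta 2) := by
    obtain ⟨C, hC⟩ := f.decay' 0 1
    have hf : LipschitzWith (Real.toNNReal C) f := by
      refine lipschitzWith_of_nnnorm_fderiv_le f.differentiable fun y => ?_
      have h := hC y
      rw [pow_zero, one_mul, norm_iteratedFDeriv_one] at h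
      exact NNReal.le_toNNReal_of_coe_le h
    refine ⟨Real.toNNReal C * K, LipschitzOnWith.of_dist_le_mul fun t ht u hu => ?_⟩
    refine (hf.dist_le_mul _ _).trans ?_
    rw [dist_sub_left, NNReal.coe_mul, mul_assoc]
    exact mul_le_mul_of_nonneg_left (hK.dist_le_mul t ht u hu) (NNReal.coe_nonneg _)
  obtain ⟨C, hAL⟩ := hAL
  obtain ⟨A, hA, hAe⟩ := hAL.extend_real
  have hgreen := green_lipschitz hA hB
  have hrhs : chainForm σ.boundary f (fun _ => ν) x = ∑ i : Fin 3, (-1) ^ (i : ℕ) *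
      ∫ s in (0 : ℝ)..1, A (edge i s) * deriv (fun s => B (edge i s)) s := by
    rw [chainForm_boundary, _root_.sum_apply]
    refine Finset.sum_congr rfl fun i _ => ?_
    rw [_root_.smul_apply, smear_face σ f i ν hBe.symm hAe.symm, zsmul_eq_mul]
    push_cast
    rfl
  rw [hrhs, ← hgreen]
  simp only [lineDerivOp_smear]
  change ∑ μ, (∫ t in Delta 2, _) = _
  have hmeas := (continuousOn_extendZero σ).aestronglyMeasurable (μ := volume)
    (isCompact_Delta 2).measurableSet
  rw [← integral_finsetSum _ fun μ _ =>
    integrable_superposition hmeas (integrable_jacobian σ ![μ, ν]) _ x, ← integral_neg]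
  refine integral_congr_ae ?_
  filter_upwards [ae_differentiableAt_extendZero σ] with t ht
  have e1 : ∀ v, lineDeriv ℝ B t v = fderiv ℝ (extendZero σ.toFun) t v ν := fun v => by
    have h := lineDeriv_eq_of_eqOn (g := fun y => y ν) hBe.symm ht.1 ht.2 (by fun_prop) v
    rw [h]
    have h2 : HasFDerivAt (fun y : Mink => y ν)
      (ContinuousLinearMap.proj (R := ℝ) (φ := fun _ : Fin 4 => ℝ) ν) (extendZero σ.toFun t) :=
      (ContinuousLinearMap.proj (R := ℝ) (φ := fun _ : Fin 4 => ℝ) ν).hasFDerivAt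
    rw [h2.fderiv]
    rfl
  -- Differentiating f(x - σ(t)) in t brings a minus sign relative to ∂_μ f. This is the sign in the
  -- theorem.
  have e2 : ∀ v, lineDeriv ℝ A t v = -∑ μ, (∂_{(Pi.single μ 1 : Mink)} f) (x - extendZero σ.toFun t)
      * fderiv ℝ (extendZero σ.toFun) t v μ := fun v => by
    have h3 : HasFDerivAt (fun y => f (x - y))
        ((fderiv ℝ f (x - extendZero σ.toFun t)).comp (-ContinuousLinearMap.id ℝ Mink))
        (extendZero σ.toFun t) :=
      (f.hasFDerivAt _).comp _ ((hasFDerivAt_id _).const_sub x)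
    have h := lineDeriv_eq_of_eqOn (g := fun y => f (x - y)) hAe.symm ht.1 ht.2
      h3.differentiableAt v
    rw [h, h3.fderiv, ← fderiv_apply_eq_sum]
    simp
  simp only [jacobian_two, e1, e2, Finset.sum_mul, neg_mul, mul_sub, Finset.sum_sub_distrib]
  simp only [← mul_assoc]
  ring

end Divergence

/-! ### Ray integrals of translated test functions, and two homotopy formulas -/

section Superposition

open Filter Topology

/-- Superpositions `∫ J(t) f(x - c(t)) dν(t)` of translates of a Schwartz function are Schwartz
functions if all moments of the weight are finite. -/
theorem exists_superposition {T : Type*} [MeasurableSpace T] {ν : Measure T} {c : T → Mink}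
    {J : T → ℝ} (hc : AEStronglyMeasurable c ν) (hJ : Integrable J ν)
    (hM : ∀ k : ℕ, Integrable (fun t => ‖c t‖ ^ k * ‖J t‖) ν) (f : Test) :
    ∃ g : Test, ∀ x, g x = ∫ t, f (x - c t) * J t ∂ν := by
  have hmeas : ∀ (n : ℕ) (x : Mink),
      AEStronglyMeasurable (fun t => J t • iteratedFDeriv ℝ n f (x - c t)) ν := by
    intro n x
    have h1 : Continuous (iteratedFDeriv ℝ n f) :=
      f.smooth'.continuous_iteratedFDeriv (by exact_mod_cast le_top)
    exact hJ.aestronglyMeasurable.smul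
      (h1.comp_aestronglyMeasurable (aestronglyMeasurable_const.sub hc))
  have hbd : ∀ n : ℕ, ∃ B : ℝ, ∀ (x : Mink) (t : T),
      ‖J t • iteratedFDeriv ℝ n f (x - c t)‖ ≤ ‖J t‖ * B := by
    intro n
    obtain ⟨B, hB⟩ := f.decay' 0 n
    refine ⟨B, fun x t => ?_⟩
    have h2 := hB (x - c t)
    rw [pow_zero, one_mul] at h2
    rw [norm_smul]
    exact mul_le_mul_of_nonneg_left h2 (norm_nonneg _)
  have hint : ∀ (n : ℕ) (x : Mink),
      Integrable (fun t => J t • iteratedFDeriv ℝ n f (x - c t)) ν := by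
    intro n x
    obtain ⟨B, hB⟩ := hbd n
    exact (hJ.norm.mul_const B).mono' (hmeas n x) (Eventually.of_forall (hB x))
  have hderiv : ∀ (n : ℕ) (x : Mink),
      HasFDerivAt (fun x => ∫ t, J t • iteratedFDeriv ℝ n f (x - c t) ∂ν)
        (∫ t, J t • iteratedFDeriv ℝ (n + 1) f (x - c t) ∂ν).curryLeft x := by
    intro n x
    obtain ⟨B, hB⟩ := hbd (n + 1)
    have hcurry : (∫ t, J t • iteratedFDeriv ℝ (n + 1) f (x - c t) ∂ν).curryLeft
        = ∫ t, (J t • iteratedFDeriv ℝ (n + 1) f (x - c t)).curryLeft ∂ν := by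
      let e : (Mink [×(n + 1)]→L[ℝ] ℝ) →L[ℝ] (Mink →L[ℝ] (Mink [×n]→L[ℝ] ℝ)) :=
        (continuousMultilinearCurryLeftEquiv ℝ (fun _ : Fin (n + 1) => Mink)
          ℝ).toContinuousLinearEquiv.toContinuousLinearMap
      exact (ContinuousLinearMap.integral_comp_comm (𝕜 := ℝ)
        (Fₗ := Mink →L[ℝ] (Mink [×n]→L[ℝ] ℝ)) e (hint (n + 1) x)).symm
    rw [hcurry]
    refine hasFDerivAt_integral_of_dominated_of_fderiv_le (s := univ)
      (F' := fun y t => (J t • iteratedFDeriv ℝ (n + 1) f (y - c t)).curryLeft)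
      (bound := fun t => ‖J t‖ * B) Filter.univ_mem
      (Filter.Eventually.of_forall fun y => hmeas n y) (hint n x) ?_ ?_ (hJ.norm.mul_const B) ?_
    · exact (continuousMultilinearCurryLeftEquiv ℝ (fun _ : Fin (n + 1) => Mink)
        ℝ).continuous.comp_aestronglyMeasurable (hmeas (n + 1) x)
    · refine Eventually.of_forall fun t y _ => ?_
      rw [ContinuousMultilinearMap.curryLeft_norm]
      exact hB y t
    · refine Filter.Eventually.of_forall fun t y _ => ?_
      have h3 : HasFDerivAt (iteratedFDeriv ℝ n f)
          (iteratedFDeriv ℝ (n + 1) f (y - c t)).curryLeft (y - c t) := by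
        have h4 : DifferentiableAt ℝ (iteratedFDeriv ℝ n f) (y - c t) :=
          (f.smooth'.differentiable_iteratedFDeriv
            (by exact_mod_cast ENat.natCast_lt_top n)).differentiableAt
        have h5 := h4.hasFDerivAt
        rw [fderiv_iteratedFDeriv] at h5
        exact h5
      have h6 : HasFDerivAt (fun y : Mink => y - c t) (ContinuousLinearMap.id ℝ Mink) y :=
        (hasFDerivAt_id y).sub_const (c t)
      exact (h3.comp y h6).const_smul (J t)
  have hzero : ∀ x, ∫ t, f (x - c t) * J t ∂ν
      = (∫ t, J t • iteratedFDeriv ℝ 0 f (x - c t) ∂ν).curry0 := by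
    intro x
    have := (continuousMultilinearCurryFin0 ℝ Mink
      ℝ).toContinuousLinearEquiv.toContinuousLinearMap.integral_comp_comm (hint 0 x)
    refine Eq.trans ?_ this
    refine integral_congr_ae (Filter.Eventually.of_forall fun t => ?_)
    simp [mul_comm]
  have htaylor : HasFTaylorSeriesUpTo ∞ (fun x => ∫ t, f (x - c t) * J t ∂ν)
      (fun x n => ∫ t, J t • iteratedFDeriv ℝ n f (x - c t) ∂ν) :=
    { zero_eq := fun x => (hzero x).symm
      fderiv := fun m _ x => hderiv m x
      cont := fun m _ => continuous_iff_continuousAt.mpr fun x => (hderiv m x).continuousAt }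
  refine ⟨⟨fun x => ∫ t, f (x - c t) * J t ∂ν, htaylor.contDiff, fun k n => ?_⟩, fun x => rfl⟩
  set S : ℝ := 2 ^ k * (Finset.Iic (k, n)).sup (fun m => SchwartzMap.seminorm ℝ m.1 m.2) f with hS
  have hbound : Integrable (fun t => (2 : ℝ) ^ k * (‖J t‖ + ‖c t‖ ^ k * ‖J t‖) * S) ν :=
    ((hJ.norm.add (hM k)).const_mul _).mul_const _
  refine ⟨∫ t, (2 : ℝ) ^ k * (‖J t‖ + ‖c t‖ ^ k * ‖J t‖) * S ∂ν, fun x => ?_⟩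
  rw [← htaylor.eq_iteratedFDeriv (by exact_mod_cast le_top)]
  have hpt : ∀ t, ‖(‖x‖ ^ k) • (J t • iteratedFDeriv ℝ n f (x - c t))‖
      ≤ (2 : ℝ) ^ k * (‖J t‖ + ‖c t‖ ^ k * ‖J t‖) * S := by
    intro t
    have h3 := SchwartzMap.one_add_le_sup_seminorm_apply (𝕜 := ℝ) (m := (k, n)) (k := k) (n := n)
      le_rfl le_rfl f (x - c t)
    have h4 : ‖x‖ ≤ (1 + ‖c t‖) * (1 + ‖x - c t‖) := by
      have h5 : ‖x‖ ≤ ‖x - c t‖ + ‖c t‖ := by simpa using norm_add_le (x - c t) (c t)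
      nlinarith [norm_nonneg (x - c t), norm_nonneg (c t)]
    -- Decay of order k at x is traded for decay of f at x - c(t) and a factor (1 + ‖c(t)‖)^k. This
    -- elementary bound reduces the factor to the k-th moment of the weight.
    have h5 : (1 + ‖c t‖) ^ k ≤ 2 ^ k * (1 + ‖c t‖ ^ k) := by
      have h6 : 1 + ‖c t‖ ≤ 2 * max 1 ‖c t‖ := by
        linarith [le_max_left 1 ‖c t‖, le_max_right 1 ‖c t‖]
      calc (1 + ‖c t‖) ^ k ≤ (2 * max 1 ‖c t‖) ^ k := by gcongr
        _ = 2 ^ k * (max 1 ‖c t‖) ^ k := mul_pow _ _ _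
        _ ≤ 2 ^ k * (1 + ‖c t‖ ^ k) := by
          gcongr
          rcases max_choice 1 ‖c t‖ with h | h <;> rw [h]
          · rw [one_pow]; linarith [pow_nonneg (norm_nonneg (c t)) k]
          · linarith
    rw [norm_smul, norm_smul, norm_pow, norm_norm]
    calc ‖x‖ ^ k * (‖J t‖ * ‖iteratedFDeriv ℝ n f (x - c t)‖)
        ≤ ((1 + ‖c t‖) * (1 + ‖x - c t‖)) ^ k * (‖J t‖ * ‖iteratedFDeriv ℝ n f (x - c t)‖) := by
          gcongr
      _ = (1 + ‖c t‖) ^ k * ‖J t‖ * ((1 + ‖x - c t‖) ^ k * ‖iteratedFDeriv ℝ n f (x - c t)‖) := by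
          rw [mul_pow]; ring
      _ ≤ (2 ^ k * (1 + ‖c t‖ ^ k)) * ‖J t‖ * S := by gcongr
      _ = _ := by ring
  calc ‖x‖ ^ k * ‖∫ t, J t • iteratedFDeriv ℝ n f (x - c t) ∂ν‖
      = ‖∫ t, (‖x‖ ^ k) • (J t • iteratedFDeriv ℝ n f (x - c t)) ∂ν‖ := by
        rw [integral_smul, norm_smul, norm_pow, norm_norm]
    _ ≤ _ := norm_integral_le_of_norm_le hbound (Eventually.of_forall hpt)

/-- The measure `ds dz` on `[0,1] × ℝ⁴`. -/
def rayMeasure : Measure (ℝ × Mink) := (volume.restrict (Icc (0 : ℝ) 1)).prod volume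

theorem ae_rayMeasure : ∀ᵐ p ∂rayMeasure, p.1 ∈ Icc (0 : ℝ) 1 := by
  have h : ∀ᵐ s ∂(volume.restrict (Icc (0 : ℝ) 1)), s ∈ Icc (0 : ℝ) 1 :=
    ae_restrict_mem measurableSet_Icc
  exact Measure.quasiMeasurePreserving_fst.ae h

theorem integrable_rayMeasure_of_le {G : ℝ × Mink → ℝ} (hG : Continuous G) {g : Mink → ℝ}
    (hg : Integrable g) (h : ∀ s ∈ Icc (0 : ℝ) 1, ∀ z, ‖G (s, z)‖ ≤ g z) :
    Integrable G rayMeasure := by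
  refine (hg.comp_snd (volume.restrict (Icc (0 : ℝ) 1))).mono' hG.aestronglyMeasurable ?_
  filter_upwards [ae_rayMeasure] with p hp
  exact h p.1 hp p.2

theorem integrable_rayWeight (j : ℕ) (ψ : Test) :
    Integrable (fun p : ℝ × Mink => p.1 ^ j * ψ p.2) rayMeasure := by
  refine integrable_rayMeasure_of_le (by fun_prop) ψ.integrable.norm fun s hs z => ?_
  rw [norm_mul, norm_pow, Real.norm_of_nonneg hs.1]
  exact mul_le_of_le_one_left (norm_nonneg _) (pow_le_one₀ hs.1 hs.2)

theorem integrable_rayWeight_moment (j : ℕ) (ψ : Test) (k : ℕ) :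
    Integrable (fun p : ℝ × Mink => ‖p.1 • p.2‖ ^ k * ‖p.1 ^ j * ψ p.2‖) rayMeasure := by
  refine integrable_rayMeasure_of_le (by fun_prop) (ψ.integrable_pow_mul volume k) fun s hs z => ?_
  rw [norm_mul, norm_norm, norm_mul, norm_pow, norm_norm, norm_pow, norm_smul,
    Real.norm_of_nonneg hs.1]
  have h1 : s ^ j ≤ 1 := pow_le_one₀ hs.1 hs.2
  have h2 : s * ‖z‖ ≤ ‖z‖ := mul_le_of_le_one_left (norm_nonneg _) hs.2
  have h3 : 0 ≤ s * ‖z‖ := mul_nonneg hs.1 (norm_nonneg _)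
  exact mul_le_mul (pow_le_pow_left₀ h3 h2 k) (mul_le_of_le_one_left (norm_nonneg _) h1)
    (by have := pow_nonneg hs.1 j; positivity) (by positivity)

theorem aestronglyMeasurable_ray :
    AEStronglyMeasurable (fun p : ℝ × Mink => p.1 • p.2) rayMeasure := by
  have : Continuous fun p : ℝ × Mink => p.1 • p.2 := by fun_prop
  exact this.aestronglyMeasurable

theorem exists_rayConv (j : ℕ) (ψ f : Test) :
    ∃ g : Test, ∀ x, g x = ∫ p, f (x - p.1 • p.2) * (p.1 ^ j * ψ p.2) ∂rayMeasure :=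
  exists_superposition aestronglyMeasurable_ray (integrable_rayWeight j ψ)
    (integrable_rayWeight_moment j ψ) f

/-- The underlying function of `rayConv`. -/
def rayConvFun (j : ℕ) (ψ f : Test) : Test := (exists_rayConv j ψ f).choose

theorem rayConvFun_apply (j : ℕ) (ψ f : Test) (x : Mink) :
    rayConvFun j ψ f x = ∫ p, f (x - p.1 • p.2) * (p.1 ^ j * ψ p.2) ∂rayMeasure :=
  (exists_rayConv j ψ f).choose_spec x

/-- The bilinear operation `(ψ, f) ↦ ∫₀¹ ds sʲ ∫ dz ψ(z) f(x - s z)` on test functions. -/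
def rayConv (j : ℕ) : Test →ₗ[ℝ] Test →ₗ[ℝ] Test :=
  have hI := fun ψ f x => integrable_superposition aestronglyMeasurable_ray
        (integrable_rayWeight j ψ) f x
  LinearMap.mk₂ ℝ (rayConvFun j)
    (fun ψ₁ ψ₂ f => by
      ext x
      simp only [_root_.add_apply, rayConvFun_apply]
      rw [← integral_add (hI ψ₁ f x) (hI ψ₂ f x)]
      exact integral_congr_ae (Eventually.of_forall fun p => by simp only; ring))
    (fun a ψ f => by
      ext x
      simp only [_root_.smul_apply, rayConvFun_apply, smul_eq_mul]
      rw [← integral_const_mul]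
      exact integral_congr_ae (Eventually.of_forall fun p => by simp only; ring))
    (fun ψ f₁ f₂ => by
      ext x
      simp only [_root_.add_apply, rayConvFun_apply]
      rw [← integral_add (hI ψ f₁ x) (hI ψ f₂ x)]
      exact integral_congr_ae (Eventually.of_forall fun p => by simp only; ring))
    (fun a ψ f => by
      ext x
      simp only [_root_.smul_apply, rayConvFun_apply, smul_eq_mul]
      rw [← integral_const_mul]
      exact integral_congr_ae (Eventually.of_forall fun p => by simp only; ring))

theorem rayConv_apply (j : ℕ) (ψ f : Test) (x : Mink) :
    rayConv j ψ f x = ∫ p, f (x - p.1 • p.2) * (p.1 ^ j * ψ p.2) ∂rayMeasure :=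
  rayConvFun_apply j ψ f x

/-- The second argument enters only through its translates, so derivatives pass onto it. -/
theorem lineDerivOp_rayConv (j : ℕ) (ψ f : Test) (v : Mink) :
    ∂_{v} (rayConv j ψ f) = rayConv j ψ (∂_{v} f) := by
  ext x
  rw [SchwartzMap.lineDerivOp_apply, rayConv_apply]
  have h := hasLineDerivAt_superposition aestronglyMeasurable_ray (integrable_rayWeight j ψ) f x v
  have e : (rayConv j ψ f : Mink → ℝ)
      = fun x => ∫ p, f (x - p.1 • p.2) * (p.1 ^ j * ψ p.2) ∂rayMeasure :=
    funext (rayConv_apply j ψ f)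
  rw [e]
  exact h.lineDeriv

/-- If the integrand vanishes for all s in [0, 1] and all z, so does the integral. This is the only
information about supports used later. -/
theorem exists_of_rayConv_ne_zero {j : ℕ} {ψ f : Test} {x : Mink} (h : rayConv j ψ f x ≠ 0) :
    ∃ s ∈ Icc (0 : ℝ) 1, ∃ z, ψ z ≠ 0 ∧ f (x - s • z) ≠ 0 := by
  by_contra hn
  push Not at hn
  apply h
  rw [rayConv_apply]
  refine (integral_congr_ae ?_).trans (integral_zero _ _)
  filter_upwards [ae_rayMeasure] with p hp
  by_cases hz : ψ p.2 = 0
  · simp [hz]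
  · simp [hn p.1 hp p.2 hz]

theorem rayConv_eq_integral_snd (j : ℕ) (ψ f : Test) (x : Mink) :
    rayConv j ψ f x = ∫ z, ∫ s in (0 : ℝ)..1, f (x - s • z) * (s ^ j * ψ z) := by
  rw [rayConv_apply]
  refine (integral_prod_symm _ (integrable_superposition aestronglyMeasurable_ray
    (integrable_rayWeight j ψ) f x)).trans ?_
  refine integral_congr_ae (Eventually.of_forall fun z => ?_)
  simp only
  rw [integral_Icc_eq_integral_Ioc, intervalIntegral.integral_of_le zero_le_one]

theorem rayConv_eq_integral_fst (j : ℕ) (ψ f : Test) (x : Mink) :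
    rayConv j ψ f x = ∫ s in Icc (0 : ℝ) 1, ∫ z, f (x - s • z) * (s ^ j * ψ z) := by
  rw [rayConv_apply]
  exact integral_prod _ (integrable_superposition aestronglyMeasurable_ray
    (integrable_rayWeight j ψ) f x)

/-- Multiplication of a test function by a coordinate. -/
def coordMul (ρ : Fin 4) : Test →ₗ[ℝ] Test :=
  (SchwartzMap.smulLeftCLM ℝ fun x : Mink => x ρ).toLinearMap

theorem coordMul_apply (ρ : Fin 4) (f : Test) (x : Mink) : coordMul ρ f x = x ρ * f x :=
  SchwartzMap.smulLeftCLM_apply_apply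
    (ContinuousLinearMap.proj (R := ℝ) (φ := fun _ : Fin 4 => ℝ) ρ).hasTemperateGrowth f x

/-- The partial derivative in a coordinate direction. -/
abbrev pd (ρ : Fin 4) (f : Test) : Test := ∂_{(Pi.single ρ 1 : Mink)} f

theorem hasDerivAt_ray (f : Test) (x z : Mink) (s : ℝ) :
    HasDerivAt (fun s : ℝ => f (x - s • z)) (-∑ ρ, z ρ * pd ρ f (x - s • z)) s := by
  have h1 : HasDerivAt (fun s : ℝ => x - s • z) (-z) s := by
    simpa using ((hasDerivAt_id s).smul_const z).const_sub x
  have h2 := (f.hasFDerivAt (x - s • z)).comp_hasDerivAt s h1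
  rw [map_neg, fderiv_apply_eq_sum] at h2
  simp only [mul_comm (z _)]
  exact h2

theorem pd_coordMul (ρ μ : Fin 4) (f : Test) :
    pd ρ (coordMul μ f) = (if μ = ρ then f else 0) + coordMul μ (pd ρ f) := by
  ext x
  have h1 := f.hasFDerivAt x
  have h2 : HasFDerivAt (fun y : Mink => y μ)
      (ContinuousLinearMap.proj (R := ℝ) (φ := fun _ : Fin 4 => ℝ) μ) x :=
    (ContinuousLinearMap.proj (R := ℝ) (φ := fun _ : Fin 4 => ℝ) μ).hasFDerivAt
  have h3 : (coordMul μ f : Mink → ℝ) = fun y => y μ * f y := funext (coordMul_apply μ f)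
  have h4 : HasFDerivAt (fun y => y μ * f y) _ x := h2.mul h1
  change _ = (if μ = ρ then f else 0 : Test) x + coordMul μ (pd ρ f) x
  rw [SchwartzMap.lineDerivOp_apply, h3, (h4.hasLineDerivAt _).lineDeriv, coordMul_apply,
    SchwartzMap.lineDerivOp_apply_eq_fderiv]
  by_cases h : μ = ρ
  · subst h; simp; ring
  · simp [h]

/-- Integration by parts in the variable `z`. -/
theorem rayConv_succ_pd (j : ℕ) (ψ f : Test) (ρ : Fin 4) :
    rayConv (j + 1) ψ (pd ρ f) = rayConv j (pd ρ ψ) f := by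
  ext x
  rw [rayConv_eq_integral_fst, rayConv_eq_integral_fst]
  refine integral_congr_ae (Eventually.of_forall fun s => ?_)
  simp only
  obtain ⟨C, hC⟩ := Test.norm_le f
  obtain ⟨C', hC'⟩ := Test.norm_le (pd ρ f)
  have hint : ∀ (g h : Test), Integrable fun z => g (x - s • z) * h z := fun g h => by
    obtain ⟨C, hC⟩ := Test.norm_le g
    exact h.integrable.bdd_mul (c := C) (by
      have : Continuous fun z => g (x - s • z) := by fun_prop
      exact this.aestronglyMeasurable) (Eventually.of_forall fun z => hC _)
  -- The chain rule in z produces the factor -s. It accounts for the power of s lost when the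
  -- derivative passes to ψ.
  have h := integral_bilinear_hasLineDerivAt_right_eq_neg_left_of_integrable (μ := volume)
    (f := fun z => f (x - s • z)) (f' := fun z => -(s * pd ρ f (x - s • z))) (g := ψ) (g' := pd ρ ψ)
    (v := Pi.single ρ 1) (B := ContinuousLinearMap.mul ℝ ℝ)
    (by
      have := ((hint (pd ρ f) ψ).const_mul s).neg
      refine this.congr (Eventually.of_forall fun z => ?_)
      simp only [Pi.neg_apply, ContinuousLinearMap.mul_apply']
      ring)
    (hint f (pd ρ ψ)) (hint f ψ)
    (fun z _ => by
      have h1 : HasFDerivAt (fun z : Mink => x - s • z) (-(s • ContinuousLinearMap.id ℝ Mink)) z :=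
        ((hasFDerivAt_id z).const_smul s).const_sub x
      have h2 := ((f.hasFDerivAt (x - s • z)).comp z h1).hasLineDerivAt (Pi.single ρ 1)
      rw [SchwartzMap.lineDerivOp_apply_eq_fderiv]
      simp only [ContinuousLinearMap.comp_apply, _root_.neg_apply, _root_.smul_apply,
        ContinuousLinearMap.id_apply, map_neg, map_smul, smul_eq_mul] at h2
      exact h2)
    (fun z _ => by
      have h2 := (ψ.hasFDerivAt z).hasLineDerivAt (Pi.single ρ 1)
      rwa [← SchwartzMap.lineDerivOp_apply_eq_fderiv] at h2)
  simp only [ContinuousLinearMap.mul_apply'] at h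
  calc ∫ z, pd ρ f (x - s • z) * (s ^ (j + 1) * ψ z)
      = s ^ j * -∫ z, -(s * pd ρ f (x - s • z)) * ψ z := by
        rw [← integral_neg, ← integral_const_mul]
        refine integral_congr_ae (Eventually.of_forall fun z => ?_)
        simp only
        ring
    _ = ∫ z, f (x - s • z) * (s ^ j * pd ρ ψ z) := by
        rw [← h, ← integral_const_mul]
        refine integral_congr_ae (Eventually.of_forall fun z => ?_)
        simp only
        ring

/-- Comparison of a test function with its convolution with `φ`. -/
theorem sub_convolution_eq (φ K : Test) (hφ : ∫ y, φ y = 1) (x : Mink) :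
    K x - ∫ y, φ y * K (x - y) = ∑ ρ, rayConv 0 (coordMul ρ φ) (pd ρ K) x := by
  obtain ⟨C, hC⟩ := Test.norm_le K
  have hint : Integrable fun y => φ y * K (x - y) :=
    φ.integrable.mul_bdd (c := C) (by
      have : Continuous fun z => K (x - z) := by fun_prop
      exact this.aestronglyMeasurable) (Eventually.of_forall fun z => hC _)
  have h1 : K x = ∫ y, φ y * K x := by rw [integral_mul_const, hφ, one_mul]
  have hI : ∀ ρ, Integrable fun z => ∫ s in (0 : ℝ)..1,
      pd ρ K (x - s • z) * (s ^ 0 * coordMul ρ φ z) := fun ρ => by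
    have := (integrable_superposition aestronglyMeasurable_ray
      (integrable_rayWeight 0 (coordMul ρ φ)) (pd ρ K) x).integral_prod_right
    refine this.congr (Eventually.of_forall fun z => ?_)
    simp only
    rw [integral_Icc_eq_integral_Ioc, intervalIntegral.integral_of_le zero_le_one]
  simp only [rayConv_eq_integral_snd]
  rw [← integral_finsetSum _ fun ρ _ => hI ρ]
  conv_lhs => rw [h1]
  rw [← integral_sub (φ.integrable.mul_const _) hint]
  refine integral_congr_ae (Eventually.of_forall fun y => ?_)
  simp only
  have hcont : Continuous fun s : ℝ => -∑ ρ, y ρ * pd ρ K (x - s • y) := by fun_prop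
  -- K(x - y) - K(x) is the integral of the derivative of K along the segment from x to x - y.
  -- Averaging with weight φ gives the ray integrals, and no scaling is involved, so the power of s
  -- is 0.
  have h2 := intervalIntegral.integral_eq_sub_of_hasDerivAt
    (fun s _ => hasDerivAt_ray K x y s) (hcont.intervalIntegrable 0 1)
  rw [zero_smul, sub_zero, one_smul] at h2
  rw [← intervalIntegral.integral_finsetSum fun ρ _ => by
    refine Continuous.intervalIntegrable ?_ _ _
    fun_prop]
  have h3 : φ y * K x - φ y * K (x - y) = -φ y * (K (x - y) - K x) := by ring
  rw [h3, ← h2, ← intervalIntegral.integral_const_mul]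
  refine intervalIntegral.integral_congr fun s _ => ?_
  simp only [coordMul_apply, pow_zero, one_mul]
  rw [neg_mul_neg, Finset.mul_sum]
  exact Finset.sum_congr rfl fun ρ _ => by ring

/-- The convolution of two test functions as a superposition of contracted convolutions. -/
theorem convolution_eq (φ K : Test) (x : Mink) :
    ∫ z, φ (x - z) * K z = 2 * rayConv 1 K φ x - ∑ ρ, rayConv 2 (coordMul ρ K) (pd ρ φ) x := by
  have hI : ∀ (j : ℕ) (ψ f : Test), Integrable fun z => ∫ s in (0 : ℝ)..1,
      f (x - s • z) * (s ^ j * ψ z) := fun j ψ f => by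
    have := (integrable_superposition aestronglyMeasurable_ray
      (integrable_rayWeight j ψ) f x).integral_prod_right
    refine this.congr (Eventually.of_forall fun z => ?_)
    simp only
    rw [integral_Icc_eq_integral_Ioc, intervalIntegral.integral_of_le zero_le_one]
  simp only [rayConv_eq_integral_snd]
  rw [← integral_finsetSum _ fun ρ _ => hI _ _ _, ← integral_const_mul,
    ← integral_sub ((hI _ _ _).const_mul _) (integrable_finsetSum _ fun ρ _ => hI _ _ _)]
  refine integral_congr_ae (Eventually.of_forall fun z => ?_)
  simp only
  -- The factor s² kills the endpoint s = 0 and is the power by which a bivector scales under z ↦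
  -- sz. The corresponding power for a vector is 1, as found in `divInverse`.
  have hd : ∀ s : ℝ, HasDerivAt (fun s : ℝ => s ^ 2 * (φ (x - s • z) * K z))
      (2 * (φ (x - s • z) * (s ^ 1 * K z))
        - ∑ ρ, pd ρ φ (x - s • z) * (s ^ 2 * coordMul ρ K z)) s := fun s => by
    have h1 := (hasDerivAt_pow 2 s).mul ((hasDerivAt_ray φ x z s).mul_const (K z))
    refine h1.congr_deriv ?_
    simp only [coordMul_apply, Finset.sum_mul, neg_mul, mul_neg, Finset.mul_sum]
    rw [sub_eq_add_neg]
    congr 1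
    · push_cast; ring
    · congr 1
      exact Finset.sum_congr rfl fun ρ _ => by ring
  have hcont : Continuous fun s : ℝ => 2 * (φ (x - s • z) * (s ^ 1 * K z))
        - ∑ ρ, pd ρ φ (x - s • z) * (s ^ 2 * coordMul ρ K z) := by fun_prop
  have h2 := intervalIntegral.integral_eq_sub_of_hasDerivAt (fun s _ => hd s)
    (hcont.intervalIntegrable 0 1)
  rw [← intervalIntegral.integral_finsetSum fun ρ _ => by
    refine Continuous.intervalIntegrable ?_ _ _
    fun_prop, ← intervalIntegral.integral_const_mul, ← intervalIntegral.integral_sub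
    (Continuous.intervalIntegrable (by fun_prop) _ _) (Continuous.intervalIntegrable (by fun_prop) _ _),
    h2]
  simp

theorem convolution_comm (φ K : Test) (x : Mink) :
    ∫ y, φ y * K (x - y) = ∫ z, φ (x - z) * K z := by
  rw [← integral_sub_left_eq_self (fun y => φ y * K (x - y)) volume x]
  simp

end Superposition

/-! ### Poincaré lemma with supports, and the first Maxwell equation -/

section Homotopy

theorem exists_test_integral_eq_one {ε : ℝ} (hε : 0 < ε) :
    ∃ φ : Test, ∫ y, φ y = 1 ∧ ∀ x, φ x ≠ 0 → ‖x‖ < ε := by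
  let b : ContDiffBump (0 : Mink) := ⟨ε / 2, ε, by positivity, by linarith⟩
  have hs : HasCompactSupport (b.normed volume) := b.hasCompactSupport_normed
  refine ⟨hs.toSchwartzMap b.contDiff_normed, b.integral_normed, fun x hx => ?_⟩
  have h1 : x ∈ Function.support (b.normed volume) := hx
  rw [b.support_normed_eq, mem_ball_zero_iff] at h1
  exact h1

theorem lineDerivOp_sub (v : Mink) (f g : Test) : ∂_{v} (f - g) = ∂_{v} f - ∂_{v} g := by
  rw [sub_eq_add_neg, sub_eq_add_neg, LineDeriv.lineDerivOp_add, LineDeriv.lineDerivOp_neg]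

/-- The divergence `∂_ρ K^{ρν}` of a 2-tensor. -/
def tensorDiv (K : Fin 4 → Fin 4 → Test) (ν : Fin 4) : Test := ∑ ρ, pd ρ (K ρ ν)

/-- The cyclic 3-tensor whose divergence is `K`, up to a tensor built from the divergence of `K`. -/
def potential (φ : Test) (K : Fin 4 → Fin 4 → Test) (ρ μ ν : Fin 4) : Test :=
  (rayConv 0 (coordMul ρ φ) (K μ ν) + rayConv 0 (coordMul μ φ) (K ν ρ)
    + rayConv 0 (coordMul ν φ) (K ρ μ))
  - (rayConv 2 (coordMul ρ (K μ ν)) φ + rayConv 2 (coordMul μ (K ν ρ)) φ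
    + rayConv 2 (coordMul ν (K ρ μ)) φ)

/-- A 2-tensor with divergence `D`, built from `D` by smoothened contractions. -/
def divInverse (φ : Test) (D : Fin 4 → Test) (μ ν : Fin 4) : Test :=
  rayConv 0 (coordMul μ φ) (D ν) - rayConv 0 (coordMul ν φ) (D μ)
    - rayConv 1 (coordMul μ (D ν)) φ + rayConv 1 (coordMul ν (D μ)) φ

theorem potential_cyclic (φ : Test) (K : Fin 4 → Fin 4 → Test) (ρ μ ν : Fin 4) :
    potential φ K μ ν ρ = potential φ K ρ μ ν := by
  unfold potential
  abel

/-- The homotopy formula, with the homotopy operator given by the wedge product with the ray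
direction. The divergence of a cyclic sum y^ρ K^{μν} + ... contains the derivative of K along the
ray plus terms in div K. The former reassembles K; the latter form `divInverse`. -/
theorem sum_pd_potential (φ : Test) (hφ : ∫ y, φ y = 1) (K : Fin 4 → Fin 4 → Test)
    (hK : ∀ μ ν, K μ ν = -K ν μ) (μ ν : Fin 4) :
    K μ ν = ∑ ρ, pd ρ (potential φ K ρ μ ν) + divInverse φ (tensorDiv K) μ ν := by
  have hdiv : ∀ μ, ∑ ρ, pd ρ (K μ ρ) = -tensorDiv K μ := fun μ => by
    rw [tensorDiv, ← Finset.sum_neg_distrib]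
    refine Finset.sum_congr rfl fun ρ _ => ?_
    rw [hK μ ρ]
    exact LineDeriv.lineDerivOp_neg _ _
  -- K = (K - φ * K) + φ * K: the first difference is the translation homotopy, and φ * K is the
  -- contraction.
  have h1 : K μ ν = ∑ ρ, rayConv 0 (coordMul ρ φ) (pd ρ (K μ ν))
      + ((2 : ℝ) • rayConv 1 (K μ ν) φ - ∑ ρ, rayConv 2 (coordMul ρ (K μ ν)) (pd ρ φ)) := by
    ext x
    have e1 := sub_convolution_eq φ (K μ ν) hφ x
    have e2 := convolution_eq φ (K μ ν) x
    rw [convolution_comm] at e1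
    simp only [_root_.add_apply, _root_.sub_apply, _root_.smul_apply, _root_.sum_apply,
      smul_eq_mul]
    linarith
  -- In the last two summands the derivative is integrated by parts from φ onto the weight, where
  -- the product rule gives Kronecker terms. Summed over ρ, each becomes K^{νμ} = -K^{μν}. Together
  -- they supply the term 2 `rayConv 1 (K μ ν) φ` of `h1`.
  have h2 : ∀ ρ, pd ρ (potential φ K ρ μ ν) =
      (rayConv 0 (coordMul ρ φ) (pd ρ (K μ ν)) + rayConv 0 (coordMul μ φ) (pd ρ (K ν ρ))
        + rayConv 0 (coordMul ν φ) (pd ρ (K ρ μ)))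
      - (rayConv 2 (coordMul ρ (K μ ν)) (pd ρ φ)
        + rayConv 1 ((if μ = ρ then K ν ρ else 0) + coordMul μ (pd ρ (K ν ρ))) φ
        + rayConv 1 ((if ν = ρ then K ρ μ else 0) + coordMul ν (pd ρ (K ρ μ))) φ) := fun ρ => by
    unfold potential pd
    simp only [lineDerivOp_sub, LineDeriv.lineDerivOp_add, lineDerivOp_rayConv]
    rw [← pd_coordMul, ← pd_coordMul, ← rayConv_succ_pd, ← rayConv_succ_pd]
  have h3 : ∀ (j : ℕ) (g : Fin 4 → Test) (f : Test),
      ∑ ρ, rayConv j (g ρ) f = rayConv j (∑ ρ, g ρ) f := fun j g f => by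
    rw [map_sum, LinearMap.sum_apply]
  simp only [h2]
  rw [Finset.sum_sub_distrib, Finset.sum_add_distrib, Finset.sum_add_distrib,
    Finset.sum_add_distrib, Finset.sum_add_distrib, ← map_sum (rayConv 0 (coordMul μ φ)),
    ← map_sum (rayConv 0 (coordMul ν φ)), h3, h3, Finset.sum_add_distrib, Finset.sum_add_distrib,
    ← map_sum (coordMul μ), ← map_sum (coordMul ν), hdiv]
  simp only [Finset.sum_ite_eq, Finset.mem_univ, if_true]
  conv_lhs => rw [h1]
  rw [show ∑ ρ, pd ρ (K ρ μ) = tensorDiv K μ from rfl, hK ν μ]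
  unfold divInverse
  simp only [map_add, map_neg, LinearMap.add_apply, LinearMap.neg_apply, two_smul]
  abel

/-- Relabelling the summation indices shows that the three cyclic sums are equal, so three times the
sum vanishes. -/
theorem sum_cyclic_eq_zero {M : Type*} [AddCommGroup M] [Module ℝ M] {ι : Type*} [Fintype ι]
    (T : ι → ι → ι → M) (hT : ∀ ρ μ ν, T ρ μ ν + T μ ν ρ + T ν ρ μ = 0) :
    ∑ μ, ∑ ν, ∑ ρ, T ρ μ ν = 0 := by
  have h1 : ∑ μ, ∑ ν, ∑ ρ, T μ ν ρ = ∑ μ, ∑ ν, ∑ ρ, T ρ μ ν := by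
    rw [Finset.sum_comm]
    exact Finset.sum_congr rfl fun _ _ => Finset.sum_comm
  have h2 : ∑ μ, ∑ ν, ∑ ρ, T ν ρ μ = ∑ μ, ∑ ν, ∑ ρ, T μ ν ρ := by
    rw [Finset.sum_comm]
    exact Finset.sum_congr rfl fun _ _ => Finset.sum_comm
  have h3 : ∑ μ, ∑ ν, ∑ ρ, (T ρ μ ν + T μ ν ρ + T ν ρ μ) = 0 :=
    Finset.sum_eq_zero fun _ _ => Finset.sum_eq_zero fun _ _ => Finset.sum_eq_zero fun _ _ =>
      hT _ _ _
  simp only [Finset.sum_add_distrib] at h3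
  rw [h2, h1] at h3
  have h4 : (3 : ℝ) • ∑ μ, ∑ ν, ∑ ρ, T ρ μ ν = 0 := by
    rw [show (3 : ℝ) = 1 + 1 + 1 by norm_num, add_smul, add_smul, one_smul, h3]
  exact (smul_eq_zero.mp h4).resolve_left (by norm_num)

variable {H : Type*} [NormedAddCommGroup H] [InnerProductSpace ℂ H] [CompleteSpace H]

/-- Translation of test functions. -/
def translate (p : Mink) : Test →ₗ[ℝ] Test := (SchwartzMap.compSubConstCLM ℝ p).toLinearMap

theorem translate_apply (p : Mink) (f : Test) (x : Mink) : translate p f x = f (x - p) := rfl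

theorem pd_translate (ρ : Fin 4) (p : Mink) (f : Test) :
    pd ρ (translate p f) = translate p (pd ρ f) := by
  ext x
  rw [translate_apply, SchwartzMap.lineDerivOp_apply_eq_fderiv,
    SchwartzMap.lineDerivOp_apply_eq_fderiv]
  exact congrArg (fun L : Mink →L[ℝ] ℝ => L (Pi.single ρ 1))
    (fderiv_comp_sub (𝕜 := ℝ) (f := (f : Mink → ℝ)) (x := x) p)

theorem translate_translate_neg (p : Mink) (f : Test) : translate p (translate (-p) f) = f := by
  ext x
  simp [translate_apply]

/-- By the first Maxwell equation, the smeared field depends only on the divergence of an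
antisymmetric tensor. -/
theorem EMField.sum_eq_divInverse (Q : EMField H) (φ : Test) (hφ : ∫ y, φ y = 1) (p : Mink)
    (K : Fin 4 → Fin 4 → Test) (hK : ∀ μ ν, K μ ν = -K ν μ) :
    ∑ μ, ∑ ν, Q.F μ ν (K μ ν) = ∑ μ, ∑ ν,
      Q.F μ ν (translate p (divInverse φ (fun ν => translate (-p) (tensorDiv K ν)) μ ν)) := by
  set K' : Fin 4 → Fin 4 → Test := fun μ ν => translate (-p) (K μ ν) with hK'
  have hD : tensorDiv K' = fun ν => translate (-p) (tensorDiv K ν) := by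
    funext ν
    simp only [tensorDiv, hK', pd_translate, map_sum]
  rw [← hD]
  have h1 : ∑ μ, ∑ ν, ∑ ρ, Q.F μ ν (pd ρ (translate p (potential φ K' ρ μ ν))) = 0 := by
    refine sum_cyclic_eq_zero
      (fun ρ μ ν => Q.F μ ν (pd ρ (translate p (potential φ K' ρ μ ν)))) fun ρ μ ν => ?_
    have := Q.maxwell ρ μ ν (translate p (potential φ K' ρ μ ν))
    rwa [potential_cyclic φ K' ρ μ ν, ← potential_cyclic φ K' ν ρ μ]
  have h2 : ∀ μ ν, Q.F μ ν (K μ ν) =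
      ∑ ρ, Q.F μ ν (pd ρ (translate p (potential φ K' ρ μ ν)))
      + Q.F μ ν (translate p (divInverse φ (tensorDiv K') μ ν)) := fun μ ν => by
    have h3 := sum_pd_potential φ hφ K' (fun μ ν => by simp only [hK', hK μ ν, map_neg]) μ ν
    conv_lhs => rw [← translate_translate_neg p (K μ ν),
      show translate (-p) (K μ ν) = K' μ ν from rfl, h3]
    simp only [map_add, map_sum, pd_translate]
  simp only [h2, Finset.sum_add_distrib]
  rw [h1, zero_add]

/-- `divInverse` is linear in the divergence, so it vanishes here whatever bump and centre are used.
No control of supports is needed. -/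
theorem EMField.sum_eq_zero (Q : EMField H) (K : Fin 4 → Fin 4 → Test)
    (hK : ∀ μ ν, K μ ν = -K ν μ) (hD : tensorDiv K = 0) : ∑ μ, ∑ ν, Q.F μ ν (K μ ν) = 0 := by
  obtain ⟨φ, hφ, -⟩ := exists_test_integral_eq_one one_pos
  rw [Q.sum_eq_divInverse φ hφ 0 K hK, hD]
  refine Finset.sum_eq_zero fun μ _ => Finset.sum_eq_zero fun ν _ => ?_
  simp [divInverse]

/-- Terms of power 0 move a point of the support of D by less than ε. Terms of power 1 place a bump
of radius ε at a point sz of the segment from 0 to a point z of that support. -/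
theorem divInverse_support {φ : Test} {ε : ℝ} (hφ : ∀ x, φ x ≠ 0 → ‖x‖ < ε) {D : Fin 4 → Test}
    {C : Set Mink} (hC : ∀ ν x, D ν x ≠ 0 → ∀ s ∈ Icc (0 : ℝ) 1, s • x ∈ C) {μ ν : Fin 4}
    {x : Mink} (hx : divInverse φ D μ ν x ≠ 0) : x ∈ Metric.cthickening ε C := by
  have h0 : ∀ ρ κ, rayConv 0 (coordMul ρ φ) (D κ) x ≠ 0 → x ∈ Metric.cthickening ε C := by
    intro ρ κ h
    obtain ⟨s, hs, z, hz, hd⟩ := exists_of_rayConv_ne_zero h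
    rw [coordMul_apply] at hz
    have h1 := hC κ _ hd 1 ⟨zero_le_one, le_rfl⟩
    rw [one_smul] at h1
    refine Metric.mem_cthickening_of_dist_le x _ ε C h1 ?_
    rw [dist_eq_norm, sub_sub_cancel, norm_smul, Real.norm_of_nonneg hs.1]
    have h2 := hφ z (right_ne_zero_of_mul hz)
    nlinarith [norm_nonneg z, hs.1, hs.2]
  have h1 : ∀ ρ κ, rayConv 1 (coordMul ρ (D κ)) φ x ≠ 0 → x ∈ Metric.cthickening ε C := by
    intro ρ κ h
    obtain ⟨s, hs, z, hz, hd⟩ := exists_of_rayConv_ne_zero h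
    rw [coordMul_apply] at hz
    refine Metric.mem_cthickening_of_dist_le x _ ε C
      (hC κ z (right_ne_zero_of_mul hz) s hs) ?_
    rw [dist_eq_norm]
    exact (hφ _ hd).le
  by_contra hn
  refine hx ?_
  have h0' : ∀ ρ κ, rayConv 0 (coordMul ρ φ) (D κ) x = 0 := fun ρ κ => by
    by_contra h; exact hn (h0 ρ κ h)
  have h1' : ∀ ρ κ, rayConv 1 (coordMul ρ (D κ)) φ x = 0 := fun ρ κ => by
    by_contra h; exact hn (h1 ρ κ h)
  simp only [divInverse, _root_.add_apply, _root_.sub_apply, h0', h1']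
  norm_num

/-- If the divergence of an antisymmetric tensor vanishes outside a compact subset of a convex open
set, then the tensor may be replaced by one supported in that set. -/
theorem EMField.exists_sum_eq_of_divergence (Q : EMField H) {o S : Set Mink} (ho : IsOpen o)
    (hoc : Convex ℝ o) (hne : o.Nonempty) (hS : IsCompact S) (hSo : S ⊆ o)
    (K : Fin 4 → Fin 4 → Test) (hK : ∀ μ ν, K μ ν = -K ν μ)
    (hD : ∀ ν x, tensorDiv K ν x ≠ 0 → x ∈ S) :
    ∃ G : Fin 4 → Fin 4 → Test, (∀ μ ν, tsupport (G μ ν) ⊆ o) ∧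
      ∑ μ, ∑ ν, Q.F μ ν (K μ ν) = ∑ μ, ∑ ν, Q.F μ ν (G μ ν) := by
  obtain ⟨p, hp⟩ := hne
  -- The union of the segments from p to S, shifted so that p becomes the origin. Convexity keeps it
  -- in o, and compactness leaves room for a bump of some radius ε.
  set C : Set Mink := (fun q : ℝ × Mink => q.1 • (q.2 - p)) '' (Icc (0 : ℝ) 1 ×ˢ S) with hCdef
  have hC : IsCompact C := (isCompact_Icc.prod hS).image (by fun_prop)
  have hCo : C ⊆ (fun x => x + p) ⁻¹' o := by
    rintro _ ⟨⟨s, z⟩, ⟨hs, hz⟩, rfl⟩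
    have h1 := hoc hp (hSo hz) (sub_nonneg.mpr hs.2) hs.1 (by ring)
    have h2 : s • (z - p) + p = (1 - s) • p + s • z := by
      rw [sub_smul, smul_sub, one_smul]; abel
    change s • (z - p) + p ∈ o
    rwa [h2]
  obtain ⟨ε, hε, hεo⟩ := hC.exists_cthickening_subset_open
    (ho.preimage (by fun_prop : Continuous fun x : Mink => x + p)) hCo
  obtain ⟨φ, hφ, hφε⟩ := exists_test_integral_eq_one hε
  have hcl : IsClosed ((fun x => x - p) ⁻¹' Metric.cthickening ε C) :=
    Metric.isClosed_cthickening.preimage (by fun_prop)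
  set D : Fin 4 → Test := fun ν => translate (-p) (tensorDiv K ν) with hDdef
  have hDC : ∀ ν x, D ν x ≠ 0 → ∀ s ∈ Icc (0 : ℝ) 1, s • x ∈ C := fun ν y hy s hs => by
    have hy' : tensorDiv K ν (y + p) ≠ 0 := by
      rwa [hDdef, translate_apply, sub_neg_eq_add] at hy
    exact ⟨(s, y + p), ⟨hs, hD ν _ hy'⟩, by simp⟩
  have hsupp : ∀ μ ν x, translate p (divInverse φ D μ ν) x ≠ 0 →
      x - p ∈ Metric.cthickening ε C := fun μ ν x hx =>
    divInverse_support hφε hDC hx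
  refine ⟨fun μ ν => translate p (divInverse φ D μ ν), fun μ ν => ?_,
    Q.sum_eq_divInverse φ hφ p K hK⟩
  refine (closure_minimal (hsupp μ ν) hcl).trans fun x hx => ?_
  simpa using hεo hx

end Homotopy

/-! ### Double cones are open, convex and bounded -/

section DoubleCones

theorem minkInner_self (v : Mink) :
    minkInner v v = v 0 ^ 2 - (v 1 ^ 2 + v 2 ^ 2 + v 3 ^ 2) := by
  simp only [minkInner, metric, Matrix.mulVec_diagonal, dotProduct, Fin.sum_univ_four]
  simp
  ring

theorem smul_mem_forwardCone {v : Mink} (hv : v ∈ forwardCone) {a : ℝ} (ha : 0 < a) :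
    a • v ∈ forwardCone := by
  obtain ⟨h1, h2⟩ := hv
  rw [minkInner_self] at h1
  refine ⟨?_, ?_⟩
  · rw [minkInner_self]
    simp only [Pi.smul_apply, smul_eq_mul]
    have : 0 < a ^ 2 * (v 0 ^ 2 - (v 1 ^ 2 + v 2 ^ 2 + v 3 ^ 2)) := by positivity
    linarith
  · simp only [Pi.smul_apply, smul_eq_mul]
    positivity

/-- By the Cauchy–Schwarz inequality the spatial inner product is smaller in modulus than the
product of the times, so the cross term of the Minkowski square is positive. -/
theorem add_mem_forwardCone {v w : Mink} (hv : v ∈ forwardCone) (hw : w ∈ forwardCone) :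
    v + w ∈ forwardCone := by
  obtain ⟨h1, h2⟩ := hv
  obtain ⟨h3, h4⟩ := hw
  rw [minkInner_self] at h1 h3
  refine ⟨?_, by simpa using add_pos h2 h4⟩
  rw [minkInner_self]
  simp only [Pi.add_apply]
  set r := v 1 * w 1 + v 2 * w 2 + v 3 * w 3 with hr
  have cs : r ^ 2 ≤ (v 1 ^ 2 + v 2 ^ 2 + v 3 ^ 2) * (w 1 ^ 2 + w 2 ^ 2 + w 3 ^ 2) := by
    rw [hr]
    nlinarith [sq_nonneg (v 1 * w 2 - v 2 * w 1), sq_nonneg (v 1 * w 3 - v 3 * w 1),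
      sq_nonneg (v 2 * w 3 - v 3 * w 2)]
  have hlt : r ^ 2 < (v 0 * w 0) ^ 2 := by
    refine cs.trans_lt ?_
    rw [mul_pow]
    exact mul_lt_mul'' (by linarith) (by linarith) (by positivity) (by positivity)
  have h5 : |r| < v 0 * w 0 := abs_lt_of_sq_lt_sq hlt (by positivity)
  nlinarith [le_abs_self r]

theorem convex_doubleCone (p q : Mink) : Convex ℝ (doubleCone p q) := by
  refine convex_iff_forall_pos.mpr ?_
  rintro x ⟨hx1, hx2⟩ y ⟨hy1, hy2⟩ a b ha hb hab
  have h : ∀ z : Mink, z = a • z + b • z := fun z => by rw [← add_smul, hab, one_smul]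
  refine ⟨?_, ?_⟩
  · have := add_mem_forwardCone (smul_mem_forwardCone hx1 ha) (smul_mem_forwardCone hy1 hb)
    rw [h p]
    convert this using 1
    simp only [smul_sub]
    abel
  · have := add_mem_forwardCone (smul_mem_forwardCone hx2 ha) (smul_mem_forwardCone hy2 hb)
    rw [h q]
    convert this using 1
    simp only [smul_sub]
    abel

theorem isOpen_forwardCone : IsOpen forwardCone := by
  have : forwardCone = {v : Mink | 0 < v 0 ^ 2 - (v 1 ^ 2 + v 2 ^ 2 + v 3 ^ 2)} ∩ {v | 0 < v 0} := by
    ext v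
    rw [mem_inter_iff, mem_ofPred_eq, ← minkInner_self]
    rfl
  rw [this]
  exact (isOpen_lt continuous_const (by fun_prop)).inter (isOpen_lt continuous_const (by fun_prop))

theorem isOpen_doubleCone (p q : Mink) : IsOpen (doubleCone p q) :=
  (isOpen_forwardCone.preimage (by fun_prop : Continuous fun x : Mink => x - p)).inter
    (isOpen_forwardCone.preimage (by fun_prop : Continuous fun x : Mink => q - x))

theorem doubleCone_nonempty {p q : Mink} (h : q - p ∈ forwardCone) : (doubleCone p q).Nonempty := by
  have h1 := smul_mem_forwardCone h (a := 1 / 2) (by norm_num)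
  refine ⟨p + (1 / 2 : ℝ) • (q - p), by simpa using h1, ?_⟩
  have h2 : q - (p + (1 / 2 : ℝ) • (q - p)) = (1 / 2 : ℝ) • (q - p) := by
    ext i
    simp only [Pi.sub_apply, Pi.add_apply, Pi.smul_apply, smul_eq_mul]
    ring
  rwa [h2]

/-- The time of x lies between those of the tips, and spatial distances from p are dominated by
elapsed time. -/
theorem isBounded_doubleCone (p q : Mink) : Bornology.IsBounded (doubleCone p q) := by
  refine (Metric.isBounded_closedBall (x := p) (r := |q 0 - p 0|)).subset ?_
  rintro x ⟨⟨h1, h2⟩, -, h3⟩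
  rw [minkInner_self] at h1
  simp only [Pi.sub_apply] at h1 h2 h3
  rw [mem_closedBall_iff_norm, pi_norm_le_iff_of_nonneg (abs_nonneg _)]
  intro i
  have h4 : |(x - p) i| ≤ |x 0 - p 0| := by
    refine sq_le_sq.mp ?_
    simp only [Pi.sub_apply]
    fin_cases i <;> simp only [Fin.zero_eta, Fin.mk_one, Fin.reduceFinMk] <;>
      nlinarith [sq_nonneg (x 1 - p 1), sq_nonneg (x 2 - p 2), sq_nonneg (x 3 - p 3)]
  refine h4.trans ?_
  rw [abs_of_pos h2, abs_of_pos (by linarith)]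
  linarith

end DoubleCones

/-! ### Surface integrals of the field: dependence on the boundary and causality -/

section Surface

theorem smear_antisymm (σ : SingSimplex 2) (f : Test) (μ ν : Fin 4) :
    smear σ f ![μ, ν] = -smear σ f ![ν, μ] := by
  ext x
  change smearFun σ f ![μ, ν] x = -smearFun σ f ![ν, μ] x
  unfold smearFun
  rw [← integral_neg]
  refine integral_congr_ae (Filter.Eventually.of_forall fun t => ?_)
  simp only [jacobian_two]
  ring

/-- The tensor `½ σ[f]^{μν}`. -/
def surfaceTensor (σ : SingSimplex 2) (f : Test) (μ ν : Fin 4) : Test :=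
  (1 / 2 : ℝ) • smear σ f ![μ, ν]

theorem surfaceTensor_antisymm (σ : SingSimplex 2) (f : Test) (μ ν : Fin 4) :
    surfaceTensor σ f μ ν = -surfaceTensor σ f ν μ := by
  rw [surfaceTensor, smear_antisymm, smul_neg, surfaceTensor]

theorem tensorDiv_surfaceTensor (σ : SingSimplex 2) (f : Test) (ν : Fin 4) :
    tensorDiv (surfaceTensor σ f) ν = -((1 / 2 : ℝ) • chainForm σ.boundary f fun _ => ν) := by
  ext x
  have h := divergence_smear σ f ν x
  simp only [tensorDiv, surfaceTensor, pd, LineDeriv.lineDerivOp_smul, _root_.sum_apply,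
    _root_.smul_apply, _root_.neg_apply, smul_eq_mul]
  rw [← Finset.mul_sum, h]
  ring

variable {H : Type*} [NormedAddCommGroup H] [InnerProductSpace ℂ H] [CompleteSpace H]

/-- The field is only real linear in the test function, so the complex scalar ½ must become real
before it is absorbed into the tensor. -/
theorem EMField.surface_eq (Q : EMField H) (σ : SingSimplex 2) (f : SmearingFn) :
    Q.surface σ f = ∑ μ, ∑ ν, Q.F μ ν (surfaceTensor σ f.1 μ ν) := by
  have h : ∀ T : Q.D →ₗ[ℂ] Q.D, (1 / 2 : ℂ) • T = (1 / 2 : ℝ) • T := fun T => by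
    refine LinearMap.ext fun ψ => Subtype.ext ?_
    change (1 / 2 : ℂ) • (T ψ : H) = (1 / 2 : ℝ) • (T ψ : H)
    rw [← Complex.coe_smul]
    norm_num
  simp only [EMField.surface, surfaceTensor, map_smul, Finset.smul_sum, h]

theorem EMField.isEssSelfAdjoint_surface (Q : EMField H) (σ : SingSimplex 2) (f : SmearingFn) :
    IsEssSelfAdjoint (Q.surface σ f) := by
  rw [Q.surface_eq]
  exact Q.essSelfAdjoint₂ _

/-- The surface integral depends only on the boundary of the surface. -/
theorem EMField.surface_eq_of_boundary_eq (Q : EMField H) {σ σ' : SingSimplex 2}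
    (h : σ.boundary = σ'.boundary) (f : SmearingFn) : Q.surface σ f = Q.surface σ' f := by
  rw [Q.surface_eq, Q.surface_eq, ← sub_eq_zero]
  simp only [← Finset.sum_sub_distrib, ← map_sub]
  refine Q.sum_eq_zero (fun μ ν => surfaceTensor σ f.1 μ ν - surfaceTensor σ' f.1 μ ν)
    (fun μ ν => ?_) ?_
  · rw [surfaceTensor_antisymm σ, surfaceTensor_antisymm σ']
    abel
  · funext ν
    simp only [tensorDiv, pd, lineDerivOp_sub, Finset.sum_sub_distrib]
    have h1 := tensorDiv_surfaceTensor σ f.1 ν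
    have h2 := tensorDiv_surfaceTensor σ' f.1 ν
    simp only [tensorDiv, pd] at h1 h2
    rw [h1, h2, h, sub_self, Pi.zero_apply]

/-- If the boundary of a smearing surface is supported in a double cone, then its surface integral
is an integral of the field against a tensor supported there. -/
theorem EMField.exists_surface_eq (Q : EMField H) (σ : SingSimplex 2) (f : SmearingFn)
    {o : Set Mink} (ho : o ∈ doubleCones) (hs : chainSupport σ.boundary f.1 ⊆ o) :
    ∃ G : Fin 4 → Fin 4 → Test, (∀ μ ν, tsupport (G μ ν) ⊆ o) ∧
      Q.surface σ f = ∑ μ, ∑ ν, Q.F μ ν (G μ ν) := by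
  obtain ⟨p, q, hpq, rfl⟩ := ho
  rw [Q.surface_eq]
  have hS : IsCompact (chainSupport σ.boundary f.1) :=
    Metric.isCompact_of_isClosed_isBounded isClosed_closure ((isBounded_doubleCone p q).subset hs)
  refine Q.exists_sum_eq_of_divergence (isOpen_doubleCone p q) (convex_doubleCone p q)
    (doubleCone_nonempty hpq) hS hs _ (surfaceTensor_antisymm σ f.1) fun ν x hx => ?_
  refine subset_closure ⟨fun _ => ν, fun h => hx ?_⟩
  rw [tensorDiv_surfaceTensor]
  simp only [_root_.neg_apply, _root_.smul_apply, h, smul_zero, neg_zero]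

theorem CausallyDisjoint.mono {X Y X' Y' : Set Mink} (h : CausallyDisjoint X Y) (hX : X' ⊆ X)
    (hY : Y' ⊆ Y) : CausallyDisjoint X' Y' :=
  fun x hx y hy => h x (hX hx) y (hY hy)

/-- Field operators smeared with tensors of causally disjoint supports commute, in the sense that
their exponentials do. -/
theorem EMField.commute_exp_sum (Q : EMField H) {o₁ o₂ : Set Mink} (ho : CausallyDisjoint o₁ o₂)
    {G₁ G₂ : Fin 4 → Fin 4 → Test} (h₁ : ∀ μ ν, tsupport (G₁ μ ν) ⊆ o₁)
    (h₂ : ∀ μ ν, tsupport (G₂ μ ν) ⊆ o₂) {u v : unitary (H →L[ℂ] H)}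
    (hu : IsExpI (∑ μ, ∑ ν, Q.F μ ν (G₁ μ ν)) u) (hv : IsExpI (∑ μ, ∑ ν, Q.F μ ν (G₂ μ ν)) v) :
    u * v = v * u := by
  have hsmul : ∀ (t : ℝ) (f : Test), tsupport (t • f : Test) ⊆ tsupport f := fun t f =>
    closure_mono fun x hx hf => hx (by simp [hf])
  have hess : ∀ (μ ν : Fin 4) (f : Test) (t : ℝ), IsEssSelfAdjoint (t • Q.F μ ν f) :=
    fun μ ν f t => by
      rw [← map_smul]
      exact Q.essSelfAdjoint _ _ _
  have hpair : ∀ G : Fin 4 → Fin 4 → Test, ∑ μ, ∑ ν, Q.F μ ν (G μ ν)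
      = ∑ i : Fin 4 × Fin 4, Q.F i.1 i.2 (G i.1 i.2) := fun G => by
    rw [Fintype.sum_prod_type]
  have hS : ∀ G : Fin 4 → Fin 4 → Test,
      IsEssSelfAdjoint (∑ i : Fin 4 × Fin 4, Q.F i.1 i.2 (G i.1 i.2)) := fun G => by
    rw [← hpair]
    exact Q.essSelfAdjoint₂ G
  rw [hpair] at hu hv
  -- The passage to sums is made twice: u commutes with exp of the second sum if it commutes with
  -- each of its components, and this in turn reduces to components of the first sum.
  refine commute_isExpI_sum Finset.univ (A := fun i : Fin 4 × Fin 4 => Q.F i.1 i.2 (G₂ i.1 i.2))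
    (fun i _ t => hess _ _ _ t) (hS G₂) (fun i _ t v' hv' => ?_) hv
  refine Eq.symm (commute_isExpI_sum Finset.univ
    (A := fun i : Fin 4 × Fin 4 => Q.F i.1 i.2 (G₁ i.1 i.2))
    (fun i _ t => hess _ _ _ t) (hS G₁) (fun j _ s u' hu' => ?_) hu)
  rw [← map_smul] at hv' hu'
  exact (Q.causality _ _ _ _ _ _ (ho.mono ((hsmul s _).trans (h₁ j.1 j.2))
    ((hsmul t _).trans (h₂ i.1 i.2))) u' v' hu' hv').symm

end Surface

/-! ### Poincaré covariance of the surface integral -/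

section Covariance

/-- A Lorentz matrix satisfies L⁻¹ = gLᵀg, so moving both indices with g leaves Lᵀ. The coefficients
of the field's covariance law thus become those by which contravariant tensors transform. -/
theorem lowerUpper_inv (L : restrictedLorentz) (μ α : Fin 4) :
    lowerUpper (lmat L⁻¹) μ α = lmat L α μ := by
  have h : lmat L⁻¹ = metric * (lmat L)ᵀ * metric :=
    lorentz_inv L.2.1 (Poincare.lmat_mul_inv L)
  have h2 : lowerUpper (lmat L⁻¹) = (lmat L)ᵀ := by
    rw [lowerUpper, h]
    calc metric * (metric * (lmat L)ᵀ * metric) * metric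
        = (metric * metric) * (lmat L)ᵀ * (metric * metric) := by simp only [Matrix.mul_assoc]
      _ = (lmat L)ᵀ := by rw [metric_mul_metric, Matrix.one_mul, Matrix.mul_one]
  rw [h2, Matrix.transpose_apply]

theorem jacobian_poincare (σ : SingSimplex 2) (P : Poincare) (α β : Fin 4) {t : Fin 2 → ℝ}
    (ht : t ∈ interior (Delta 2)) (hd : DifferentiableAt ℝ (extendZero σ.toFun) t) :
    (σ.poincare P).jacobian ![α, β] t =
      ∑ μ, ∑ ν, lmat P.lor α μ * lmat P.lor β ν * σ.jacobian ![μ, ν] t := by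
  have h1 : extendZero (σ.poincare P).toFun =ᶠ[nhds t] P.act ∘ extendZero σ.toFun := by
    filter_upwards [mem_interior_iff_mem_nhds.mp ht] with u hu
    rw [extendZero_apply _ hu, Function.comp_apply, extendZero_apply _ hu]
    rfl
  have h2 : HasFDerivAt (P.act ∘ extendZero σ.toFun)
      ((lorentzEquiv P.lor : Mink →L[ℝ] Mink).comp (fderiv ℝ (extendZero σ.toFun) t)) t :=
    ((lorentzEquiv P.lor : Mink →L[ℝ] Mink).hasFDerivAt.const_add P.trans).comp t hd.hasFDerivAt
  have h3 : ∀ (v : Fin 2 → ℝ) (α : Fin 4), fderiv ℝ (extendZero (σ.poincare P).toFun) t v α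
      = ∑ μ, lmat P.lor α μ * fderiv ℝ (extendZero σ.toFun) t v μ := fun v α => by
    rw [h1.fderiv_eq, h2.fderiv]
    rfl
  simp only [jacobian_two, h3, Finset.sum_mul_sum]
  rw [← Finset.sum_sub_distrib]
  refine Finset.sum_congr rfl fun μ _ => ?_
  rw [← Finset.sum_sub_distrib]
  exact Finset.sum_congr rfl fun ν _ => by ring

/-- The Jacobian of Pσ contributes one factor L per index, and the points match because L⁻¹(x -
Pσ(t)) = P⁻¹x - σ(t). -/
theorem smear_poincare (σ : SingSimplex 2) (P : Poincare) (f : Test) (α β : Fin 4) :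
    smear (σ.poincare P) (testLor P.lor f) ![α, β] =
      ∑ μ, ∑ ν, (lmat P.lor α μ * lmat P.lor β ν) • testAct P (smear σ f ![μ, ν]) := by
  ext x
  simp only [_root_.sum_apply, _root_.smul_apply, testAct_apply, smul_eq_mul]
  change smearFun _ _ _ x = ∑ μ, ∑ ν, _ * smearFun _ _ _ _
  unfold smearFun
  have hint : ∀ μ ν, Integrable (fun t => f (P⁻¹.act x - extendZero σ.toFun t)
      * σ.jacobian ![μ, ν] t) (volume.restrict (Delta 2)) := fun μ ν =>
    integrable_superposition ((continuousOn_extendZero σ).aestronglyMeasurable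
      (isCompact_Delta 2).measurableSet) (integrable_jacobian σ _) f _
  simp only [← integral_const_mul]
  have hsum : ∀ μ, ∑ ν, ∫ t in Delta 2, lmat P.lor α μ * lmat P.lor β ν *
      (f (P⁻¹.act x - extendZero σ.toFun t) * σ.jacobian ![μ, ν] t)
      = ∫ t in Delta 2, ∑ ν, lmat P.lor α μ * lmat P.lor β ν *
      (f (P⁻¹.act x - extendZero σ.toFun t) * σ.jacobian ![μ, ν] t) := fun μ =>
    (integral_finsetSum _ fun ν _ => (hint μ ν).const_mul _).symm
  simp only [hsum]
  rw [← integral_finsetSum _ fun μ _ => integrable_finsetSum _ fun ν _ => (hint μ ν).const_mul _]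
  refine integral_congr_ae ?_
  filter_upwards [ae_differentiableAt_extendZero σ] with t ht
  have htD := interior_subset ht.1
  have h1 : testLor P.lor f (x - extendZero (σ.poincare P).toFun t)
      = f (P⁻¹.act x - extendZero σ.toFun t) := by
    rw [testLor_apply, extendZero_apply _ htD, extendZero_apply _ htD]
    congr 1
    change lmat P.lor⁻¹ *ᵥ (x - (P.trans + lmat P.lor *ᵥ σ.toFun ⟨t, htD⟩))
      = -(lmat P.lor⁻¹ *ᵥ P.trans) + lmat P.lor⁻¹ *ᵥ x - σ.toFun ⟨t, htD⟩
    rw [Matrix.mulVec_sub, Matrix.mulVec_add, Matrix.mulVec_mulVec, Poincare.lmat_inv_mul,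
      Matrix.one_mulVec]
    abel
  rw [h1, jacobian_poincare σ P α β ht.1 ht.2]
  simp only [Finset.mul_sum]
  exact Finset.sum_congr rfl fun μ _ => Finset.sum_congr rfl fun ν _ => by ring

theorem testAct_smul (P : Poincare) (c : ℝ) (f : Test) : testAct P (c • f) = c • testAct P f := by
  ext x
  simp only [testAct_apply, _root_.smul_apply]

theorem surfaceTensor_poincare (σ : SingSimplex 2) (P : Poincare) (f : Test) (α β : Fin 4) :
    surfaceTensor (σ.poincare P) (testLor P.lor f) α β =
      ∑ μ, ∑ ν, (lmat P.lor α μ * lmat P.lor β ν) • testAct P (surfaceTensor σ f μ ν) := by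
  simp only [surfaceTensor, smear_poincare, testAct_smul, Finset.smul_sum]
  exact Finset.sum_congr rfl fun μ _ => Finset.sum_congr rfl fun ν _ => smul_comm _ _ _

variable {H : Type*} [NormedAddCommGroup H] [InnerProductSpace ℂ H] [CompleteSpace H]

/-- The same coefficients L^α_μ L^β_ν arise on the left from covariance of the field and on the
right from the transformed surface tensor, so the two contractions agree term by term after
reordering the sums. -/
theorem EMField.U_surface (Q : EMField H) (P : Poincare) (σ : SingSimplex 2) (f : SmearingFn)
    (ψ : Q.D) : (Q.U P : H →L[ℂ] H) (Q.surface σ f ψ) =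
      Q.surface (σ.poincare P) (f.lor P.lor) ⟨(Q.U P : H →L[ℂ] H) ψ, Q.U_mem P ψ ψ.2⟩ := by
  rw [Q.surface_eq, Q.surface_eq]
  have hR : ∀ α β, Q.F α β (surfaceTensor (σ.poincare P) (f.lor P.lor).1 α β) =
      ∑ μ, ∑ ν, (lmat P.lor α μ * lmat P.lor β ν) •
        Q.F α β (testAct P (surfaceTensor σ f.1 μ ν)) := fun α β => by
    rw [show (f.lor P.lor).1 = testLor P.lor f.1 from rfl, surfaceTensor_poincare]
    simp only [map_sum, map_smul]
  simp only [hR, LinearMap.sum_apply, AddSubmonoidClass.coe_finsetSum, map_sum, Q.covariance,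
    lowerUpper_inv]
  have hcomm : ∀ T : Fin 4 → Fin 4 → Fin 4 → Fin 4 → H,
      ∑ μ, ∑ ν, ∑ α, ∑ β, T μ ν α β = ∑ α, ∑ β, ∑ μ, ∑ ν, T μ ν α β := fun T => by
    calc _ = ∑ μ, ∑ α, ∑ ν, ∑ β, T μ ν α β := Finset.sum_congr rfl fun _ _ => Finset.sum_comm
      _ = ∑ α, ∑ μ, ∑ ν, ∑ β, T μ ν α β := Finset.sum_comm
      _ = ∑ α, ∑ μ, ∑ β, ∑ ν, T μ ν α β := Finset.sum_congr rfl fun _ _ =>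
        Finset.sum_congr rfl fun _ _ => Finset.sum_comm
      _ = _ := Finset.sum_congr rfl fun _ _ => Finset.sum_comm
  rw [hcomm]
  refine Finset.sum_congr rfl fun α _ => Finset.sum_congr rfl fun β _ =>
    Finset.sum_congr rfl fun μ _ => Finset.sum_congr rfl fun ν _ => ?_
  exact Complex.coe_smul _ _

theorem EMField.isExpI_surface_poincare (Q : EMField H) (P : Poincare) (σ : SingSimplex 2)
    (f : SmearingFn) {u : unitary (H →L[ℂ] H)} (hu : IsExpI (Q.surface σ f) u) :
    IsExpI (Q.surface (σ.poincare P) (f.lor P.lor)) (Q.U P * u * star (Q.U P)) :=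
  IsExpI.conj (Q.isEssSelfAdjoint_surface σ f) (Q.isEssSelfAdjoint_surface _ _) hu fun ψ => by
    rw [Q.U_surface P σ f ψ]
    exact mem_graph_closure _ ⟨(Q.U P : H →L[ℂ] H) ψ, Q.U_mem P ψ ψ.2⟩

end Covariance

/-! ### The cone over a closed curve -/

section Cone

/-- The cone with apex `0` over a curve. -/
def coneMap (g : (Fin 1 → ℝ) → Mink) (t : Fin 2 → ℝ) : Mink :=
  (t 0 + t 1) • g fun _ => t 1 / (t 0 + t 1)

/-- The homogeneous linear function which agrees with a given affine function on the base of the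
standard triangle. -/
def homogenize (a : (Fin 1 → ℝ) →ᵃ[ℝ] ℝ) : (Fin 2 → ℝ) →ᵃ[ℝ] ℝ :=
  (a.linear (fun _ => 1) • LinearMap.proj (R := ℝ) (φ := fun _ : Fin 2 => ℝ) 1
    + a 0 • (LinearMap.proj (R := ℝ) (φ := fun _ : Fin 2 => ℝ) 0
      + LinearMap.proj (R := ℝ) (φ := fun _ : Fin 2 => ℝ) 1)).toAffineMap

/-- Away from the apex the sign of the homogenization at t is the sign of a at the projected point
of the base, so the pieces of the curve give conical pieces of the triangle. -/
theorem homogenize_apply (a : (Fin 1 → ℝ) →ᵃ[ℝ] ℝ) {t : Fin 2 → ℝ} (ht : t 0 + t 1 ≠ 0) :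
    homogenize a t = (t 0 + t 1) * a fun _ => t 1 / (t 0 + t 1) := by
  have h1 : ∀ x : ℝ, a (fun _ => x) = x * a.linear (fun _ => 1) + a 0 := fun x => by
    have h2 := congrFun a.decomp fun _ => x
    have h3 : (fun _ : Fin 1 => x) = x • fun _ => (1 : ℝ) := by ext; simp
    rw [h2, Pi.add_apply, h3, map_smul, smul_eq_mul]
  rw [h1]
  simp only [homogenize, LinearMap.coe_toAffineMap, LinearMap.add_apply, LinearMap.smul_apply,
    LinearMap.proj_apply, smul_eq_mul]
  field_simp

theorem mem_Delta_one_of_mem_Icc {x : ℝ} (hx : x ∈ Icc (0 : ℝ) 1) :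
    (fun _ : Fin 1 => x) ∈ Delta 1 :=
  ⟨fun _ => hx.1, by simpa using hx.2⟩

theorem cone_ratio_mem {t : Fin 2 → ℝ} (ht : t ∈ Delta 2) :
    (fun _ : Fin 1 => t 1 / (t 0 + t 1)) ∈ Delta 1 := by
  have h0 := ht.1 0
  have h1 := ht.1 1
  exact mem_Delta_one_of_mem_Icc ⟨by positivity, div_le_one_of_le₀ (by linarith) (by positivity)⟩

theorem lipschitzOnWith_coneMap {g : (Fin 1 → ℝ) → Mink} {K : NNReal}
    (hg : LipschitzOnWith K g (Delta 1)) : ∃ C, LipschitzOnWith C (coneMap g) (Delta 2) := by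
  obtain ⟨M, hM⟩ := (isCompact_Delta 1).exists_bound_of_continuousOn hg.continuousOn
  have hM0 : 0 ≤ M := (norm_nonneg _).trans (hM _ (mem_Delta_one_of_mem_Icc ⟨le_rfl, zero_le_one⟩))
  -- Write s, r for the coordinate sums of t, u and a, b for the ratios. Then |s - r| ≤ 2d and s|a -
  -- b| ≤ 3d, where d is the sup distance. The first multiplies the bound M of the curve, the second
  -- its Lipschitz constant K.
  refine ⟨3 * K + 2 * ⟨M, hM0⟩, LipschitzOnWith.of_dist_le_mul fun t ht u hu => ?_⟩
  have hb := cone_ratio_mem hu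
  have ha := cone_ratio_mem ht
  set a := t 1 / (t 0 + t 1) with ha_def
  set b := u 1 / (u 0 + u 1) with hb_def
  have hmul : ∀ {v : Fin 2 → ℝ}, v ∈ Delta 2 → (v 0 + v 1) * (v 1 / (v 0 + v 1)) = v 1 := by
    intro v hv
    refine mul_div_cancel_of_imp' fun h => ?_
    linarith [hv.1 0, hv.1 1]
  have hsa : (t 0 + t 1) * a = t 1 := hmul ht
  have hrb : (u 0 + u 1) * b = u 1 := hmul hu
  have hs0 : 0 ≤ t 0 + t 1 := add_nonneg (ht.1 0) (ht.1 1)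
  have hb0 : 0 ≤ b := hb.1 0
  have hb1 : b ≤ 1 := by simpa using hb.2
  have hd : ∀ i, |t i - u i| ≤ dist t u := fun i => dist_le_pi_dist t u i
  have h1 : |(t 0 + t 1) - (u 0 + u 1)| ≤ 2 * dist t u := by
    have : (t 0 + t 1) - (u 0 + u 1) = (t 0 - u 0) + (t 1 - u 1) := by ring
    rw [this]
    exact (abs_add_le _ _).trans (by linarith [hd 0, hd 1])
  have h2 : (t 0 + t 1) * |a - b| ≤ 3 * dist t u := by
    have h3 : (t 0 + t 1) * |a - b| = |(t 1 - u 1) - ((t 0 + t 1) - (u 0 + u 1)) * b| := by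
      rw [← abs_of_nonneg hs0, ← abs_mul, abs_of_nonneg hs0]
      congr 1
      linear_combination hsa - hrb
    rw [h3]
    refine (abs_sub _ _).trans ?_
    rw [abs_mul, abs_of_nonneg hb0]
    nlinarith [hd 1, abs_nonneg ((t 0 + t 1) - (u 0 + u 1))]
  have h4 : ‖g (fun _ => a) - g (fun _ => b)‖ ≤ K * |a - b| := by
    have := hg.dist_le_mul _ ha _ hb
    rw [dist_eq_norm] at this
    refine this.trans (mul_le_mul_of_nonneg_left ?_ K.2)
    exact (dist_pi_le_iff (abs_nonneg _)).mpr fun _ => le_rfl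
  have h5 : coneMap g t - coneMap g u = (t 0 + t 1) • (g (fun _ => a) - g (fun _ => b))
      + ((t 0 + t 1) - (u 0 + u 1)) • g fun _ => b := by
    simp only [coneMap, ← ha_def, ← hb_def, smul_sub, sub_smul]
    abel
  rw [dist_eq_norm, h5]
  refine (norm_add_le _ _).trans ?_
  rw [norm_smul, norm_smul, Real.norm_of_nonneg hs0, Real.norm_eq_abs]
  have h6 : (t 0 + t 1) * ‖g (fun _ => a) - g (fun _ => b)‖ ≤ K * (3 * dist t u) := by
    calc _ ≤ (t 0 + t 1) * (K * |a - b|) := mul_le_mul_of_nonneg_left h4 hs0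
      _ = K * ((t 0 + t 1) * |a - b|) := by ring
      _ ≤ _ := mul_le_mul_of_nonneg_left h2 K.2
  have h7 : |(t 0 + t 1) - (u 0 + u 1)| * ‖g fun _ => b‖ ≤ 2 * dist t u * M :=
    mul_le_mul h1 (hM _ hb) (norm_nonneg _) (by positivity)
  push_cast
  change _ ≤ (3 * (K : ℝ) + 2 * M) * dist t u
  linarith

/-- The hyperplane t₀ + t₁ = 0 is added to the homogenized ones to isolate the apex, where the ratio
is not smooth. Elsewhere the cone is a composition of smooth maps. -/
theorem piecewiseSmoothOn_coneMap {g : (Fin 1 → ℝ) → Mink} (hg : PiecewiseSmoothOn g) :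
    PiecewiseSmoothOn (coneMap g) := by
  classical
  obtain ⟨⟨K, hK⟩, A, hA⟩ := hg
  refine ⟨lipschitzOnWith_coneMap hK, ?_⟩
  let S : (Fin 2 → ℝ) →ᵃ[ℝ] ℝ := (LinearMap.proj (R := ℝ) (φ := fun _ : Fin 2 => ℝ) 0
      + LinearMap.proj (R := ℝ) (φ := fun _ : Fin 2 => ℝ) 1).toAffineMap
  refine ⟨insert S (A.image homogenize), fun s => ?_⟩
  by_cases hs : s S = 1
  · have hpos : ∀ t ∈ {t ∈ Delta 2 | ∀ a ∈ insert S (A.image homogenize),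
        SignType.sign (a t) = s a}, 0 < t 0 + t 1 := fun t ht =>
      sign_eq_one_iff.mp ((ht.2 S (Finset.mem_insert_self _ _)).trans hs)
    have hmaps : MapsTo (fun (t : Fin 2 → ℝ) (_ : Fin 1) => t 1 / (t 0 + t 1))
        {t ∈ Delta 2 | ∀ a ∈ insert S (A.image homogenize), SignType.sign (a t) = s a}
        {t ∈ Delta 1 | ∀ a ∈ A, SignType.sign (a t) = s (homogenize a)} := by
      intro t ht
      refine ⟨cone_ratio_mem ht.1, fun a ha => ?_⟩
      rw [← ht.2 _ (Finset.mem_insert_of_mem (Finset.mem_image_of_mem _ ha)),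
        homogenize_apply a (hpos t ht).ne', sign_mul, sign_pos (hpos t ht), one_mul]
    have h0 : ∀ i : Fin 2, ContDiff ℝ ∞ fun t : Fin 2 → ℝ => t i := fun i => contDiff_apply ℝ ℝ i
    have hsum : ContDiff ℝ ∞ fun t : Fin 2 → ℝ => t 0 + t 1 := (h0 0).add (h0 1)
    refine ContDiffOn.smul hsum.contDiffOn ((hA fun a => s (homogenize a)).comp ?_ hmaps)
    exact contDiffOn_pi.mpr fun _ =>
      (h0 1).contDiffOn.div hsum.contDiffOn fun t ht => (hpos t ht).ne'
  -- Such a piece contains at most the apex, where the scalar factor is 0 and the junk value of the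
  -- division is harmless.
  · refine (contDiffOn_const (c := (0 : Mink))).congr ?_
    rintro t ⟨ht, hst⟩
    have h1 : ¬ 0 < t 0 + t 1 := fun h => hs <| by
      rw [← hst S (Finset.mem_insert_self _ _)]
      exact sign_pos h
    have h2 := ht.1 0
    have h3 := ht.1 1
    rw [coneMap, le_antisymm (not_lt.mp h1) (add_nonneg h2 h3), zero_smul]

/-- The cone with apex `0` over a curve, as a surface. -/
def SingSimplex.cone (γ : SingSimplex 1) : SingSimplex 2 where
  toFun t := coneMap (extendZero γ.toFun) t
  piecewiseSmooth := by
    obtain ⟨⟨K, hK⟩, A, hA⟩ := piecewiseSmoothOn_coneMap γ.piecewiseSmooth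
    have e : EqOn (extendZero fun t : Delta 2 => coneMap (extendZero γ.toFun) t)
        (coneMap (extendZero γ.toFun)) (Delta 2) := fun t ht => extendZero_apply _ ht
    refine ⟨⟨K, fun t ht u hu => ?_⟩, A, fun s => (hA s).congr fun t ht => e ht.1⟩
    rw [e ht, e hu]
    exact hK ht hu

theorem extendZero_const_eq (γ : SingSimplex 1) (t : Delta 1) {x : ℝ} (hx : x = t.1 0) :
    extendZero γ.toFun (fun _ => x) = γ.toFun t := by
  have h : (fun _ : Fin 1 => x) = t.1 := by
    ext i
    rw [hx, Subsingleton.elim i 0]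
  rw [h, extendZero_apply _ t.2]

theorem vertex_zero_apply : (vertex (0 : Fin 2)).1 0 = 0 := rfl

theorem vertex_one_apply : (vertex (1 : Fin 2)).1 0 = 1 := by
  change (Pi.single (0 : Fin 1) (1 : ℝ) : Fin 1 → ℝ) 0 = 1
  simp

theorem cone_face_zero (γ : SingSimplex 1) : γ.cone.face 0 = γ := by
  ext1
  funext t
  have h0 : faceIncl 0 t.1 0 = 1 - t.1 0 := by simp [faceIncl]
  have h1 : faceIncl 0 t.1 1 = t.1 0 := rfl
  change coneMap (extendZero γ.toFun) (faceIncl 0 t.1) = γ.toFun t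
  rw [coneMap, h0, h1, sub_add_cancel, one_smul]
  exact extendZero_const_eq γ t (div_one _)

theorem cone_face_one (γ : SingSimplex 1) (t : Delta 1) :
    (γ.cone.face 1).toFun t = t.1 0 • γ.toFun (vertex 1) := by
  have h0 : faceIncl 1 t.1 0 = 0 := rfl
  have h1 : faceIncl 1 t.1 1 = t.1 0 := rfl
  change coneMap (extendZero γ.toFun) (faceIncl 1 t.1) = _
  rw [coneMap, h0, h1, zero_add]
  by_cases h : t.1 0 = 0
  · rw [h, zero_smul, zero_smul]
  · rw [extendZero_const_eq γ (vertex 1) (by rw [div_self h, vertex_one_apply])]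

theorem cone_face_two (γ : SingSimplex 1) (t : Delta 1) :
    (γ.cone.face 2).toFun t = t.1 0 • γ.toFun (vertex 0) := by
  have h0 : faceIncl 2 t.1 0 = t.1 0 := rfl
  have h1 : faceIncl 2 t.1 1 = 0 := rfl
  change coneMap (extendZero γ.toFun) (faceIncl 2 t.1) = _
  rw [coneMap, h0, h1, add_zero,
    extendZero_const_eq γ (vertex 0) (by rw [zero_div, vertex_zero_apply])]

/-- A closed curve is the boundary of the cone over it. -/
theorem boundary_cone (γ : SingSimplex 1) (h : γ.toFun (vertex 0) = γ.toFun (vertex 1)) :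
    γ.cone.boundary = Finsupp.single γ 1 := by
  have h12 : γ.cone.face 1 = γ.cone.face 2 := by
    ext1
    funext t
    rw [cone_face_one, cone_face_two, h]
  rw [SingSimplex.boundary, Fin.sum_univ_three, cone_face_zero, h12]
  simp [add_assoc]

end Cone

/-! ### The phases of smearing boundaries -/

section Phase

variable {H : Type*} [NormedAddCommGroup H] [InnerProductSpace ℂ H] [CompleteSpace H]

theorem EMField.exists_phase (Q : EMField H) (c : SmearingBoundary) :
    ∃ u : unitary (H →L[ℂ] H), ∀ σ : SingSimplex 2, σ.boundary = c.1.1 →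
      IsExpI (Q.surface σ c.1.2) u := by
  obtain ⟨σ, hσ⟩ := c.2
  obtain ⟨u, hu⟩ := (Q.isEssSelfAdjoint_surface σ c.1.2).exists_isExpI
  refine ⟨u, fun σ' hσ' => ?_⟩
  rw [Q.surface_eq_of_boundary_eq (hσ'.trans hσ.symm)]
  exact hu

/-- Only the boundary forms, not the surfaces, are assumed to be supported in the double cones. The
surface tensors are therefore first exchanged for tensors supported there. -/
theorem EMField.phase_commute (Q : EMField H) {o₁ o₂ : Set Mink} (ho₁ : o₁ ∈ doubleCones)
    (ho₂ : o₂ ∈ doubleCones) (ho : CausallyDisjoint o₁ o₂) {σ₁ σ₂ : SingSimplex 2}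
    {f₁ f₂ : SmearingFn} (h₁ : chainSupport σ₁.boundary f₁.1 ⊆ o₁)
    (h₂ : chainSupport σ₂.boundary f₂.1 ⊆ o₂) {u₁ u₂ : unitary (H →L[ℂ] H)}
    (hu₁ : IsExpI (Q.surface σ₁ f₁) u₁) (hu₂ : IsExpI (Q.surface σ₂ f₂) u₂) :
    u₁ * u₂ = u₂ * u₁ := by
  obtain ⟨G₁, hG₁, e₁⟩ := Q.exists_surface_eq σ₁ f₁ ho₁ h₁
  obtain ⟨G₂, hG₂, e₂⟩ := Q.exists_surface_eq σ₂ f₂ ho₂ h₂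
  rw [e₁] at hu₁
  rw [e₂] at hu₂
  exact Q.commute_exp_sum ho hG₁ hG₂ hu₁ hu₂

end Phase

end QEM

end

theorem theorem3p3 {H : Type*} [NormedAddCommGroup H] [InnerProductSpace ℂ H] [CompleteSpace H]
    (Q : QEM.EMField H) :
    -- every closed curve is the boundary of a surface
    (∀ γ : QEM.SingSimplex 1, γ.toFun (QEM.vertex 0) = γ.toFun (QEM.vertex 1) →
      ∃ σ : QEM.SingSimplex 2, σ.boundary = Finsupp.single γ 1) ∧
    ∃ w : QEM.SmearingBoundary → unitary (H →L[ℂ] H),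
      -- `w(∂σ, f) = exp(i F⟨σ, f⟩)` for all spanning surfaces, which determines `w`
      (∀ (σ : QEM.SingSimplex 2) (f : QEM.SmearingFn),
        QEM.IsExpI (Q.surface σ f) (w (QEM.SmearingBoundary.of σ f))) ∧
      (∀ w' : QEM.SmearingBoundary → unitary (H →L[ℂ] H),
        (∀ (σ : QEM.SingSimplex 2) (f : QEM.SmearingFn),
          QEM.IsExpI (Q.surface σ f) (w' (QEM.SmearingBoundary.of σ f))) → w' = w) ∧
      -- covariance
      (∀ (P : QEM.Poincare) (c : QEM.SmearingBoundary),
        Q.U P * w c * star (Q.U P) = w (c.poincare P)) ∧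
      -- causality
      (∀ o₁ ∈ QEM.doubleCones, ∀ o₂ ∈ QEM.doubleCones, QEM.CausallyDisjoint o₁ o₂ →
        ∀ c₁ c₂ : QEM.SmearingBoundary, c₁.support ⊆ o₁ → c₂.support ⊆ o₂ →
          w c₁ * w c₂ = w c₂ * w c₁) := by
  choose w hw using Q.exists_phase
  refine ⟨fun γ hγ => ⟨γ.cone, QEM.boundary_cone γ hγ⟩, w,
    fun σ f => hw (QEM.SmearingBoundary.of σ f) σ rfl, ?_, ?_, ?_⟩
  · intro w' hw'
    funext c
    obtain ⟨σ, hσ⟩ := c.2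
    have hc : c = QEM.SmearingBoundary.of σ c.1.2 := Subtype.ext (Prod.ext hσ.symm rfl)
    rw [hc]
    exact QEM.IsExpI.unique (Q.isEssSelfAdjoint_surface σ c.1.2) (hw' σ c.1.2)
      (hw (QEM.SmearingBoundary.of σ c.1.2) σ rfl)
  · intro P c
    obtain ⟨σ, hσ⟩ := c.2
    have hP : (σ.poincare P).boundary = (c.poincare P).1.1 :=
      (QEM.boundary_poincare P σ).trans (congrArg (QEM.chainAct P) hσ)
    exact QEM.IsExpI.unique (Q.isEssSelfAdjoint_surface _ _)
      (Q.isExpI_surface_poincare P σ c.1.2 (hw c σ hσ)) (hw (c.poincare P) (σ.poincare P) hP)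
  · intro o₁ ho₁ o₂ ho₂ ho c₁ c₂ h₁ h₂
    obtain ⟨σ₁, hσ₁⟩ := c₁.2
    obtain ⟨σ₂, hσ₂⟩ := c₂.2
    rw [QEM.SmearingBoundary.support, ← hσ₁] at h₁
    rw [QEM.SmearingBoundary.support, ← hσ₂] at h₂
    exact Q.phase_commute ho₁ ho₂ ho h₁ h₂ (hw c₁ σ₁ hσ₁) (hw c₂ σ₂ hσ₂)
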